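/- **Setting.** Let $\mathfrak g=\mathfrak{sl}(2,\mathbb C)$ with standard basis $e,f,h$ and $(X|Y)=\operatorname{tr}(XY)$. Let $\tilde{\mathfrak g}=\mathfrak g\otimes\mathbb C[t,t^{-1}]\oplus\mathbb Cc\oplus\mathbb Cd$, with $X_n=X\otimes t^n$, $[X_m,Y_n]=[X,Y]_{m+n}+m\delta_{m+n,0}(X|Y)c$, $[d,X_n]=nX_n$ and $c$ central, and let $\hat{\mathfrak g}=\mathfrak g\otimes\mathbb C[t,t^{-1}]\oplus\mathbb Cc$. A weight $\lambda$ of $\mathfrak g$ is identified with the number $\lambda(h)\in\mathbb C$. Fix $\lambda,\kappa\in\mathbb C$ with $\kappa\ne0$ and $\kappa\neq-2$, $m\in\mathbb N=\{0,1,2,\dots\}$ and $\beta\in\mathbb C\setminus\{0\}$. For $\mu\in\mathbb C$ put $$\Delta(\mu)=\frac{\langle\mu,\mu+2\rho\rangle}{2(\kappa+h^\vee)}=\frac{\mu(\mu+2)/2}{2(\kappa+2)} .$$ *Imaginary Verma module.* $V_{\mu,\kappa}$ is the $\tilde{\mathfrak g}$-module induced from the one-dimensional module $\mathbb C v_{\mu,\kappa}$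 on which $e_n$ ($n\in\mathbb Z$) and $h_n$ ($n>0$) act by $0$, and $h_0$, $c$, $d$ act by $\mu$, $\kappa$, $-\Delta(\mu)$. *Imaginary Wakimoto module.* $W_{\mu,\kappa}=\mathbb C[x_n,\,n\in\mathbb Z]\otimes\mathbb C[y_k,\,k>0]$. Let $a_n=x_n$ and $a^*_n=-\partial/\partial x_{-n}$, let $b_{-k}=y_k$ and $b_k=2k\kappa\,\partial/\partial y_k$ for $k>0$, and let $b_0=\mu$. Put $a(z)=\sum a_nz^{-n-1}$, $a^*(z)=\sum a_n^*z^{-n}$, $b(z)=\sum b_nz^{-n-1}$, and $X(z)=\sum X_nz^{-n-1}$ for $X\in\mathfrak g$. The action is $$f(z)\mapsto a(z),\quad h(z)\mapsto 2{:}a(z)a^*(z){:}+b(z),\quad e(z)\mapsto -{:}a^*(z)^2a(z){:}-a^*(z)b(z)+\kappa\,\partial_za^*(z),\quad c\mapsto\kappa$$ (normal ordering puts all $a^*$ to the right), and $d$ multiplies the monomial $x_{n_1}\cdots x_{n_i}y_{m_1}\cdots y_{m_j}$ by $\sum_r n_r-\sum_r m_r-\Delta(\mu)$. Let $w_{\mu,\kappa}=1$.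 *Completed tensor products.* Let $\mathfrak F_m$ be the irreducible $\mathfrak g$-module of highest weight $m$ with highest weight vector $u^m$. For $\Delta\in\mathbb C$ let $z^{-\Delta}\mathfrak F_m[z,z^{-1}]=\mathfrak F_m\otimes z^{-\Delta}\mathbb C[z,z^{-1}]$ be the $\tilde{\mathfrak g}$-module on which $X_n$ acts by $X\otimes z^n$, $c$ by $0$ and $d$ by $z\,\partial/\partial z$; put $u^m_n=u^m\otimes z^n$. For $M=V_{\mu,\kappa}$ or $W_{\mu,\kappa}$, let $M\hat\otimes z^{-\Delta}\mathfrak F_m[z,z^{-1}]$ be the $\tilde{\mathfrak g}$-module (with the tensor product action) of all infinite sums $\sum_i w_i\otimes v_i$ with $w_i\in M$ homogeneous, i.e. $d$-eigenvectors with eigenvalue in $-\Delta(\mu)+\mathbb Z$, whose degrees (their $d$-eigenvalues) tend to $-\infty$. *The vector $v^\sharp$.* For a partition $\pi$ with $n_k$ parts equal to $k$ ($k\ge1$) put $$\alpha_\pi=\beta\prod_{k}\frac1{n_k!}\Big(\frac{-m}{2\kappa k}\Big)^{n_k},\qquad h_\pi=h_{-1}^{n_1}h_{-2}^{n_2}\cdots,\qquad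 b_\pi=b_{-1}^{n_1}b_{-2}^{n_2}\cdots .$$ Writing $P_n$ for the set of partitions of $n$, set $$v^\sharp_{\lambda,\kappa}=\sum_{n\ge0}\sum_{\pi\in P_n}\alpha_\pi\,h_\pi v_{\lambda-m,\kappa}\otimes u^m_n\in V_{\lambda-m,\kappa}\hat\otimes\mathfrak F_m[z,z^{-1}].$$ **Proposition.** 1. (Cox–Futorny isomorphism.) For every $\mu\in\mathbb C$ there is a unique isomorphism of $\tilde{\mathfrak g}$-modules $\Psi_{\mu,\kappa}:V_{\mu,\kappa}\to W_{\mu,\kappa}$ with $$\Psi_{\mu,\kappa}(f_{n_1}\cdots f_{n_i}h_{-m_1}\cdots h_{-m_j}v_{\mu,\kappa})=a_{n_1}\cdots a_{n_i}b_{-m_1}\cdots b_{-m_j}w_{\mu,\kappa}$$ for all $i,j\ge0$, $n_r\in\mathbb Z$ and $m_r>0$. 2. There is a unique homomorphism of $\hat{\mathfrak g}$-modules $\Phi^V(z):V_{\lambda,\kappa}\to V_{\lambda-m,\kappa}\hat\otimes\mathfrak F_m[z,z^{-1}]$ with $\Phi^V(z)(v_{\lambda,\kappa})=v^\sharp_{\lambda,\kappa}$.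 3. Put $\Phi^W(z)=(\Psi_{\lambda-m,\kappa}\otimes1)\circ\Phi^V(z)\circ\Psi_{\lambda,\kappa}^{-1}$. For every $\Delta\in\mathbb C$, the map $$z^{-\Delta}\Phi^W(z):W_{\lambda,\kappa}\to W_{\lambda-m,\kappa}\hat\otimes z^{-\Delta}\mathfrak F_m[z,z^{-1}]$$ is a homomorphism of $\hat{\mathfrak g}$-modules such that $$z^{-\Delta}\Phi^W(z)(w_{\lambda,\kappa})=\sum_{n\ge0}\sum_{\pi\in P_n}\alpha_\pi\,b_\pi w_{\lambda-m,\kappa}\otimes z^{-\Delta}u^m_n,$$ and it is a homomorphism of $\tilde{\mathfrak g}$-modules (with $d$ acting by $z\,\partial/\partial z$ on the second factor) if and only if $$\Delta=\Delta(\lambda)-\Delta(\lambda-m).$$ -/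

import Mathlib

open scoped TensorProduct

noncomputable section

namespace ImaginaryWakimoto

/-! ### The affine Lie algebra -/

/-- The Lie algebra `𝔤 = 𝔰𝔩(2, ℂ)` of traceless matrices. -/
abbrev SL2 := LieAlgebra.SpecialLinear.sl (Fin 2) ℂ

/-- `e = E₁₂`. -/
def slE : SL2 := LieAlgebra.SpecialLinear.single 0 1 (by decide) 1

/-- `f = E₂₁`. -/
def slF : SL2 := LieAlgebra.SpecialLinear.single 1 0 (by decide) 1

/-- `h = E₁₁ - E₂₂`. -/
def slH : SL2 := LieAlgebra.SpecialLinear.singleSubSingle 0 1 1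

/-- The loop algebra `𝔤 ⊗ ℂ[t, t⁻¹]`. -/
def Loop := LieAlgebra.loopAlgebra ℂ ℤ SL2

instance : LieRing Loop := inferInstanceAs (LieRing (LieAlgebra.loopAlgebra ℂ ℤ SL2))

instance : LieAlgebra ℂ Loop := inferInstanceAs (LieAlgebra ℂ (LieAlgebra.loopAlgebra ℂ ℤ SL2))

/-- Elements of the loop algebra as finitely supported functions. -/
def Loop.coeff : Loop ≃ₗ[ℂ] (ℤ →₀ SL2) := LieAlgebra.LoopAlgebra.toFinsupp ℂ ℤ SL2

/-- `x ↦ xₙ = x ⊗ tⁿ`. -/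
def Loop.tm (n : ℤ) : SL2 →ₗ[ℂ] Loop := TensorProduct.mk ℂ _ _ (AddMonoidAlgebra.single n 1)

/-- The linear map on the loop algebra with prescribed values `T n x` at `x ⊗ tⁿ`. -/
def Loop.lift {M : Type*} [AddCommGroup M] [Module ℂ M] (T : ℤ → SL2 →ₗ[ℂ] M) : Loop →ₗ[ℂ] M :=
  Finsupp.lsum ℂ T ∘ₗ Loop.coeff.toLinearMap

theorem Loop.coeff_tm (n : ℤ) (x : SL2) :
    Loop.coeff (Loop.tm n x) = Finsupp.single n x :=
  LieAlgebra.LoopAlgebra.toFinsupp_single_tmul ℂ ℤ SL2 n x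

@[simp]
theorem Loop.lift_tm {M : Type*} [AddCommGroup M] [Module ℂ M] (T : ℤ → SL2 →ₗ[ℂ] M)
    (n : ℤ) (x : SL2) : Loop.lift T (Loop.tm n x) = T n x := by
  rw [lift, LinearMap.comp_apply, LinearEquiv.coe_coe, Loop.coeff_tm, Finsupp.lsum_single]

theorem Loop.ind {P : Loop → Prop} (h0 : P 0) (htm : ∀ n x, P (Loop.tm n x))
    (hadd : ∀ x y, P x → P y → P (x + y)) (x : Loop) : P x := by
  have key : ∀ v : ℤ →₀ SL2, P (Loop.coeff.symm v) := by
    intro v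
    induction v using Finsupp.induction_linear with
    | zero => rw [map_zero]; exact h0
    | add v w hv hw => rw [map_add]; exact hadd _ _ hv hw
    | single n x =>
      rw [← Loop.coeff_tm, LinearEquiv.symm_apply_apply]; exact htm n x
  have := key (Loop.coeff x)
  rwa [LinearEquiv.symm_apply_apply] at this

theorem Loop.lie_tm (m n : ℤ) (x y : SL2) :
    ⁅Loop.tm m x, Loop.tm n y⁆ = Loop.tm (m + n) ⁅x, y⁆ := by
  refine (LieAlgebra.ExtendScalars.bracket_tmul ℂ (AddMonoidAlgebra ℂ ℤ) SL2 SL2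
    (AddMonoidAlgebra.single m 1) (AddMonoidAlgebra.single n 1) x y).trans ?_
  rw [AddMonoidAlgebra.single_mul_single, one_mul]; rfl

/-- The form `(X | Y) = tr (X Y)`. -/
def traceForm : LinearMap.BilinForm ℂ SL2 :=
  LinearMap.mk₂ ℂ (fun x y => Matrix.trace (x.1 * y.1))
    (by simp [add_mul]) (by simp) (by simp [mul_add]) (by simp)

theorem traceForm_apply (x y : SL2) : traceForm x y = Matrix.trace (x.1 * y.1) := rfl

theorem traceForm_comm (x y : SL2) : traceForm x y = traceForm y x := by
  rw [traceForm_apply, traceForm_apply, Matrix.trace_mul_comm]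

theorem traceForm_lie (x y z : SL2) : traceForm ⁅x, y⁆ z = traceForm x ⁅y, z⁆ := by
  rw [traceForm_apply, traceForm_apply, LieAlgebra.SpecialLinear.sl_bracket,
    LieAlgebra.SpecialLinear.sl_bracket, sub_mul, mul_sub,
    Matrix.trace_sub, Matrix.trace_sub, Matrix.mul_assoc, Matrix.mul_assoc,
    Matrix.trace_mul_comm y.1, Matrix.mul_assoc]

/-- The residue pairing `(f, g) ↦ Res (f | dg)`. -/
def Loop.residue : Loop →ₗ[ℂ] Loop →ₗ[ℂ] ℂ :=
  LieAlgebra.LoopAlgebra.residuePairing ℂ ℤ SL2 traceForm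

theorem Loop.residue_apply (x y : Loop) : Loop.residue x y =
    (Loop.coeff y).sum fun a v => a • traceForm (Loop.coeff x (-a)) v := rfl

/-- The cocycle with `(Xₘ, Yₙ) ↦ m δ_{m+n,0} (X | Y)`. -/
def cocycle (x y : Loop) : ℂ := Loop.residue y x

theorem cocycle_tm (m n : ℤ) (x y : SL2) : cocycle (Loop.tm m x) (Loop.tm n y) =
    if m + n = 0 then m * traceForm x y else 0 := by
  rw [cocycle, Loop.residue_apply,
    Loop.coeff_tm, Loop.coeff_tm, Finsupp.sum_single_index (by simp)]
  by_cases hmn : m + n = 0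
  · rw [show -m = n by lia, Finsupp.single_eq_same, if_pos hmn, traceForm_comm, zsmul_eq_mul]
  · rw [Finsupp.single_eq_of_ne (by lia), if_neg hmn]
    simp

@[simp] theorem cocycle_add_left (x y z : Loop) :
    cocycle (x + y) z = cocycle x z + cocycle y z := by
  simp [cocycle]

@[simp] theorem cocycle_add_right (x y z : Loop) :
    cocycle x (y + z) = cocycle x y + cocycle x z := by
  simp [cocycle]

@[simp] theorem cocycle_smul_left (c : ℂ) (x y : Loop) : cocycle (c • x) y = c * cocycle x y := by
  simp [cocycle]

@[simp] theorem cocycle_smul_right (c : ℂ) (x y : Loop) : cocycle x (c • y) = c * cocycle x y := by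
  simp [cocycle]

@[simp] theorem cocycle_zero_left (x : Loop) : cocycle 0 x = 0 := by
  simp [cocycle]

@[simp] theorem cocycle_zero_right (x : Loop) : cocycle x 0 = 0 := by
  simp [cocycle]

theorem cocycle_skew (x y : Loop) : cocycle x y = - cocycle y x := by
  induction x using Loop.ind with
  | h0 => simp
  | hadd x x' hx hx' => simp [hx, hx', add_comm]
  | htm m x =>
  induction y using Loop.ind with
  | h0 => simp
  | hadd y y' hy hy' => simp [hy, hy', add_comm]
  | htm n y =>
  simp only [cocycle_tm, traceForm_comm y x, add_comm n m]
  split_ifs with h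
  · obtain rfl : m = -n := by lia
    push_cast; ring
  · simp

/-- The degree derivation `t d/dt` of the loop algebra. -/
def Loop.deg : Loop →ₗ[ℂ] Loop := Loop.lift fun n => (n : ℂ) • Loop.tm n

@[simp]
theorem Loop.deg_tm (n : ℤ) (x : SL2) : Loop.deg (Loop.tm n x) = (n : ℂ) • Loop.tm n x := by
  rw [Loop.deg, Loop.lift_tm]; rfl

theorem Loop.deg_lie (x y : Loop) :
    Loop.deg ⁅x, y⁆ = ⁅Loop.deg x, y⁆ + ⁅x, Loop.deg y⁆ := by
  induction x using Loop.ind with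
  | h0 => simp
  | hadd x x' hx hx' => simp only [add_lie, map_add, hx, hx']; abel
  | htm m x =>
  induction y using Loop.ind with
  | h0 => simp
  | hadd y y' hy hy' => simp only [lie_add, map_add, hy, hy']; abel
  | htm n y =>
  rw [Loop.lie_tm, Loop.deg_tm, Loop.deg_tm, Loop.deg_tm, smul_lie, lie_smul, Loop.lie_tm,
    ← add_smul]
  push_cast; rfl

theorem cocycle_deg (x y : Loop) : cocycle (Loop.deg x) y + cocycle x (Loop.deg y) = 0 := by
  induction x using Loop.ind with
  | h0 => simp
  | hadd x x' hx hx' =>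
    simp only [cocycle_add_left, map_add]; linear_combination hx + hx'
  | htm m x =>
  induction y using Loop.ind with
  | h0 => simp
  | hadd y y' hy hy' =>
    simp only [cocycle_add_right, map_add]; linear_combination hy + hy'
  | htm n y =>
  rw [Loop.deg_tm, Loop.deg_tm, cocycle_smul_left, cocycle_smul_right, cocycle_tm]
  split_ifs with h
  · obtain rfl : m = -n := by lia
    push_cast; ring
  · simp

theorem cocycle_lie (x y z : Loop) :
    cocycle x ⁅y, z⁆ = cocycle ⁅x, y⁆ z + cocycle y ⁅x, z⁆ := by
  induction x using Loop.ind with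
  | h0 => simp
  | hadd x x' hx hx' =>
    simp only [cocycle_add_left, cocycle_add_right, add_lie, hx, hx']; ring
  | htm k x =>
  induction y using Loop.ind with
  | h0 => simp
  | hadd y y' hx hx' =>
    simp only [cocycle_add_left, cocycle_add_right, add_lie, lie_add, hx, hx']; ring
  | htm m y =>
  induction z using Loop.ind with
  | h0 => simp
  | hadd z z' hx hx' =>
    simp only [cocycle_add_right, lie_add, hx, hx']; ring
  | htm n z =>
  rw [Loop.lie_tm, Loop.lie_tm, Loop.lie_tm, cocycle_tm, cocycle_tm, cocycle_tm]
  have h1 : traceForm y ⁅x, z⁆ = - traceForm x ⁅y, z⁆ := by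
    rw [← traceForm_lie, ← traceForm_lie, ← lie_skew x y, LinearMap.map_neg, LinearMap.neg_apply]
    simp only [neg_neg]
  by_cases h : k + m + n = 0
  · rw [if_pos (by lia), if_pos h, if_pos (by lia), h1, traceForm_lie]
    push_cast; ring
  · rw [if_neg (by lia), if_neg h, if_neg (by lia), add_zero]

/-- The affine Lie algebra `𝔤̃ = (𝔤 ⊗ ℂ[t, t⁻¹]) ⊕ ℂ c ⊕ ℂ d`. -/
@[ext]
structure Affine where
  /-- the component in `𝔤 ⊗ ℂ[t, t⁻¹]` -/
  loop : Loop
  /-- the coefficient of `c` -/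
  cc : ℂ
  /-- the coefficient of `d` -/
  dd : ℂ

namespace Affine

/-- `𝔤̃` is a direct sum as a vector space. -/
def toProd : Affine ≃ Loop × ℂ × ℂ where
  toFun x := (x.loop, x.cc, x.dd)
  invFun x := ⟨x.1, x.2.1, x.2.2⟩
  left_inv _ := rfl
  right_inv _ := rfl

instance : AddCommGroup Affine := toProd.addCommGroup

instance : Module ℂ Affine := toProd.module ℂ

@[simp] theorem zero_loop : (0 : Affine).loop = 0 := rfl
@[simp] theorem zero_cc : (0 : Affine).cc = 0 := rfl
@[simp] theorem zero_dd : (0 : Affine).dd = 0 := rfl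
@[simp] theorem add_loop (x y : Affine) : (x + y).loop = x.loop + y.loop := rfl
@[simp] theorem add_cc (x y : Affine) : (x + y).cc = x.cc + y.cc := rfl
@[simp] theorem add_dd (x y : Affine) : (x + y).dd = x.dd + y.dd := rfl
@[simp] theorem smul_loop (r : ℂ) (x : Affine) : (r • x).loop = r • x.loop := rfl
@[simp] theorem smul_cc (r : ℂ) (x : Affine) : (r • x).cc = r * x.cc := rfl
@[simp] theorem smul_dd (r : ℂ) (x : Affine) : (r • x).dd = r * x.dd := rfl

/-- `[Xₘ, Yₙ] = [X, Y]ₘ₊ₙ + m δ_{m+n,0} (X | Y) c`, `[d, Xₘ] = m Xₘ`, and `c` is central. -/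
instance : Bracket Affine Affine where
  bracket x y :=
    ⟨⁅x.loop, y.loop⁆ + x.dd • Loop.deg y.loop - y.dd • Loop.deg x.loop, cocycle x.loop y.loop, 0⟩

@[simp] theorem lie_loop (x y : Affine) : ⁅x, y⁆.loop =
    ⁅x.loop, y.loop⁆ + x.dd • Loop.deg y.loop - y.dd • Loop.deg x.loop := rfl
@[simp] theorem lie_cc (x y : Affine) : ⁅x, y⁆.cc = cocycle x.loop y.loop := rfl
@[simp] theorem lie_dd (x y : Affine) : ⁅x, y⁆.dd = 0 := rfl

instance : LieRing Affine where
  add_lie x y z := by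
    ext
    · simp only [lie_loop, add_loop, add_lie, add_dd, add_smul, map_add, smul_add]; abel
    · simp
    · simp
  lie_add x y z := by
    ext
    · simp only [lie_loop, add_loop, lie_add, add_dd, add_smul, map_add, smul_add]; abel
    · simp
    · simp
  lie_self x := by
    ext
    · simp
    · have := cocycle_skew x.loop x.loop
      simp only [lie_cc, zero_cc]
      linear_combination this / 2
    · simp
  leibniz_lie x y z := by
    ext
    · simp only [lie_loop, add_loop, lie_dd, zero_smul, map_add, map_sub, map_smul, lie_add, add_lie,
        lie_sub, sub_lie, smul_lie, lie_smul, Loop.deg_lie, leibniz_lie x.loop y.loop z.loop]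
      rw [← lie_skew y.loop (Loop.deg x.loop)]
      module
    · have h1 := cocycle_lie x.loop y.loop z.loop
      have h2 := cocycle_deg x.loop z.loop
      have h3 := cocycle_deg x.loop y.loop
      have h4 := cocycle_deg y.loop z.loop
      have h5 := cocycle_skew y.loop (Loop.deg x.loop)
      simp only [lie_cc, lie_loop, add_cc, sub_eq_add_neg, cocycle_add_left, cocycle_add_right,
        ← neg_smul, cocycle_smul_left, cocycle_smul_right]
      linear_combination h1 + y.dd * h2 - z.dd * h3 + z.dd * h5 - x.dd * h4
    · simp

instance : LieAlgebra ℂ Affine where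
  lie_smul r x y := by
    ext
    · simp only [lie_loop, smul_loop, smul_dd, lie_smul, map_smul]; module
    · simp
    · simp

/-- `xₙ = x ⊗ tⁿ` as an element of `𝔤̃`. -/
def el (n : ℤ) (x : SL2) : Affine := ⟨Loop.tm n x, 0, 0⟩

/-- The element `eₙ`. -/
def e (n : ℤ) : Affine := el n slE

/-- The element `fₙ`. -/
def f (n : ℤ) : Affine := el n slF

/-- The element `hₙ`. -/
def h (n : ℤ) : Affine := el n slH

/-- The central element `c`. -/
def c : Affine := ⟨0, 1, 0⟩

/-- The degree derivation `d`. -/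
def d : Affine := ⟨0, 0, 1⟩

theorem d_lie_el (n : ℤ) (x : SL2) : ⁅d, el n x⁆ = (n : ℂ) • el n x := by
  ext <;> simp [d, el]

/-- The subalgebra `𝔤̂ = (𝔤 ⊗ ℂ[t, t⁻¹]) ⊕ ℂ c`. -/
def hat : LieSubalgebra ℂ Affine where
  carrier := {x | x.dd = 0}
  add_mem' hx hy := by simp_all
  zero_mem' := rfl
  smul_mem' r x hx := by simp_all
  lie_mem' _ _ := rfl

end Affine

/-! ### Constructing modules over the affine Lie algebra -/

theorem SL2.eq_coords (x : SL2) : x = x.1 0 1 • slE + x.1 1 0 • slF + x.1 0 0 • slH := by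
  have ht : x.1 0 0 + x.1 1 1 = 0 := by
    have := x.2
    rw [← Matrix.trace_fin_two x.1]
    exact this
  have h11 : x.1 1 1 = - x.1 0 0 := by linear_combination ht
  ext i j
  fin_cases i <;> fin_cases j <;>
    simp [slE, slF, slH, Matrix.single, h11]

section rep

variable {M : Type*} [AddCommGroup M] [Module ℂ M]

/-- The linear action with `xₙ ↦ T n x`, `c ↦ K` and `d ↦ D`. -/
def Affine.rep (T : ℤ → SL2 →ₗ[ℂ] Module.End ℂ M) (K D : Module.End ℂ M) :
    Affine →ₗ[ℂ] Module.End ℂ M where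
  toFun x := Loop.lift T x.loop + x.cc • K + x.dd • D
  map_add' x y := by simp only [Affine.add_loop, Affine.add_cc, Affine.add_dd, map_add]; module
  map_smul' r x := by
    simp only [Affine.smul_loop, Affine.smul_cc, Affine.smul_dd, map_smul, RingHom.id_apply]; module

variable (T : ℤ → SL2 →ₗ[ℂ] Module.End ℂ M) (K D : Module.End ℂ M)

theorem Affine.rep_apply (x : Affine) :
    Affine.rep T K D x = Loop.lift T x.loop + x.cc • K + x.dd • D := rfl

@[simp] theorem Affine.rep_el (n : ℤ) (x : SL2) : Affine.rep T K D (Affine.el n x) = T n x := by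
  simp [Affine.rep_apply, Affine.el]

@[simp] theorem Affine.rep_c : Affine.rep T K D Affine.c = K := by
  simp [Affine.rep_apply, Affine.c]

@[simp] theorem Affine.rep_d : Affine.rep T K D Affine.d = D := by
  simp [Affine.rep_apply, Affine.d]

/-- The relations that make `Affine.rep T K D` a representation. -/
structure Affine.IsRep : Prop where
  tt : ∀ m n x y, T m x * T n y - T n y * T m x =
    T (m + n) ⁅x, y⁆ + (if m + n = 0 then (m : ℂ) * traceForm x y else 0) • K
  kt : ∀ n x, K * T n x = T n x * K
  dt : ∀ n x, D * T n x - T n x * D = (n : ℂ) • T n x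
  kd : K * D = D * K

variable {T K D}

theorem Affine.IsRep.rep_lie (H : Affine.IsRep T K D) (x y : Affine) :
    Affine.rep T K D ⁅x, y⁆ = Affine.rep T K D x * Affine.rep T K D y -
      Affine.rep T K D y * Affine.rep T K D x := by
  have hK : ∀ u : Loop, K * Loop.lift T u = Loop.lift T u * K := by
    intro u
    induction u using Loop.ind with
    | h0 => simp
    | hadd u v hu hv => simp only [map_add, mul_add, add_mul, hu, hv]
    | htm n x => simpa using H.kt n x
  have hD : ∀ u : Loop, D * Loop.lift T u = Loop.lift T u * D + Loop.lift T (Loop.deg u) := by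
    intro u
    induction u using Loop.ind with
    | h0 => simp
    | hadd u v hu hv => simp only [map_add, mul_add, add_mul, hu, hv]; abel
    | htm n x =>
      have := H.dt n x
      simp only [Loop.lift_tm, Loop.deg_tm, map_smul, ← this]
      abel
  have hT : ∀ u v : Loop, Loop.lift T u * Loop.lift T v - Loop.lift T v * Loop.lift T u =
      Loop.lift T ⁅u, v⁆ + cocycle u v • K := by
    intro u v
    induction u using Loop.ind with
    | h0 => simp
    | hadd u u' hu hu' =>
      simp only [map_add, add_lie, cocycle_add_left, add_smul]
      rw [add_add_add_comm, ← hu, ← hu', add_mul, mul_add]; abel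
    | htm m x =>
    induction v using Loop.ind with
    | h0 => simp
    | hadd u u' hu hu' =>
      simp only [map_add, lie_add, cocycle_add_right, add_smul]
      rw [add_add_add_comm, ← hu, ← hu', add_mul, mul_add]; abel
    | htm n y =>
      rw [Loop.lie_tm, cocycle_tm]
      simpa using H.tt m n x y
  simp only [Affine.rep_apply, Affine.lie_loop, Affine.lie_cc, Affine.lie_dd, map_add, map_sub,
    map_smul, add_mul, mul_add, smul_mul_assoc, mul_smul_comm, hK, hD, H.kd, smul_add]
  have := hT x.loop y.loop
  rw [sub_eq_iff_eq_add] at this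
  rw [this]
  module

/-- The `𝔤̃`-module given by operators that satisfy the relations of `𝔤̃`. -/
@[reducible]
def Affine.IsRep.lieRingModule (H : Affine.IsRep T K D) : LieRingModule Affine M where
  bracket x v := Affine.rep T K D x v
  add_lie x y v := by simp
  lie_add x v w := by simp
  leibniz_lie x y v := by
    rw [H.rep_lie]
    simp

theorem Affine.IsRep.lieModule (H : Affine.IsRep T K D) :
    letI := H.lieRingModule
    LieModule ℂ Affine M :=
  letI := H.lieRingModule
  { smul_lie := fun r x v => by
      change Affine.rep T K D (r • x) v = r • Affine.rep T K D x v
      simp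
    lie_smul := fun r x v => by
      change Affine.rep T K D x (r • v) = r • Affine.rep T K D x v
      simp }

/-- It suffices to check the relations between the basis vectors. -/
theorem Affine.IsRep.of_basis
    (hee : ∀ m n, T m slE * T n slE = T n slE * T m slE)
    (hff : ∀ m n, T m slF * T n slF = T n slF * T m slF)
    (hhh : ∀ m n, T m slH * T n slH - T n slH * T m slH =
      (if m + n = 0 then 2 * (m : ℂ) else 0) • K)
    (hef : ∀ m n, T m slE * T n slF - T n slF * T m slE =
      T (m + n) slH + (if m + n = 0 then (m : ℂ) else 0) • K)
    (hhe : ∀ m n, T m slH * T n slE - T n slE * T m slH = (2 : ℂ) • T (m + n) slE)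
    (hhf : ∀ m n, T m slH * T n slF - T n slF * T m slH = (-2 : ℂ) • T (m + n) slF)
    (hk : ∀ n x, K * T n x = T n x * K)
    (hde : ∀ n, D * T n slE - T n slE * D = (n : ℂ) • T n slE)
    (hdf : ∀ n, D * T n slF - T n slF * D = (n : ℂ) • T n slF)
    (hdh : ∀ n, D * T n slH - T n slH * D = (n : ℂ) • T n slH)
    (hkd : K * D = D * K) : Affine.IsRep T K D where
  kt := hk
  kd := hkd
  dt n x := by
    rw [SL2.eq_coords x]
    simp only [map_add, map_smul, mul_add, add_mul, mul_smul_comm, smul_mul_assoc]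
    have h1 := hde n
    have h2 := hdf n
    have h3 := hdh n
    rw [sub_eq_iff_eq_add] at h1 h2 h3
    rw [h1, h2, h3]
    module
  tt m n x y := by
    have bef : ⁅slE, slF⁆ = slH := by
      apply Subtype.ext; rw [LieAlgebra.SpecialLinear.sl_bracket]
      ext i j; fin_cases i <;> fin_cases j <;>
      simp [slE, slF, slH, Matrix.single, Matrix.mul_apply]
    have bhe : ⁅slH, slE⁆ = (2 : ℂ) • slE := by
      apply Subtype.ext; rw [LieAlgebra.SpecialLinear.sl_bracket]
      ext i j; fin_cases i <;> fin_cases j <;>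
      simp [slE, slH, Matrix.single, Matrix.mul_apply]
      norm_num
    have bhf : ⁅slH, slF⁆ = (-2 : ℂ) • slF := by
      apply Subtype.ext; rw [LieAlgebra.SpecialLinear.sl_bracket]
      ext i j; fin_cases i <;> fin_cases j <;>
      simp [slF, slH, Matrix.single, Matrix.mul_apply]
      norm_num
    have bfe : ⁅slF, slE⁆ = -slH := by rw [← lie_skew, bef]
    have beh : ⁅slE, slH⁆ = (-2 : ℂ) • slE := by rw [← lie_skew, bhe]; module
    have bfh : ⁅slF, slH⁆ = (2 : ℂ) • slF := by rw [← lie_skew, bhf]; module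
    have tee : traceForm slE slE = 0 := by
      simp [traceForm_apply, slE, Matrix.trace_fin_two, Matrix.single, Matrix.mul_apply]
    have tff : traceForm slF slF = 0 := by
      simp [traceForm_apply, slF, Matrix.trace_fin_two, Matrix.single, Matrix.mul_apply]
    have thh : traceForm slH slH = 2 := by
      simp [traceForm_apply, slH, Matrix.trace_fin_two, Matrix.single, Matrix.mul_apply]
      norm_num
    have tef : traceForm slE slF = 1 := by
      simp [traceForm_apply, slE, slF, Matrix.trace_fin_two, Matrix.single, Matrix.mul_apply]
    have teh : traceForm slE slH = 0 := by
      simp [traceForm_apply, slE, slH, Matrix.trace_fin_two, Matrix.single, Matrix.mul_apply]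
    have tfh : traceForm slF slH = 0 := by
      simp [traceForm_apply, slF, slH, Matrix.trace_fin_two, Matrix.single, Matrix.mul_apply]
    have tfe : traceForm slF slE = 1 := by rw [traceForm_comm, tef]
    have the : traceForm slH slE = 0 := by rw [traceForm_comm, teh]
    have thf : traceForm slH slF = 0 := by rw [traceForm_comm, tfh]
    set δ : ℂ := if m + n = 0 then 1 else 0 with hδ
    have e1 : ∀ z : ℂ, (if m + n = 0 then z else 0) = z * δ := by
      intro z; rw [hδ]; split_ifs <;> simp
    have e2 : (n : ℂ) * δ = - m * δ := by
      rw [hδ]; split_ifs with h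
      · obtain rfl : n = -m := by lia
        push_cast; ring
      · simp
    have hfe := hef n m
    have heh := hhe n m
    have hfh := hhf n m
    have hef := hef m n
    have hhe := hhe m n
    have hhf := hhf m n
    have hhh := hhh m n
    rw [add_comm n m] at hfe heh hfh
    rw [sub_eq_iff_eq_add] at hfe heh hfh hhh hef hhe hhf
    rw [e1] at hfe hef hhh
    rw [e1, SL2.eq_coords x, SL2.eq_coords y]
    generalize x.1 0 1 = x1
    generalize x.1 1 0 = x2
    generalize x.1 0 0 = x3
    generalize y.1 0 1 = y1
    generalize y.1 1 0 = y2
    generalize y.1 0 0 = y3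
    simp only [map_add, map_smul, mul_add, add_mul, mul_smul_comm, smul_mul_assoc, lie_add, add_lie,
      lie_smul, smul_lie, lie_self, bef, bhe, bhf, bfe, beh, bfh, LinearMap.add_apply,
      LinearMap.smul_apply, tee, tff, thh, tef, teh, tfh, tfe, the, thf, smul_eq_mul, map_neg, map_zero,
      hef, hhe, hhf, hhh, hfe, heh, hfh, hee m n, hff m n, e2]
    module

end rep

/-! ### The imaginary Wakimoto module -/

/-- The Fock space `ℂ[xₙ, n ∈ ℤ] ⊗ ℂ[yₖ, k > 0]`, a polynomial ring in both sets of variables. -/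
abbrev Fock := MvPolynomial (ℤ ⊕ ℕ+) ℂ

namespace Fock

open MvPolynomial

/-- `aₙ = xₙ`. -/
def a (n : ℤ) : Module.End ℂ Fock := LinearMap.mulLeft ℂ (X (Sum.inl n))

/-- `a*ₙ = -∂/∂x₋ₙ`. -/
def aStar (n : ℤ) : Module.End ℂ Fock := -(pderiv (Sum.inl (-n))).toLinearMap

/-- Multiplication by `yₖ`. -/
def y (k : ℕ+) : Module.End ℂ Fock := LinearMap.mulLeft ℂ (X (Sum.inr k))

/-- `bₙ` is multiplication by `y₋ₙ` for `n < 0`, the scalar `l` for `n = 0`, and `2 n κ ∂/∂yₙ` for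
`n > 0`, so that `[bₘ, bₙ] = 2 m κ δ_{m+n,0}`. -/
def b (l κ : ℂ) (n : ℤ) : Module.End ℂ Fock :=
  if n < 0 then y (-n).toNat.toPNat'
  else if n = 0 then l • 1
  else (2 * n * κ) • (pderiv (Sum.inr n.toNat.toPNat')).toLinearMap

theorem finite_aStar (p : Fock) : (Function.support fun i => aStar i p).Finite := by
  refine Set.Finite.subset (p.vars.finite_toSet.preimage
    (f := fun i : ℤ => (Sum.inl (-i) : ℤ ⊕ ℕ+)) ?_) ?_
  · intro i _ j _ hij
    simpa using hij
  · intro i hi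
    by_contra h
    apply hi
    simp [aStar, pderiv_eq_zero_of_notMem_vars h]

/-- The normally ordered sum `∑ᵢ Sᵢ a*ᵢ`; on each polynomial all but finitely many of the summands
vanish. -/
def normalSum (S : ℤ → Module.End ℂ Fock) : Module.End ℂ Fock where
  toFun p := ∑ᶠ i, S i (aStar i p)
  map_add' p q := by
    rw [← finsum_add_distrib]
    · simp
    · exact (finite_aStar p).subset fun i hi h => hi (by simp [h])
    · exact (finite_aStar q).subset fun i hi h => hi (by simp [h])
  map_smul' r p := by
    simp [smul_finsum' r ((finite_aStar p).subset fun i hi h => hi (by simp [h]) :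
      (Function.support fun i => S i (aStar i p)).Finite)]

theorem normalSum_eq_sum (S : ℤ → Module.End ℂ Fock) (p : Fock) (s : Finset ℤ)
    (hs : ∀ i ∉ s, aStar i p = 0) : normalSum S p = ∑ i ∈ s, S i (aStar i p) :=
  finsum_eq_sum_of_support_subset _ fun i hi => by
    by_contra h
    exact hi (by simp [hs i h])

/-- The coefficient of `z⁻ⁿ⁻¹` in `:a(z) a*(z):`. -/
def aa (n : ℤ) : Module.End ℂ Fock := normalSum fun i => a (n - i)

/-- The coefficient of `z⁻ⁿ⁻¹` in `:a*(z)² a(z):`, all `a*` acting first. -/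
def aaa (n : ℤ) : Module.End ℂ Fock := normalSum fun i => aa (n - i)

/-- The coefficient of `z⁻ⁿ⁻¹` in `a*(z) b(z)`; the two fields commute. -/
def ab (l κ : ℂ) (n : ℤ) : Module.End ℂ Fock := normalSum fun i => b l κ (n - i)

/-- The action of `fₙ`: `f(z) ↦ a(z)`. -/
def opF (n : ℤ) : Module.End ℂ Fock := a n

/-- The action of `hₙ`: `h(z) ↦ 2 :a(z) a*(z): + b(z)`. -/
def opH (l κ : ℂ) (n : ℤ) : Module.End ℂ Fock := (2 : ℂ) • aa n + b l κ n

/-- The action of `eₙ`: `e(z) ↦ -:a*(z)² a(z): - a*(z) b(z) + κ ∂_z a*(z)`. -/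
def opE (l κ : ℂ) (n : ℤ) : Module.End ℂ Fock :=
  -aaa n - ab l κ n + (κ * -n) • aStar n

/-- The degree `n` of `xₙ` and `-k` of `yₖ`. -/
def deg : ℤ ⊕ ℕ+ → ℤ := Sum.elim id fun k => -(k : ℤ)

/-- The action of `d`: it multiplies a monomial `x_{n₁} ⋯ x_{nᵢ} y_{m₁} ⋯ y_{mⱼ}` by
`∑ n - ∑ m - Δ`. -/
def opD (Δ : ℂ) : Module.End ℂ Fock :=
  (mkDerivation ℂ fun i => (deg i : ℂ) • (X i : Fock)).toLinearMap - Δ • 1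

section commutators

/-- The commutator `[A, B]` of two operators. -/
def cm (A B : Module.End ℂ Fock) : Module.End ℂ Fock := A * B - B * A

theorem cm_add (A B C : Module.End ℂ Fock) : cm A (B + C) = cm A B + cm A C := by
  simp only [cm, mul_add, add_mul]; abel

theorem add_cm (A B C : Module.End ℂ Fock) : cm (A + B) C = cm A C + cm B C := by
  simp only [cm, mul_add, add_mul]; abel

theorem cm_smul (A B : Module.End ℂ Fock) (r : ℂ) : cm A (r • B) = r • cm A B := by
  simp [cm, smul_sub]

theorem smul_cm (A B : Module.End ℂ Fock) (r : ℂ) : cm (r • A) B = r • cm A B := by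
  simp [cm, smul_sub]

theorem cm_neg (A B : Module.End ℂ Fock) : cm A (-B) = -cm A B := by
  refine LinearMap.ext fun p => ?_
  simp only [cm, LinearMap.sub_apply, Module.End.mul_apply, LinearMap.neg_apply, map_neg]; abel

theorem neg_cm (A B : Module.End ℂ Fock) : cm (-A) B = -cm A B := by
  refine LinearMap.ext fun p => ?_
  simp only [cm, LinearMap.sub_apply, Module.End.mul_apply, LinearMap.neg_apply, map_neg]; abel

theorem cm_sub (A B C : Module.End ℂ Fock) : cm A (B - C) = cm A B - cm A C := by
  simp only [sub_eq_add_neg, cm_add, cm_neg]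

theorem sub_cm (A B C : Module.End ℂ Fock) : cm (A - B) C = cm A C - cm B C := by
  simp only [sub_eq_add_neg, add_cm, neg_cm]

@[simp] theorem cm_zero (A : Module.End ℂ Fock) : cm A 0 = 0 := by simp [cm]

@[simp] theorem zero_cm (A : Module.End ℂ Fock) : cm 0 A = 0 := by simp [cm]

@[simp] theorem cm_one (A : Module.End ℂ Fock) : cm A 1 = 0 := by simp [cm]

theorem cm_swap (A B : Module.End ℂ Fock) : cm A B = -cm B A := by
  simp only [cm]; abel

theorem end_neg_mul (A B : Module.End ℂ Fock) : -A * B = -(A * B) := neg_mul A B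

theorem end_mul_neg (A B : Module.End ℂ Fock) : A * -B = -(A * B) := mul_neg A B

theorem mul_cm (A B C : Module.End ℂ Fock) : cm (A * B) C = A * cm B C + cm A C * B := by
  simp only [cm, mul_sub, sub_mul, mul_assoc]; abel

theorem cm_cm (A B C : Module.End ℂ Fock) : cm (cm A B) C = cm A (cm B C) - cm B (cm A C) := by
  simp only [cm, mul_sub, sub_mul, mul_assoc]; abel

theorem end_ext {A B : Module.End ℂ Fock} (h1 : A 1 = B 1)
    (ha : ∀ p, cm (A) (a p) = cm (B) (a p)) (hy : ∀ k, cm (A) (y k) = cm (B) (y k)) : A = B := by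
  rw [← sub_eq_zero]
  set Z := A - B with hZ
  have h1 : Z 1 = 0 := by simp [hZ, h1]
  have ha : ∀ p, cm (Z) (a p) = 0 := fun p => by rw [hZ, sub_cm, ha, sub_self]
  have hy : ∀ p, cm (Z) (y p) = 0 := fun p => by rw [hZ, sub_cm, hy, sub_self]
  refine LinearMap.ext fun p => ?_
  induction p using MvPolynomial.induction_on with
  | C r => rw [← mul_one (C r), ← MvPolynomial.smul_eq_C_mul, map_smul, h1]; simp
  | add p q hp hq => simp [hp, hq]
  | mul_X p i hp =>
    rw [mul_comm]
    cases i with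
    | inl n =>
      have := LinearMap.congr_fun (ha n) p
      simpa [cm, a, hp] using this
    | inr n =>
      have := LinearMap.congr_fun (hy n) p
      simpa [cm, y, hp] using this

theorem lie_a_a (m n : ℤ) : cm (a m) (a n) = 0 := by
  refine LinearMap.ext fun p => ?_
  simp [cm, a, mul_left_comm]

theorem lie_a_y (m : ℤ) (k) : cm (a m) (y k) = 0 := by
  refine LinearMap.ext fun p => ?_
  simp [cm, a, y, mul_left_comm]

theorem lie_y_y (m k) : cm (y m) (y k) = 0 := by
  refine LinearMap.ext fun p => ?_
  simp [cm, y, mul_left_comm]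

theorem lie_aStar_a (m n : ℤ) : cm (aStar m) (a n) = (if m + n = 0 then -1 else 0 : ℂ) • 1 := by
  refine LinearMap.ext fun p => ?_
  by_cases h : m + n = 0
  · obtain rfl : n = -m := by lia
    simp [cm, a, aStar, pderiv_mul, mul_comm]
  · have h' : (Sum.inl (-m) : ℤ ⊕ ℕ+) ≠ Sum.inl n := by
      simp; lia
    simp [cm, a, aStar, pderiv_mul, pderiv_X_of_ne h'.symm, h]

theorem lie_aStar_y (m k) : cm (aStar m) (y k) = 0 := by
  refine LinearMap.ext fun p => ?_
  simp [cm, y, aStar, pderiv_mul, pderiv_X_of_ne]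

theorem aStar_one (m) : aStar m 1 = 0 := by
  simp [aStar]

theorem lie_aStar_aStar (m n : ℤ) : cm (aStar m) (aStar n) = 0 := by
  refine end_ext ?_ (fun p => ?_) (fun k => ?_)
  · simp [cm, aStar_one]
  · rw [cm_cm, lie_aStar_a, lie_aStar_a]; simp [cm]
  · rw [cm_cm, lie_aStar_y, lie_aStar_y]; simp

variable (l κ : ℂ)

theorem b_neg (k : ℕ+) : b l κ (-k) = y k := by
  simp [b]

theorem cm_smul_one (A : Module.End ℂ Fock) (r : ℂ) : cm (A) (r • (1 : Module.End ℂ Fock)) = 0 := by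
  simp [cm]

theorem smul_one_cm (A : Module.End ℂ Fock) (r : ℂ) : cm (r • (1 : Module.End ℂ Fock)) (A) = 0 := by
  simp [cm]

theorem lie_b_y (n : ℤ) (k : ℕ+) :
    cm (b l κ n) (y k) = (if n = k then 2 * k * κ else 0 : ℂ) • 1 := by
  have hk := k.pos
  unfold b
  split_ifs with h1 h2 h3 h2 h2 h2
  · lia
  · rw [lie_y_y]; simp
  · lia
  · rw [smul_one_cm]; simp
  · subst h2
    refine LinearMap.ext fun p => ?_
    simp [cm, y, pderiv_mul, mul_comm, mul_add]
  · have h' : (Sum.inr n.toNat.toPNat' : ℤ ⊕ ℕ+) ≠ Sum.inr k := by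
      intro h
      have := congrArg PNat.val (Sum.inr_injective h)
      rw [Nat.toPNat'_coe, if_pos (by lia)] at this
      lia
    refine LinearMap.ext fun p => ?_
    simp [cm, y, pderiv_mul, pderiv_X_of_ne h'.symm]

theorem lie_b_a (n m : ℤ) : cm (b l κ n) (a m) = 0 := by
  unfold b
  split_ifs with h1 h2
  · rw [cm_swap, lie_a_y, neg_zero]
  · rw [smul_one_cm]
  · refine LinearMap.ext fun p => ?_
    simp [cm, a, pderiv_mul, pderiv_X_of_ne]

theorem b_one (n : ℤ) (hn : 0 ≤ n) : b l κ n 1 = (if n = 0 then l else 0 : ℂ) • 1 := by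
  unfold b
  rw [if_neg (by lia)]
  split_ifs with h2
  · simp
  · rw [LinearMap.smul_apply, Derivation.coeFn_coe, Derivation.map_one_eq_zero, smul_zero, zero_smul]

theorem exists_b_neg (n : ℤ) (hn : n < 0) : ∃ k : ℕ+, n = -k := by
  refine ⟨⟨(-n).toNat, by lia⟩, ?_⟩
  simp; lia

theorem lie_b_b (m n : ℤ) :
    cm (b l κ m) (b l κ n) = (if m + n = 0 then 2 * m * κ else 0 : ℂ) • 1 := by
  by_cases hn : n < 0
  · obtain ⟨k, rfl⟩ := exists_b_neg n hn
    rw [b_neg, lie_b_y]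
    by_cases h : m = k
    · rw [if_pos h, if_pos (by lia), h]; simp
    · rw [if_neg h, if_neg (by lia)]
  by_cases hm : m < 0
  · obtain ⟨k, rfl⟩ := exists_b_neg m hm
    rw [b_neg, cm_swap, lie_b_y]
    by_cases h : n = k
    · rw [if_pos h, if_pos (by lia)]; push_cast; module
    · rw [if_neg h, if_neg (by lia)]; simp
  have h0 : (if m + n = 0 then 2 * m * κ else 0 : ℂ) = 0 := by
    split_ifs with h
    · obtain rfl : m = 0 := by lia
      simp
    · rfl
  rw [h0, zero_smul]
  refine end_ext ?_ (fun p => ?_) (fun k => ?_)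
  · simp only [cm, LinearMap.sub_apply, Module.End.mul_apply]
    rw [b_one l κ n (by lia), b_one l κ m (by lia), map_smul, map_smul,
      b_one l κ n (by lia), b_one l κ m (by lia), smul_comm, sub_self]; rfl
  · rw [cm_cm, lie_b_a, lie_b_a]; simp
  · rw [cm_cm, lie_b_y, lie_b_y, cm_smul_one, cm_smul_one]; simp

theorem lie_b_aStar (m n : ℤ) : cm (b l κ m) (aStar n) = 0 := by
  unfold b
  split_ifs with h1 h2
  · rw [cm_swap, lie_aStar_y, neg_zero]
  · rw [smul_one_cm]
  · have hD : cm ((pderiv (Sum.inr m.toNat.toPNat') : Derivation ℂ Fock Fock).toLinearMap) (aStar n) = 0 := by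
      refine end_ext ?_ (fun p => ?_) (fun k => ?_)
      · simp [cm, aStar]
      · have h : cm ((pderiv (Sum.inr m.toNat.toPNat') : Derivation ℂ Fock Fock).toLinearMap) (a p) = 0 := by
          refine LinearMap.ext fun q => ?_
          simp [cm, a, pderiv_mul, pderiv_X_of_ne]
        rw [cm_cm, h, lie_aStar_a, cm_smul_one]; simp
      · have h : ∃ r : ℂ, cm ((pderiv (Sum.inr m.toNat.toPNat') : Derivation ℂ Fock Fock).toLinearMap) (y k) = r • 1 := by
          by_cases hk : m.toNat.toPNat' = k
          · refine ⟨1, LinearMap.ext fun q => ?_⟩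
            subst hk
            simp [cm, y, pderiv_mul, mul_comm]
          · refine ⟨0, LinearMap.ext fun q => ?_⟩
            have h' : (Sum.inr m.toNat.toPNat' : ℤ ⊕ ℕ+) ≠ Sum.inr k := by simpa using hk
            simp [cm, y, pderiv_mul, pderiv_X_of_ne h'.symm]
        obtain ⟨r, hr⟩ := h
        rw [cm_cm, hr, lie_aStar_y, cm_smul_one]; simp
    rw [smul_cm, hD, smul_zero]

theorem lie_normalSum (S S' : ℤ → Module.End ℂ Fock) (T R : Module.End ℂ Fock) (c : ℤ)
    (h : ∀ i, cm (S i * aStar i) (T) = S' i * aStar i + if i = c then R else 0) :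
    cm (normalSum S) (T) = normalSum S' + R := by
  refine LinearMap.ext fun p => ?_
  set s : Finset ℤ := (finite_aStar p).toFinset ∪ (finite_aStar (T p)).toFinset ∪ {c} with hs
  have h1 : ∀ i ∉ s, aStar i p = 0 := fun i hi => by
    by_contra h; exact hi (by simp [hs, h])
  have h2 : ∀ i ∉ s, aStar i (T p) = 0 := fun i hi => by
    by_contra h; exact hi (by simp [hs, h])
  have h3 : c ∈ s := by simp [hs]
  simp only [cm, LinearMap.sub_apply, Module.End.mul_apply, LinearMap.add_apply]
  rw [normalSum_eq_sum S p s h1, normalSum_eq_sum S (T p) s h2, normalSum_eq_sum S' p s h1,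
    map_sum, ← Finset.sum_sub_distrib, ← Finset.sum_ite_eq_of_mem' s c (fun _ => R p) h3,
    ← Finset.sum_add_distrib]
  refine Finset.sum_congr rfl fun i _ => ?_
  have := LinearMap.congr_fun (h i) p
  simp only [cm, LinearMap.sub_apply, Module.End.mul_apply, LinearMap.add_apply] at this
  rw [this]
  split_ifs <;> simp

theorem normalSum_smul (r : ℂ) (S : ℤ → Module.End ℂ Fock) :
    normalSum (fun i => r • S i) = r • normalSum S := by
  refine LinearMap.ext fun p => ?_
  have h : ∀ i ∉ (finite_aStar p).toFinset, aStar i p = 0 := fun i hi => by simpa using hi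
  rw [LinearMap.smul_apply, normalSum_eq_sum _ p _ h, normalSum_eq_sum _ p _ h, Finset.smul_sum]
  rfl

theorem normalSum_zero : normalSum (fun _ => 0) = 0 := by
  refine LinearMap.ext fun p => ?_
  simp [normalSum]

theorem normalSum_apply_of (S : ℤ → Module.End ℂ Fock) (p : Fock) (h : ∀ i, aStar i p = 0) :
    normalSum S p = 0 := by
  simp [normalSum, h]

theorem lie_aa_a (n p : ℤ) : cm (aa n) (a p) = -a (n + p) := by
  rw [aa, lie_normalSum _ (fun _ => 0) _ (-a (n + p)) (-p), normalSum_zero, zero_add]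
  intro i
  rw [mul_cm, lie_a_a, lie_aStar_a, zero_mul, add_zero]
  by_cases h : i = -p
  · subst h; simp
  · rw [if_neg (by lia), if_neg h]; simp

theorem lie_aa_y (n : ℤ) (k : ℕ+) : cm (aa n) (y k) = 0 := by
  rw [aa, lie_normalSum _ (fun _ => 0) _ 0 0, normalSum_zero, zero_add]
  intro i
  rw [mul_cm, lie_a_y, lie_aStar_y]; simp

theorem lie_aa_aStar (n p : ℤ) : cm (aa n) (aStar p) = aStar (n + p) := by
  rw [aa, lie_normalSum _ (fun _ => 0) _ (aStar (n + p)) (n + p), normalSum_zero, zero_add]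
  intro i
  rw [mul_cm, cm_swap (a _), lie_aStar_a, lie_aStar_aStar]
  by_cases h : i = n + p
  · subst h; simp [end_neg_mul]
  · rw [if_neg (by lia), if_neg h]; simp

theorem lie_aaa_a (n p : ℤ) : cm (aaa n) (a p) = (-2 : ℂ) • aa (n + p) := by
  rw [aaa, lie_normalSum _ (fun i => (-1 : ℂ) • a (n + p - i)) _ (-aa (n + p)) (-p),
    normalSum_smul, ← aa]
  · module
  intro i
  rw [mul_cm, lie_aa_a, lie_aStar_a, show n - i + p = n + p - i by ring]
  by_cases h : i = -p
  · subst h; rw [if_pos (by lia), if_pos rfl]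
    rw [mul_smul_comm, mul_one, end_neg_mul, smul_mul_assoc]
    rw [show n - -p = n + p by ring]
    module
  · rw [if_neg (by lia), if_neg h]; simp [end_neg_mul]

theorem lie_aaa_y (n : ℤ) (k : ℕ+) : cm (aaa n) (y k) = 0 := by
  rw [aaa, lie_normalSum _ (fun _ => 0) _ 0 0, normalSum_zero, zero_add]
  intro i
  rw [mul_cm, lie_aa_y, lie_aStar_y]; simp

theorem lie_aaa_aStar (n p : ℤ) :
    cm (aaa n) (aStar p) = normalSum fun i => aStar (n + p - i) := by
  rw [aaa, lie_normalSum _ (fun i => aStar (n + p - i)) _ 0 0, add_zero]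
  intro i
  rw [mul_cm, lie_aa_aStar, lie_aStar_aStar, show n - i + p = n + p - i by ring]; simp

theorem lie_ab_a (n p : ℤ) : cm (ab l κ n) (a p) = -b l κ (n + p) := by
  rw [ab, lie_normalSum _ (fun _ => 0) _ (-b l κ (n + p)) (-p), normalSum_zero, zero_add]
  intro i
  rw [mul_cm, lie_b_a, lie_aStar_a]
  by_cases h : i = -p
  · subst h; simp
  · rw [if_neg (by lia), if_neg h]; simp

theorem lie_ab_y (n : ℤ) (k : ℕ+) : cm (ab l κ n) (y k) = (2 * k * κ) • aStar (n - k) := by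
  rw [ab, lie_normalSum _ (fun _ => 0) _ ((2 * k * κ) • aStar (n - k)) (n - k), normalSum_zero,
    zero_add]
  intro i
  rw [mul_cm, lie_b_y, lie_aStar_y]
  by_cases h : i = n - k
  · subst h; simp
  · rw [if_neg (by lia), if_neg h]; simp

theorem lie_ab_aStar (n p : ℤ) : cm (ab l κ n) (aStar p) = 0 := by
  rw [ab, lie_normalSum _ (fun _ => 0) _ 0 0, normalSum_zero, zero_add]
  intro i
  rw [mul_cm, lie_b_aStar, lie_aStar_aStar]; simp

theorem lie_opH_a (n p : ℤ) : cm (opH l κ n) (a p) = (-2 : ℂ) • a (n + p) := by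
  rw [opH, add_cm, smul_cm, lie_aa_a, lie_b_a]; module

theorem lie_opH_y (n : ℤ) (k : ℕ+) :
    cm (opH l κ n) (y k) = (if n = k then 2 * k * κ else 0 : ℂ) • 1 := by
  rw [opH, add_cm, smul_cm, lie_aa_y, lie_b_y]; simp

theorem lie_opH_aStar (n p : ℤ) : cm (opH l κ n) (aStar p) = (2 : ℂ) • aStar (n + p) := by
  rw [opH, add_cm, smul_cm, lie_aa_aStar, lie_b_aStar, add_zero]

theorem lie_opE_a (n p : ℤ) : cm (opE l κ n) (a p) =
    opH l κ (n + p) + (if n + p = 0 then (n : ℂ) else 0) • κ • 1 := by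
  rw [opE, add_cm, sub_cm, neg_cm, smul_cm, lie_aaa_a, lie_ab_a, lie_aStar_a, opH]
  split_ifs <;> module

theorem lie_opE_y (n : ℤ) (k : ℕ+) : cm (opE l κ n) (y k) = (-(2 * k * κ)) • aStar (n - k) := by
  rw [opE, add_cm, sub_cm, neg_cm, smul_cm, lie_aaa_y, lie_ab_y, lie_aStar_y]
  module

theorem lie_opE_aStar (n p : ℤ) :
    cm (opE l κ n) (aStar p) = -normalSum fun i => aStar (n + p - i) := by
  rw [opE, add_cm, sub_cm, neg_cm, smul_cm, lie_aaa_aStar, lie_ab_aStar, lie_aStar_aStar]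
  module

theorem opE_of (n : ℤ) (p : Fock) (h : ∀ i, aStar i p = 0) : opE l κ n p = 0 := by
  simp [opE, aaa, ab, normalSum_apply_of _ p h, h]

theorem opH_of (n : ℤ) (p : Fock) (h : ∀ i, aStar i p = 0) : opH l κ n p = b l κ n p := by
  simp [opH, aa, normalSum_apply_of _ p h]

theorem aStar_b_one (i n : ℤ) : aStar i (b l κ n 1) = 0 := by
  have := LinearMap.congr_fun (lie_b_aStar l κ n i) 1
  simpa [cm, aStar_one] using this

theorem lie_opE_opF (m n : ℤ) : cm (opE l κ m) (opF n) =
    opH l κ (m + n) + (if m + n = 0 then (m : ℂ) else 0) • κ • 1 := lie_opE_a l κ m n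

theorem lie_opH_opF (m n : ℤ) : cm (opH l κ m) (opF n) = (-2 : ℂ) • opF (m + n) := lie_opH_a l κ m n

theorem lie_opH_opH (m n : ℤ) : cm (opH l κ m) (opH l κ n) =
    (if m + n = 0 then 2 * (m : ℂ) else 0) • κ • 1 := by
  rw [smul_smul]
  refine end_ext ?_ (fun p => ?_) (fun k => ?_)
  · have := LinearMap.congr_fun (lie_b_b l κ m n) 1
    simp only [cm, LinearMap.sub_apply, Module.End.mul_apply] at this ⊢
    rw [opH_of _ _ n 1 aStar_one, opH_of _ _ m 1 aStar_one,
      opH_of _ _ n _ fun i => aStar_b_one l κ i m,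
      opH_of _ _ m _ fun i => aStar_b_one l κ i n, this]
    simp [ite_mul]
  · rw [cm_cm, lie_opH_a, lie_opH_a, cm_smul, cm_smul, lie_opH_a, lie_opH_a, smul_one_cm,
      add_left_comm m n p]
    module
  · rw [cm_cm, lie_opH_y, lie_opH_y, cm_smul_one, cm_smul_one, smul_one_cm, sub_self]

theorem lie_opH_opE (m n : ℤ) : cm (opH l κ m) (opE l κ n) = (2 : ℂ) • opE l κ (m + n) := by
  refine end_ext ?_ (fun p => ?_) (fun k => ?_)
  · simp only [cm, LinearMap.sub_apply, Module.End.mul_apply, LinearMap.smul_apply]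
    rw [opE_of _ _ n 1 aStar_one, opE_of _ _ _ 1 aStar_one, opH_of _ _ m 1 aStar_one,
      opE_of _ _ n _ fun i => aStar_b_one l κ i m]
    simp
  · rw [cm_cm, smul_cm, lie_opE_a, lie_opE_a, lie_opH_a, cm_smul, lie_opE_a, cm_add,
      cm_smul, cm_smul_one, lie_opH_opH, add_left_comm n m p, add_assoc m n p]
    by_cases h : m + (n + p) = 0
    · simp only [if_pos h]; push_cast; module
    · simp only [if_neg h]; module
  · rw [cm_cm, smul_cm, lie_opE_y, lie_opE_y, lie_opH_y, cm_smul, lie_opH_aStar, cm_smul_one,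
      add_sub_assoc]
    module

theorem lie_opE_opE (m n : ℤ) : cm (opE l κ m) (opE l κ n) = 0 := by
  refine end_ext ?_ (fun p => ?_) (fun k => ?_)
  · simp only [cm, LinearMap.sub_apply, Module.End.mul_apply]
    rw [opE_of _ _ n 1 aStar_one, opE_of _ _ _ 1 aStar_one]
    simp
  · rw [cm_cm, zero_cm, lie_opE_a, lie_opE_a, cm_add, cm_add, cm_swap (opE l κ m) (opH _ _ _),
      cm_swap (opE l κ n) (opH _ _ _), lie_opH_opE, lie_opH_opE, cm_smul, cm_smul, cm_smul, cm_smul,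
      cm_one, cm_one]
    simp only [smul_zero]
    rw [add_right_comm n p m, add_right_comm m p n, add_comm n m]
    module
  · rw [cm_cm, zero_cm, lie_opE_y, lie_opE_y, cm_smul, cm_smul, lie_opE_aStar, lie_opE_aStar,
      show m + (n - (k : ℤ)) = n + (m - (k : ℤ)) by ring, sub_self]

variable (Δ : ℂ)

theorem lie_opD_a (n : ℤ) : cm (opD Δ) (a n) = (n : ℂ) • a n := by
  refine LinearMap.ext fun p => ?_
  simp only [cm, opD, a, LinearMap.sub_apply, Module.End.mul_apply,
    LinearMap.mulLeft_apply, LinearMap.smul_apply, Module.End.one_apply,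
    Derivation.coeFn_coe, Derivation.leibniz, mkDerivation_X, smul_eq_mul, deg, Sum.elim_inl, id,
    mul_sub, mul_smul_comm]
  rw [mul_comm p]
  module

theorem lie_opD_y (k : ℕ+) : cm (opD Δ) (y k) = (-k : ℂ) • y k := by
  refine LinearMap.ext fun p => ?_
  simp only [cm, opD, y, LinearMap.sub_apply, Module.End.mul_apply,
    LinearMap.mulLeft_apply, LinearMap.smul_apply, Module.End.one_apply,
    Derivation.coeFn_coe, Derivation.leibniz, mkDerivation_X, smul_eq_mul, deg, Sum.elim_inr,
    mul_sub, mul_smul_comm]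
  push_cast
  rw [mul_comm p]
  module

theorem opD_one : opD Δ 1 = (-Δ) • 1 := by
  simp [opD]

theorem lie_opD_aStar (n : ℤ) : cm (opD Δ) (aStar n) = (n : ℂ) • aStar n := by
  refine end_ext ?_ (fun p => ?_) (fun k => ?_)
  · simp [cm, aStar_one, opD_one]
  · rw [cm_cm]
    simp only [cm_smul, smul_cm, cm_one, smul_zero, cm_zero, lie_aStar_a, lie_aStar_y,
      lie_b_a, lie_b_y, lie_opD_a, lie_opD_y]
    split_ifs with h
    · obtain rfl : p = -n := by lia
      push_cast; module
    · module
  · rw [cm_cm]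
    simp only [cm_smul, smul_cm, cm_one, smul_zero, cm_zero, lie_aStar_a, lie_aStar_y,
      lie_b_a, lie_b_y, lie_opD_a, lie_opD_y]
    module

theorem lie_opD_b (n : ℤ) : cm (opD Δ) (b l κ n) = (n : ℂ) • b l κ n := by
  by_cases hn : n < 0
  · obtain ⟨k, rfl⟩ := exists_b_neg n hn
    rw [b_neg, lie_opD_y]; simp
  refine end_ext ?_ (fun p => ?_) (fun k => ?_)
  · simp only [cm, LinearMap.sub_apply, Module.End.mul_apply, LinearMap.smul_apply]
    rw [b_one l κ n (by lia), opD_one, map_smul, map_smul, opD_one, b_one l κ n (by lia)]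
    split_ifs with h
    · subst h; simp; module
    · module
  · rw [cm_cm]
    simp only [cm_smul, smul_cm, cm_one, smul_zero, cm_zero, lie_aStar_a, lie_aStar_y,
      lie_b_a, lie_b_y, lie_opD_a, lie_opD_y]
    module
  · rw [cm_cm]
    simp only [cm_smul, smul_cm, cm_one, smul_zero, cm_zero, lie_aStar_a, lie_aStar_y,
      lie_b_a, lie_b_y, lie_opD_a, lie_opD_y]
    split_ifs with h
    · subst h; push_cast; module
    · module

theorem lie_opD_normalSum (S : ℤ → Module.End ℂ Fock) (n : ℤ)
    (h : ∀ i, cm (opD Δ) (S i) = ((n - i : ℤ) : ℂ) • S i) :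
    cm (opD Δ) (normalSum S) = (n : ℂ) • normalSum S := by
  rw [cm_swap, lie_normalSum S (fun i => (-n : ℂ) • S i) (opD Δ) 0 0, normalSum_smul]
  · module
  intro i
  rw [mul_cm, cm_swap, lie_opD_aStar, cm_swap (S i), h]
  push_cast
  simp only [ite_self, end_neg_mul, end_mul_neg, mul_smul_comm, smul_mul_assoc]
  module

theorem lie_opD_opH (n : ℤ) : cm (opD Δ) (opH l κ n) = (n : ℂ) • opH l κ n := by
  rw [opH, cm_add, cm_smul, aa, lie_opD_normalSum Δ _ n fun i => lie_opD_a Δ _, lie_opD_b]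
  module

theorem lie_opD_opE (n : ℤ) : cm (opD Δ) (opE l κ n) = (n : ℂ) • opE l κ n := by
  have h1 : cm (opD Δ) (aaa n) = (n : ℂ) • aaa n :=
    lie_opD_normalSum Δ _ n fun i => lie_opD_normalSum Δ _ _ fun j => lie_opD_a Δ _
  have h2 : cm (opD Δ) (ab l κ n) = (n : ℂ) • ab l κ n :=
    lie_opD_normalSum Δ _ n fun i => lie_opD_b l κ Δ _
  rw [opE, cm_add, cm_sub, cm_neg, cm_smul, lie_opD_aStar, h1, h2]
  module

/-- The operator by which `x ⊗ tⁿ` acts. -/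
def opT (l κ : ℂ) (n : ℤ) : SL2 →ₗ[ℂ] Module.End ℂ Fock where
  toFun x := x.1 0 1 • opE l κ n + x.1 1 0 • opF n + x.1 0 0 • opH l κ n
  map_add' x y := by
    simp only [AddMemClass.coe_add, Matrix.add_apply]; module
  map_smul' r x := by
    simp only [SetLike.val_smul, Matrix.smul_apply, smul_eq_mul, RingHom.id_apply]; module

@[simp] theorem opT_e (n : ℤ) : opT l κ n slE = opE l κ n := by
  simp [opT, slE, Matrix.single]

@[simp] theorem opT_f (n : ℤ) : opT l κ n slF = opF n := by
  simp [opT, slF, Matrix.single]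

@[simp] theorem opT_h (n : ℤ) : opT l κ n slH = opH l κ n := by
  simp [opT, slH, Matrix.single]

theorem isRep : Affine.IsRep (opT l κ) (κ • 1) (opD Δ) := by
  have hc : ∀ {A B C : Module.End ℂ Fock}, cm (A) (B) = C → A * B - B * A = C := fun h => h
  refine Affine.IsRep.of_basis ?_ ?_ ?_ ?_ ?_ ?_ ?_ ?_ ?_ ?_ ?_ <;>
    try simp only [opT_e, opT_f, opT_h]
  · exact fun m n => sub_eq_zero.1 (lie_opE_opE l κ m n)
  · exact fun m n => sub_eq_zero.1 (lie_a_a m n)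
  · exact fun m n => lie_opH_opH l κ m n
  · exact fun m n => lie_opE_opF l κ m n
  · exact fun m n => lie_opH_opE l κ m n
  · exact fun m n => lie_opH_opF l κ m n
  · intro n x; simp
  · exact fun n => lie_opD_opE l κ Δ n
  · exact fun n => lie_opD_a Δ n
  · exact fun n => lie_opD_opH l κ Δ n
  · simp

end commutators

end Fock

/-- `Δ(λ) = ⟨λ, λ + 2ρ⟩ / (2 (κ + h^∨))` for `𝔰𝔩(2)`, where `h^∨ = 2`, the weight `λ` is identified with
the number `l = λ(h)`, and `⟨λ, μ⟩ = l m / 2`. -/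
def confWeight (l κ : ℂ) : ℂ := (l * (l + 2) / 2) / (2 * (κ + 2))

/-- The imaginary Wakimoto module `W_{λ,κ}`. -/
def Wakimoto (_l _κ : ℂ) : Type := Fock

namespace Wakimoto

variable (l κ : ℂ)

instance : AddCommGroup (Wakimoto l κ) := inferInstanceAs (AddCommGroup Fock)

instance : Module ℂ (Wakimoto l κ) := inferInstanceAs (Module ℂ Fock)

/-- The operator by which `x ⊗ tⁿ` acts. -/
def opT (n : ℤ) : SL2 →ₗ[ℂ] Module.End ℂ (Wakimoto l κ) := Fock.opT l κ n

/-- The action of `d`. -/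
def opD : Module.End ℂ (Wakimoto l κ) := Fock.opD (confWeight l κ)

theorem isRep : Affine.IsRep (opT l κ) (κ • (1 : Module.End ℂ (Wakimoto l κ))) (opD l κ) :=
  Fock.isRep l κ _

/-- The action of `𝔤̃` by the free field realisation, with `c` acting by `κ`. -/
instance : LieRingModule Affine (Wakimoto l κ) := (isRep l κ).lieRingModule

instance : LieModule ℂ Affine (Wakimoto l κ) := (isRep l κ).lieModule

/-- The operator `aₙ`. -/
def a (n : ℤ) : Module.End ℂ (Wakimoto l κ) := Fock.a n

/-- The operator `bₙ`. -/
def b (n : ℤ) : Module.End ℂ (Wakimoto l κ) := Fock.b l κ n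

/-- The generator `w_{λ,κ} = 1`. -/
def w : Wakimoto l κ := (1 : Fock)

theorem lie_def (x : Affine) (v : Wakimoto l κ) : ⁅x, v⁆ =
    Affine.rep (opT l κ) (κ • (1 : Module.End ℂ (Wakimoto l κ))) (opD l κ) x v := rfl

theorem d_w : ⁅Affine.d, w l κ⁆ = (-confWeight l κ) • w l κ := by
  rw [lie_def, Affine.rep_d]
  exact Fock.opD_one _

theorem d_b (n : ℤ) (v : Wakimoto l κ) :
    ⁅Affine.d, b l κ n v⁆ = b l κ n ⁅Affine.d, v⁆ + (n : ℂ) • b l κ n v := by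
  rw [lie_def, lie_def, Affine.rep_d]
  have := LinearMap.congr_fun (Fock.lie_opD_b l κ (confWeight l κ) n) v
  exact sub_eq_iff_eq_add'.1 this

end Wakimoto

/-! ### The imaginary Verma module -/

/-- The left ideal of `U(𝔤̃)` generated by `x - Λ(x)` for `x` in the natural Borel subalgebra
`𝔟 = 𝔥 ⊕ ℂ c ⊕ ℂ d ⊕ 𝔫⁺ ⊗ ℂ[t, t⁻¹] ⊕ 𝔥 ⊗ t ℂ[t]`, where the character `Λ` has `Λ(h) = l`, `Λ(c) = κ`,
`Λ(d) = -Δ(λ)`, and `Λ(eₙ) = 0`, `Λ(hₙ) = 0` for `n > 0`. -/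
def vermaIdeal (l κ : ℂ) : Submodule (UniversalEnvelopingAlgebra ℂ Affine)
    (UniversalEnvelopingAlgebra ℂ Affine) :=
  Submodule.span _ (
    (Set.range fun n : ℤ => UniversalEnvelopingAlgebra.ι ℂ (Affine.e n)) ∪
    ((fun n : ℤ => UniversalEnvelopingAlgebra.ι ℂ (Affine.h n)) '' {n | 0 < n}) ∪
    {UniversalEnvelopingAlgebra.ι ℂ (Affine.h 0) - algebraMap ℂ _ l,
      UniversalEnvelopingAlgebra.ι ℂ Affine.c - algebraMap ℂ _ κ,
      UniversalEnvelopingAlgebra.ι ℂ Affine.d - algebraMap ℂ _ (-confWeight l κ)})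

/-- The imaginary Verma module `V_{λ,κ} = U(𝔤̃) ⊗_{U(𝔟)} ℂ_Λ`, as a quotient of `U(𝔤̃)`. -/
def Verma (l κ : ℂ) : Type := UniversalEnvelopingAlgebra ℂ Affine ⧸ vermaIdeal l κ

namespace Verma

variable (l κ : ℂ)

instance : AddCommGroup (Verma l κ) :=
  inferInstanceAs (AddCommGroup (UniversalEnvelopingAlgebra ℂ Affine ⧸ vermaIdeal l κ))

instance : Module (UniversalEnvelopingAlgebra ℂ Affine) (Verma l κ) :=
  inferInstanceAs (Module _ (UniversalEnvelopingAlgebra ℂ Affine ⧸ vermaIdeal l κ))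

instance : Module ℂ (Verma l κ) :=
  inferInstanceAs (Module ℂ (UniversalEnvelopingAlgebra ℂ Affine ⧸ vermaIdeal l κ))

instance : IsScalarTower ℂ (UniversalEnvelopingAlgebra ℂ Affine) (Verma l κ) :=
  inferInstanceAs (IsScalarTower ℂ (UniversalEnvelopingAlgebra ℂ Affine)
    (UniversalEnvelopingAlgebra ℂ Affine ⧸ vermaIdeal l κ))

/-- `𝔤̃` acts by left multiplication. -/
instance : LieRingModule Affine (Verma l κ) where
  bracket x v := UniversalEnvelopingAlgebra.ι ℂ x • v
  add_lie x y v := by simp [add_smul]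
  lie_add x v w := by simp
  leibniz_lie x y v := by
    let _ := LieRing.ofAssociativeRing (A := UniversalEnvelopingAlgebra ℂ Affine)
    have : UniversalEnvelopingAlgebra.ι ℂ ⁅x, y⁆ =
        UniversalEnvelopingAlgebra.ι ℂ x * UniversalEnvelopingAlgebra.ι ℂ y -
        UniversalEnvelopingAlgebra.ι ℂ y * UniversalEnvelopingAlgebra.ι ℂ x :=
      (UniversalEnvelopingAlgebra.ι ℂ (L := Affine)).map_lie'
    simp [this, sub_smul, mul_smul]

theorem lie_def (x : Affine) (v : Verma l κ) :
    ⁅x, v⁆ = UniversalEnvelopingAlgebra.ι ℂ x • v := rfl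

instance : LieModule ℂ Affine (Verma l κ) where
  smul_lie r x v := by simp [lie_def, smul_assoc]
  lie_smul r x v := by
    rw [lie_def, lie_def, ← algebraMap_smul (UniversalEnvelopingAlgebra ℂ Affine) r v,
      ← algebraMap_smul (UniversalEnvelopingAlgebra ℂ Affine) r (_ • v), smul_smul, smul_smul,
      Algebra.commutes]

/-- The imaginary highest weight vector `v_{λ,κ}`. -/
def v : Verma l κ := Submodule.Quotient.mk 1

theorem d_v : ⁅Affine.d, v l κ⁆ = (-confWeight l κ) • v l κ := by
  rw [lie_def, ← algebraMap_smul (UniversalEnvelopingAlgebra ℂ Affine) (-confWeight l κ) (v l κ)]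
  refine (Submodule.Quotient.eq (vermaIdeal l κ)).2 ?_
  change UniversalEnvelopingAlgebra.ι ℂ Affine.d * 1 - algebraMap ℂ _ (-confWeight l κ) * 1 ∈ _
  rw [mul_one, mul_one]
  exact Submodule.subset_span (Or.inr (by simp))

end Verma

/-! ### The evaluation-type modules -/

/-- The irreducible `𝔰𝔩(2)`-module of highest weight `m`, realised as the binary forms of degree `m`
with `𝔰𝔩(2)` acting by linear substitution. -/
def BinaryForm (m : ℕ) : Type := MvPolynomial.homogeneousSubmodule (Fin 2) ℂ m

namespace BinaryForm

open MvPolynomial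

/-- The derivation of `ℂ[X₀, X₁]` induced by a matrix acting on `ℂ X₀ ⊕ ℂ X₁`. -/
def der (x : SL2) : Derivation ℂ (MvPolynomial (Fin 2) ℂ) (MvPolynomial (Fin 2) ℂ) :=
  mkDerivation ℂ fun j => ∑ i, x.1 i j • X i

theorem der_X (x : SL2) (j : Fin 2) : der x (X j) = x.1 0 j • X 0 + x.1 1 j • X 1 := by
  rw [der, mkDerivation_X, Fin.sum_univ_two]

theorem der_mem (m : ℕ) (x : SL2) (p : MvPolynomial (Fin 2) ℂ)
    (hp : p ∈ homogeneousSubmodule (Fin 2) ℂ m) : der x p ∈ homogeneousSubmodule (Fin 2) ℂ m := by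
  rw [← support_sum_monomial_coeff p, map_sum]
  refine Submodule.sum_mem _ fun s hs => ?_
  have hdeg : s.degree = m := by
    have := hp (mem_support_iff.1 hs)
    rw [Finsupp.degree_eq_weight_one]
    exact this
  rw [der, mkDerivation_monomial]
  refine Submodule.smul_mem _ _ (Submodule.sum_mem _ fun i hi => ?_)
  have hi1 : 1 ≤ s i := Nat.one_le_iff_ne_zero.2 (Finsupp.mem_support_iff.1 hi)
  have hd : (s - Finsupp.single i 1).degree + 1 = m := by
    have h1 : s - Finsupp.single i 1 + Finsupp.single i 1 = s :=
      tsub_add_cancel_of_le (Finsupp.single_le_iff.2 hi1)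
    rw [← hdeg, ← h1, map_add, Finsupp.degree_single, h1]
  change (monomial (s - Finsupp.single i 1) (s i : ℂ) * _).IsHomogeneous m
  rw [← hd]
  refine (isHomogeneous_monomial _ rfl).mul ?_
  rw [← mem_homogeneousSubmodule]
  exact Submodule.sum_mem _ fun k _ => Submodule.smul_mem _ _ (isHomogeneous_X ℂ k)

theorem der_lie (x y : SL2) (p : MvPolynomial (Fin 2) ℂ) :
    der ⁅x, y⁆ p = der x (der y p) - der y (der x p) := by
  have : der ⁅x, y⁆ = ⁅der x, der y⁆ := by
    refine MvPolynomial.derivation_ext fun j => ?_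
    rw [Derivation.commutator_apply]
    simp only [der_X, Derivation.map_smul, Derivation.map_add,
      LieAlgebra.SpecialLinear.sl_bracket, Fin.sum_univ_two, Matrix.sub_apply, Matrix.mul_apply]
    module
  rw [this, Derivation.commutator_apply]

variable (m : ℕ)

instance : AddCommGroup (BinaryForm m) :=
  inferInstanceAs (AddCommGroup (homogeneousSubmodule (Fin 2) ℂ m))

instance : Module ℂ (BinaryForm m) :=
  inferInstanceAs (Module ℂ (homogeneousSubmodule (Fin 2) ℂ m))

instance : LieRingModule SL2 (BinaryForm m) where
  bracket x p := ⟨der x p.1, der_mem m x p.1 p.2⟩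
  add_lie x y p := by
    refine Subtype.ext ?_
    change der (x + y) p.1 = der x p.1 + der y p.1
    have : der (x + y) = der x + der y := by
      refine MvPolynomial.derivation_ext fun j => ?_
      simp [der, add_smul]
      abel
    rw [this, Derivation.add_apply]
  lie_add x p q := Subtype.ext (map_add (der x) p.1 q.1)
  leibniz_lie x y p := by
    refine Subtype.ext ?_
    change der x (der y p.1) = der ⁅x, y⁆ p.1 + der y (der x p.1)
    rw [der_lie]; abel

instance : LieModule ℂ SL2 (BinaryForm m) where
  smul_lie r x p := by
    refine Subtype.ext ?_
    change der (r • x) p.1 = r • der x p.1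
    have : der (r • x) = r • der x := by
      refine MvPolynomial.derivation_ext fun j => ?_
      simp [der, smul_smul]
    rw [this, Derivation.smul_apply]
  lie_smul r x p := Subtype.ext (Derivation.map_smul (der x) r p.1)

/-- The highest weight vector `uᵐ = X₀ᵐ`. -/
def u : BinaryForm m := ⟨X 0 ^ m, by
  rw [mem_homogeneousSubmodule]; simpa using (isHomogeneous_X ℂ (0 : Fin 2)).pow m⟩

end BinaryForm

/-- The space `z^{-Δ} F[z, z⁻¹] = F ⊗ z^{-Δ} ℂ[z, z⁻¹]`; `Finsupp.single n v` stands for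
`v ⊗ z^{n-Δ}`. -/
def Twisted (_Δ : ℂ) (F : Type*) [Zero F] := ℤ →₀ F

namespace Twisted

variable (Δ : ℂ) (F : Type*) [AddCommGroup F] [Module ℂ F]

instance : AddCommGroup (Twisted Δ F) := inferInstanceAs (AddCommGroup (ℤ →₀ F))

instance : Module ℂ (Twisted Δ F) := inferInstanceAs (Module ℂ (ℤ →₀ F))

variable {F} in
/-- The element `v ⊗ z^{n-Δ}`. -/
def single (n : ℤ) : F →ₗ[ℂ] Twisted Δ F := Finsupp.lsingle n

variable {F} in
theorem hom_ext {M : Type*} [AddCommGroup M] [Module ℂ M] {f g : Twisted Δ F →ₗ[ℂ] M}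
    (h : ∀ n v, f (single Δ n v) = g (single Δ n v)) : f = g :=
  Finsupp.lhom_ext h

/-- The linear map with `v ⊗ z^{n-Δ} ↦ φ n v`. -/
def lift {M : Type*} [AddCommGroup M] [Module ℂ M] (φ : ℤ → F →ₗ[ℂ] M) : Twisted Δ F →ₗ[ℂ] M :=
  Finsupp.lsum ℂ φ

@[simp] theorem lift_single {M : Type*} [AddCommGroup M] [Module ℂ M] (φ : ℤ → F →ₗ[ℂ] M)
    (n : ℤ) (v : F) : lift Δ F φ (single Δ n v) = φ n v :=
  Finsupp.lsum_single ℂ φ n v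

/-- Multiplication by `z^{-Δ}`, from `F[z, z⁻¹]` to `z^{-Δ} F[z, z⁻¹]`. -/
def mulPow : Twisted 0 F →ₗ[ℂ] Twisted Δ F := lift 0 F fun n => single Δ n

/-- The derivation `z ∂/∂z`: it multiplies `v ⊗ z^{n-Δ}` by `n - Δ`. -/
def euler : Module.End ℂ (Twisted Δ F) := lift Δ F fun n : ℤ => ((n : ℂ) - Δ) • single Δ n

@[simp] theorem euler_single (k : ℤ) (v : F) :
    euler Δ F (single Δ k v) = ((k : ℂ) - Δ) • single Δ k v := by
  simp [euler]

variable [LieRingModule SL2 F] [LieModule ℂ SL2 F]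

/-- The element `x ⊗ tⁿ` acts by `x` on `F` and by multiplication by `zⁿ`. -/
def opT (n : ℤ) : SL2 →ₗ[ℂ] Module.End ℂ (Twisted Δ F) where
  toFun x := lift Δ F fun k : ℤ => single Δ (k + n) ∘ₗ LieModule.toEnd ℂ SL2 F x
  map_add' x y := hom_ext Δ fun k v => by simp [LinearMap.add_apply]
  map_smul' r x := hom_ext Δ fun k v => by simp [LinearMap.smul_apply]

@[simp] theorem opT_single (n k : ℤ) (x : SL2) (v : F) :
    opT Δ F n x (single Δ k v) = single Δ (k + n) ⁅x, v⁆ := lift_single ..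

theorem isRep : Affine.IsRep (opT Δ F) 0 (euler Δ F) where
  tt m n x y := hom_ext Δ fun k v => by
    simp only [LinearMap.sub_apply, Module.End.mul_apply, opT_single, smul_zero, add_zero]
    rw [add_assoc, add_assoc, add_comm n m, ← map_sub, lie_lie]
  kt n x := by simp
  dt n x := hom_ext Δ fun k v => by
    simp only [LinearMap.sub_apply, Module.End.mul_apply, opT_single, LinearMap.smul_apply,
      euler_single, map_smul, Int.cast_add]
    module
  kd := by simp

/-- The action of `𝔤̃`, in which `c` acts by `0` and `d` by `z ∂/∂z`. -/
instance : LieRingModule Affine (Twisted Δ F) := (isRep Δ F).lieRingModule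

instance : LieModule ℂ Affine (Twisted Δ F) := (isRep Δ F).lieModule

end Twisted

/-! ### Completed tensor products -/

theorem Affine.el_lie_el (m n : ℤ) (x y : SL2) : ⁅Affine.el m x, Affine.el n y⁆ =
    Affine.el (m + n) ⁅x, y⁆ + (if m + n = 0 then (m : ℂ) * traceForm x y else 0) • Affine.c := by
  ext
  · simp only [el, c, lie_loop, add_loop, smul_loop, Loop.lie_tm, zero_smul, smul_zero]; abel
  · simp only [el, c, lie_cc, add_cc, smul_cc, cocycle_tm, mul_one, zero_add]
  · simp only [el, c, lie_dd, add_dd, smul_dd, mul_zero, add_zero]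

theorem Affine.el_add (n : ℤ) (x y : SL2) : Affine.el n (x + y) = Affine.el n x + Affine.el n y := by
  ext <;> simp [el]

theorem Affine.el_smul (n : ℤ) (r : ℂ) (x : SL2) : Affine.el n (r • x) = r • Affine.el n x := by
  ext <;> simp [el]

theorem Affine.c_lie (x : Affine) : ⁅Affine.c, x⁆ = 0 := by
  ext <;> simp [Affine.c]

/-- Sequences `(ξⱼ)`, `j ∈ ℤ`, of elements of `M ⊗ U`, thought of as formal sums `∑ⱼ ξⱼ`. -/
def FormalTensor (M U : Type*) [AddCommGroup M] [Module ℂ M] [AddCommGroup U] [Module ℂ U] :=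
  ℤ → M ⊗[ℂ] U

namespace FormalTensor

variable (M U : Type*) [AddCommGroup M] [Module ℂ M] [AddCommGroup U] [Module ℂ U]

instance : AddCommGroup (FormalTensor M U) := inferInstanceAs (AddCommGroup (ℤ → M ⊗[ℂ] U))

instance : Module ℂ (FormalTensor M U) := inferInstanceAs (Module ℂ (ℤ → M ⊗[ℂ] U))

variable {M U} in
@[ext] theorem ext {ξ η : FormalTensor M U} (h : ∀ j, ξ j = η j) : ξ = η := funext h

variable {M U} in
@[simp] theorem add_apply (ξ η : FormalTensor M U) (j : ℤ) : (ξ + η) j = ξ j + η j := rfl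

variable {M U} in
@[simp] theorem sub_apply (ξ η : FormalTensor M U) (j : ℤ) : (ξ - η) j = ξ j - η j := rfl

variable {M U} in
@[simp] theorem smul_apply (r : ℂ) (ξ : FormalTensor M U) (j : ℤ) : (r • ξ) j = r • ξ j := rfl

/-- The operator `A ⊗ 1` on `M ⊗ U`, for `A` an operator on `M` which raises the degree by `n`,
applied to formal sums. -/
def left (n : ℤ) (A : Module.End ℂ M) : Module.End ℂ (FormalTensor M U) where
  toFun ξ j := LinearMap.rTensor U A (ξ (j - n))
  map_add' _ _ := ext fun _ => map_add _ _ _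
  map_smul' r ξ := ext fun _ => LinearMap.map_smul _ r (ξ _)

/-- The operator `1 ⊗ B` applied to formal sums. -/
def right (B : Module.End ℂ U) : Module.End ℂ (FormalTensor M U) where
  toFun ξ j := LinearMap.lTensor M B (ξ j)
  map_add' _ _ := ext fun _ => map_add _ _ _
  map_smul' r ξ := ext fun _ => LinearMap.map_smul _ r (ξ _)

variable {M U}

theorem left_apply (n : ℤ) (A : Module.End ℂ M) (ξ : FormalTensor M U) (j : ℤ) :
    left M U n A ξ j = LinearMap.rTensor U A (ξ (j - n)) := rfl

theorem right_apply (B : Module.End ℂ U) (ξ : FormalTensor M U) (j : ℤ) :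
    right M U B ξ j = LinearMap.lTensor M B (ξ j) := rfl

theorem left_mul_left (m n : ℤ) (A B : Module.End ℂ M) :
    left M U m A * left M U n B = left M U (m + n) (A * B) := by
  refine LinearMap.ext fun ξ => ext fun j => ?_
  rw [Module.End.mul_apply, left_apply, left_apply, left_apply, LinearMap.rTensor_mul,
    Module.End.mul_apply, sub_sub]

theorem right_mul_right (A B : Module.End ℂ U) :
    right M U A * right M U B = right M U (A * B) := by
  refine LinearMap.ext fun ξ => ext fun j => ?_
  rw [Module.End.mul_apply, right_apply, right_apply, right_apply, LinearMap.lTensor_mul,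
    Module.End.mul_apply]

theorem right_mul_left (n : ℤ) (A : Module.End ℂ M) (B : Module.End ℂ U) :
    right M U B * left M U n A = left M U n A * right M U B := by
  refine LinearMap.ext fun ξ => ext fun j => ?_
  simp only [Module.End.mul_apply, left_apply, right_apply]
  rw [← LinearMap.comp_apply, ← LinearMap.comp_apply, LinearMap.lTensor_comp_rTensor,
    LinearMap.rTensor_comp_lTensor]

theorem left_add (n : ℤ) (A B : Module.End ℂ M) :
    left M U n (A + B) = left M U n A + left M U n B := by
  refine LinearMap.ext fun ξ => ext fun j => ?_
  simp [left_apply, LinearMap.rTensor_add]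

theorem left_sub (n : ℤ) (A B : Module.End ℂ M) :
    left M U n (A - B) = left M U n A - left M U n B := by
  refine LinearMap.ext fun ξ => ext fun j => ?_
  simp [left_apply, LinearMap.rTensor_sub]

theorem left_smul (n : ℤ) (r : ℂ) (A : Module.End ℂ M) :
    left M U n (r • A) = r • left M U n A := by
  refine LinearMap.ext fun ξ => ext fun j => ?_
  simp [left_apply, LinearMap.rTensor_smul]

theorem left_zero (n : ℤ) : left M U n 0 = 0 := by
  refine LinearMap.ext fun ξ => ext fun j => ?_
  rw [left_apply, LinearMap.rTensor_zero]; rfl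

theorem right_zero : right M U 0 = 0 := by
  refine LinearMap.ext fun ξ => ext fun j => ?_
  rw [right_apply, LinearMap.lTensor_zero]; rfl

theorem right_add (A B : Module.End ℂ U) :
    right M U (A + B) = right M U A + right M U B := by
  refine LinearMap.ext fun ξ => ext fun j => ?_
  simp [right_apply, LinearMap.lTensor_add]

theorem right_sub (A B : Module.End ℂ U) :
    right M U (A - B) = right M U A - right M U B := by
  refine LinearMap.ext fun ξ => ext fun j => ?_
  simp [right_apply, LinearMap.lTensor_sub]

theorem right_smul (r : ℂ) (A : Module.End ℂ U) :
    right M U (r • A) = r • right M U A := by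
  refine LinearMap.ext fun ξ => ext fun j => ?_
  simp [right_apply, LinearMap.lTensor_smul]

variable (M U)
variable [LieRingModule Affine M] [LieModule ℂ Affine M]
  [LieRingModule Affine U] [LieModule ℂ Affine U]

/-- `xₙ` acts by `xₙ ⊗ 1 + 1 ⊗ xₙ`. -/
def opT (n : ℤ) : SL2 →ₗ[ℂ] Module.End ℂ (FormalTensor M U) where
  toFun x := left M U n (LieModule.toEnd ℂ Affine M (Affine.el n x)) +
    right M U (LieModule.toEnd ℂ Affine U (Affine.el n x))
  map_add' x y := by
    rw [Affine.el_add, map_add, map_add, left_add, right_add]; abel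
  map_smul' r x := by
    rw [Affine.el_smul, map_smul, map_smul, left_smul, right_smul, smul_add]; rfl

/-- `c` and `d` act by `x ⊗ 1 + 1 ⊗ x`. -/
def opCD (x : Affine) : Module.End ℂ (FormalTensor M U) :=
  left M U 0 (LieModule.toEnd ℂ Affine M x) + right M U (LieModule.toEnd ℂ Affine U x)

theorem toEnd_mul (M : Type*) [AddCommGroup M] [Module ℂ M] [LieRingModule Affine M]
    [LieModule ℂ Affine M] (x y : Affine) :
    LieModule.toEnd ℂ Affine M x * LieModule.toEnd ℂ Affine M y =
    LieModule.toEnd ℂ Affine M y * LieModule.toEnd ℂ Affine M x +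
      LieModule.toEnd ℂ Affine M ⁅x, y⁆ := by
  refine LinearMap.ext fun v => ?_
  simp only [LinearMap.add_apply, Module.End.mul_apply, LieModule.toEnd_apply_apply]
  rw [leibniz_lie x y v]; abel

/-- The operators `left` and `right` combine to a representation. -/
theorem comm (m n : ℤ) (x y : Affine) :
    (left M U m (LieModule.toEnd ℂ Affine M x) + right M U (LieModule.toEnd ℂ Affine U x)) *
    (left M U n (LieModule.toEnd ℂ Affine M y) + right M U (LieModule.toEnd ℂ Affine U y)) =
    (left M U n (LieModule.toEnd ℂ Affine M y) + right M U (LieModule.toEnd ℂ Affine U y)) *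
    (left M U m (LieModule.toEnd ℂ Affine M x) + right M U (LieModule.toEnd ℂ Affine U x)) +
    (left M U (m + n) (LieModule.toEnd ℂ Affine M ⁅x, y⁆) +
      right M U (LieModule.toEnd ℂ Affine U ⁅x, y⁆)) := by
  simp only [mul_add, add_mul, left_mul_left, right_mul_right, right_mul_left, toEnd_mul _ x y,
    left_add, right_add]
  rw [add_comm n m]
  abel

theorem isRep : Affine.IsRep (opT M U) (opCD M U Affine.c) (opCD M U Affine.d) where
  tt m n x y := by
    refine sub_eq_iff_eq_add'.2 ((comm M U m n _ _).trans (congrArg₂ (· + ·) rfl ?_))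
    rw [Affine.el_lie_el, map_add, map_add, map_smul, map_smul, left_add, right_add, left_smul,
      right_smul]
    have : ∀ r : ℂ, (if m + n = 0 then r else 0) •
        left M U (m + n) (LieModule.toEnd ℂ Affine M Affine.c) =
        (if m + n = 0 then r else 0) • left M U 0 (LieModule.toEnd ℂ Affine M Affine.c) := by
      intro r
      split_ifs with h
      · rw [h]
      · simp
    rw [this]
    change _ = ((_ + _ : Module.End ℂ (FormalTensor M U)) +
      _ • (_ + _ : Module.End ℂ (FormalTensor M U)))
    rw [smul_add]
    abel
  kt n x := by
    refine (comm M U 0 n _ _).trans ?_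
    rw [Affine.c_lie, map_zero, map_zero, left_zero, right_zero, add_zero, add_zero]
    rfl
  dt n x := by
    refine sub_eq_iff_eq_add'.2 ((comm M U 0 n _ _).trans ?_)
    rw [Affine.d_lie_el, map_smul, map_smul, left_smul, right_smul, zero_add, ← smul_add]
    rfl
  kd := by
    refine (comm M U 0 0 _ _).trans ?_
    rw [Affine.c_lie, map_zero, map_zero, left_zero, right_zero, add_zero, add_zero]
    rfl

instance : LieRingModule Affine (FormalTensor M U) := (isRep M U).lieRingModule

instance : LieModule ℂ Affine (FormalTensor M U) := (isRep M U).lieModule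

end FormalTensor
/-- The space of vectors of degree `s` in a `𝔤̃`-module: the eigenspace of `d`. -/
def degSpace (M : Type*) [AddCommGroup M] [Module ℂ M] [LieRingModule Affine M]
    [LieModule ℂ Affine M] (s : ℂ) : Submodule ℂ M :=
  (LieModule.toEnd ℂ Affine M Affine.d).eigenspace s

section degSpace

variable {M : Type*} [AddCommGroup M] [Module ℂ M] [LieRingModule Affine M] [LieModule ℂ Affine M]

theorem mem_degSpace {s : ℂ} {v : M} : v ∈ degSpace M s ↔ ⁅Affine.d, v⁆ = s • v :=
  Module.End.mem_eigenspace_iff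

theorem lie_mem_degSpace {x : Affine} {n s : ℂ} (hx : ⁅Affine.d, x⁆ = n • x) {v : M}
    (hv : v ∈ degSpace M s) : ⁅x, v⁆ ∈ degSpace M (s + n) := by
  rw [mem_degSpace] at hv ⊢
  rw [leibniz_lie, hv, hx, smul_lie, lie_smul, add_smul, add_comm]

end degSpace

/-- The image of `P ⊗ U` in `M ⊗ U`. -/
def subTensor {M : Type*} [AddCommGroup M] [Module ℂ M] (P : Submodule ℂ M) (U : Type*)
    [AddCommGroup U] [Module ℂ U] : Submodule ℂ (M ⊗[ℂ] U) :=
  (LinearMap.rTensor U P.subtype).range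

theorem tmul_mem_subTensor {M U : Type*} [AddCommGroup M] [Module ℂ M] [AddCommGroup U]
    [Module ℂ U] {P : Submodule ℂ M} {v : M} (hv : v ∈ P) (u : U) : v ⊗ₜ[ℂ] u ∈ subTensor P U :=
  ⟨(⟨v, hv⟩ : P) ⊗ₜ[ℂ] u, by simp⟩

theorem map_mem_subTensor {M M' U U' : Type*} [AddCommGroup M] [Module ℂ M] [AddCommGroup M']
    [Module ℂ M'] [AddCommGroup U] [Module ℂ U] [AddCommGroup U'] [Module ℂ U']
    {P : Submodule ℂ M} {P' : Submodule ℂ M'} (A : M →ₗ[ℂ] M') (B : U →ₗ[ℂ] U')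
    (hA : ∀ v ∈ P, A v ∈ P') {t : M ⊗[ℂ] U} (ht : t ∈ subTensor P U) :
    TensorProduct.map A B t ∈ subTensor P' U' := by
  obtain ⟨t, rfl⟩ := ht
  induction t using TensorProduct.induction_on with
  | zero => simp
  | tmul v u => simpa using tmul_mem_subTensor (hA v v.2) (B u)
  | add x y hx hy => rw [map_add, map_add]; exact Submodule.add_mem _ hx hy

section CTensor

variable (M : Type*) [AddCommGroup M] [Module ℂ M] [LieRingModule Affine M] [LieModule ℂ Affine M]
  (s : ℂ) (U : Type*) [AddCommGroup U] [Module ℂ U] [LieRingModule Affine U] [LieModule ℂ Affine U]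

/-- The completed tensor product `M ⊗̂ U`: the infinite sums `∑ wᵢ ⊗ uᵢ` with homogeneous `wᵢ` whose
degrees tend to `-∞`. Degrees are taken in `s + ℤ`, and the terms of degree `s + j` are collected
in the `j`-th component. -/
def CTensor : LieSubmodule ℂ Affine (FormalTensor M U) where
  carrier := {ξ | (∀ j : ℤ, ξ j ∈ subTensor (degSpace M (s + j)) U) ∧ ∃ N : ℤ, ∀ j > N, ξ j = 0}
  zero_mem' := ⟨fun _ => Submodule.zero_mem _, 0, fun _ _ => rfl⟩
  add_mem' := by
    rintro ξ η ⟨h1, N1, h2⟩ ⟨h3, N2, h4⟩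
    refine ⟨fun j => Submodule.add_mem _ (h1 j) (h3 j), max N1 N2, fun j hj => ?_⟩
    rw [FormalTensor.add_apply, h2 j (by lia), h4 j (by lia), add_zero]
  smul_mem' := by
    rintro r ξ ⟨h1, N, h2⟩
    refine ⟨fun j => Submodule.smul_mem _ r (h1 j), N, fun j hj => ?_⟩
    rw [FormalTensor.smul_apply, h2 j hj, smul_zero]
  lie_mem := by
    have key : ∀ (n : ℤ) (x : Affine), ⁅Affine.d, x⁆ = (n : ℂ) • x → ∀ ξ : FormalTensor M U,
        ((∀ j : ℤ, ξ j ∈ subTensor (degSpace M (s + j)) U) ∧ ∃ N : ℤ, ∀ j > N, ξ j = 0) →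
        ∀ η : FormalTensor M U, η = FormalTensor.left M U n (LieModule.toEnd ℂ Affine M x) ξ +
          FormalTensor.right M U (LieModule.toEnd ℂ Affine U x) ξ →
        ((∀ j : ℤ, η j ∈ subTensor (degSpace M (s + j)) U) ∧ ∃ N : ℤ, ∀ j > N, η j = 0) := by
      rintro n x hx ξ ⟨h1, N, h2⟩ η rfl
      refine ⟨fun j => Submodule.add_mem _ ?_ ?_, N + |n|, fun j hj => ?_⟩
      · refine map_mem_subTensor _ LinearMap.id (fun v hv => ?_) (h1 (j - n))
        have := lie_mem_degSpace hx hv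
        rwa [show s + ((j - n : ℤ) : ℂ) + n = s + j by push_cast; ring] at this
      · exact map_mem_subTensor LinearMap.id _ (fun v hv => hv) (h1 j)
      · have := le_abs_self n
        have := abs_nonneg n
        rw [FormalTensor.add_apply, FormalTensor.left_apply, FormalTensor.right_apply,
          h2 j (by lia), h2 (j - n) (by lia), map_zero, map_zero, add_zero]
    have hadd : ∀ ξ η : FormalTensor M U,
        ((∀ j : ℤ, ξ j ∈ subTensor (degSpace M (s + j)) U) ∧ ∃ N : ℤ, ∀ j > N, ξ j = 0) →
        ((∀ j : ℤ, η j ∈ subTensor (degSpace M (s + j)) U) ∧ ∃ N : ℤ, ∀ j > N, η j = 0) →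
        ((∀ j : ℤ, (ξ + η) j ∈ subTensor (degSpace M (s + j)) U) ∧
          ∃ N : ℤ, ∀ j > N, (ξ + η) j = 0) := by
      rintro ξ η ⟨h1, N1, h2⟩ ⟨h3, N2, h4⟩
      refine ⟨fun j => Submodule.add_mem _ (h1 j) (h3 j), max N1 N2, fun j hj => ?_⟩
      rw [FormalTensor.add_apply, h2 j (by lia), h4 j (by lia), add_zero]
    have hsmul : ∀ (r : ℂ) (ξ : FormalTensor M U),
        ((∀ j : ℤ, ξ j ∈ subTensor (degSpace M (s + j)) U) ∧ ∃ N : ℤ, ∀ j > N, ξ j = 0) →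
        ((∀ j : ℤ, (r • ξ) j ∈ subTensor (degSpace M (s + j)) U) ∧
          ∃ N : ℤ, ∀ j > N, (r • ξ) j = 0) := by
      rintro r ξ ⟨h1, N, h2⟩
      refine ⟨fun j => Submodule.smul_mem _ r (h1 j), N, fun j hj => ?_⟩
      rw [FormalTensor.smul_apply, h2 j hj, smul_zero]
    intro x ξ hξ
    refine hadd _ _ (hadd _ _ ?_ (hsmul _ _ ?_)) (hsmul _ _ ?_)
    · generalize x.loop = u
      induction u using Loop.ind with
      | h0 => exact ⟨fun _ => Submodule.zero_mem _, 0, fun _ _ => by rw [map_zero]; rfl⟩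
      | hadd u v hu hv => rw [map_add]; exact hadd _ _ hu hv
      | htm n x =>
        refine key n (Affine.el n x) (Affine.d_lie_el n x) ξ hξ _ ?_
        rw [Loop.lift_tm]; rfl
    · exact key 0 Affine.c (by ext <;> simp [Affine.c, Affine.d]) ξ hξ _ rfl
    · exact key 0 Affine.d (by simp) ξ hξ _ rfl

theorem mem_CTensor (ξ : FormalTensor M U) : ξ ∈ CTensor M s U ↔
    (∀ j : ℤ, ξ j ∈ subTensor (degSpace M (s + j)) U) ∧ ∃ N : ℤ, ∀ j > N, ξ j = 0 := Iff.rfl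

variable {M U}

/-- The map `f ⊗̂ g` between completed tensor products. -/
def CTensor.map {M' : Type*} [AddCommGroup M'] [Module ℂ M'] [LieRingModule Affine M']
    [LieModule ℂ Affine M'] {U' : Type*} [AddCommGroup U'] [Module ℂ U'] [LieRingModule Affine U']
    [LieModule ℂ Affine U'] (f : M →ₗ⁅ℂ, Affine⁆ M') (g : U →ₗ[ℂ] U') :
    CTensor M s U →ₗ[ℂ] CTensor M' s U' where
  toFun ξ := ⟨fun j => TensorProduct.map (f : M →ₗ[ℂ] M') g (ξ.1 j),
    fun j => map_mem_subTensor _ _ (fun v hv => by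
      rw [mem_degSpace] at hv ⊢
      refine (f.map_lie Affine.d v).symm.trans ?_
      rw [hv]
      exact (f : M →ₗ[ℂ] M').map_smul _ v) (ξ.2.1 j),
    ξ.2.2.imp fun N hN j hj =>
      (congrArg _ (hN j hj)).trans (map_zero (TensorProduct.map (f : M →ₗ[ℂ] M') g))⟩
  map_add' ξ η := Subtype.ext <| FormalTensor.ext fun j => map_add _ _ _
  map_smul' r ξ := Subtype.ext <| FormalTensor.ext fun j => LinearMap.map_smul _ r (ξ.1 j)

end CTensor

/-! ### The imaginary highest weight vector -/

/-- The coefficient `α_π = β ∏ₖ (1 / nₖ!) (-m / (2 κ k))^{nₖ}`, where `nₖ` is the number of parts of `π`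
that are equal to `k`. -/
def alpha (κ : ℂ) (m : ℕ) (β : ℂ) {n : ℕ} (π : n.Partition) : ℂ :=
  β * ∏ k ∈ π.parts.toFinset,
    (-(m : ℂ) / (2 * κ * k)) ^ π.parts.count k / ((π.parts.count k).factorial : ℂ)

/-- For operators `Tₖ` of degree `-k` on `M`, the formal sum `∑ₙ ∑_π α_π T_π w ⊗ z^{n-Δ} uᵐ` with `π`
ranging over the partitions of `n`, where `T_π = T₁^{n₁} T₂^{n₂} ⋯`; its `n`-th term has degree `-n`. -/
def sharp {M : Type*} [AddCommGroup M] [Module ℂ M] (T : ℕ → Module.End ℂ M) (w : M)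
    (κ : ℂ) (m : ℕ) (β Δ : ℂ) : FormalTensor M (Twisted Δ (BinaryForm m)) := fun j =>
  if j ≤ 0 then
    (∑ π : (-j).toNat.Partition, alpha κ m β π • ((π.parts.sort (· ≤ ·)).map T).prod w) ⊗ₜ[ℂ]
      Twisted.single Δ (-j) (BinaryForm.u m)
  else 0

theorem sharp_mem {M : Type*} [AddCommGroup M] [Module ℂ M] [LieRingModule Affine M]
    [LieModule ℂ Affine M] (T : ℕ → Module.End ℂ M) (w : M) (s : ℂ) (hw : w ∈ degSpace M s)
    (hT : ∀ (k : ℕ) (t : ℂ) (v : M), v ∈ degSpace M t → T k v ∈ degSpace M (t - k)) (κ : ℂ) (m : ℕ) (β Δ : ℂ) :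
    sharp T w κ m β Δ ∈ CTensor M s (Twisted Δ (BinaryForm m)) := by
  have hL : ∀ L : List ℕ, (L.map T).prod w ∈ degSpace M (s - L.sum) := by
    intro L
    induction L with
    | nil => simpa using hw
    | cons k L ih =>
      have := hT k _ _ ih
      rw [List.map_cons, List.prod_cons, Module.End.mul_apply, List.sum_cons]
      rwa [Nat.cast_add, add_comm (k : ℂ), ← sub_sub]
  rw [mem_CTensor]
  refine ⟨fun j => ?_, 0, fun j hj => if_neg (by lia)⟩
  rw [sharp]
  split_ifs with h
  · refine tmul_mem_subTensor (Submodule.sum_mem _ fun π _ => Submodule.smul_mem _ _ ?_) _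
    have := hL (π.parts.sort (· ≤ ·))
    have h2 : (π.parts.sort (· ≤ ·)).sum = (-j).toNat := by
      rw [← Multiset.sum_coe, Multiset.sort_eq, π.parts_sum]
    have h3 : s - (((-j).toNat : ℕ) : ℂ) = s + j := by
      have : (((-j).toNat : ℤ) : ℂ) = ((-j : ℤ) : ℂ) := by rw [Int.toNat_of_nonneg (by lia)]
      push_cast at this
      rw [this]; ring
    rwa [h2, h3] at this
  · exact Submodule.zero_mem _

/-- The vector `v^♯_{λ,κ} = ∑ₙ ∑_π α_π h_π v_{λ-m,κ} ⊗ uᵐₙ` in `V_{λ-m,κ} ⊗̂ 𝔉ₘ(z)`. -/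
def vSharp (l κ : ℂ) (m : ℕ) (β : ℂ) :
    CTensor (Verma (l - m) κ) (-confWeight (l - m) κ) (Twisted 0 (BinaryForm m)) :=
  ⟨sharp (fun k => LieModule.toEnd ℂ Affine (Verma (l - m) κ) (Affine.h (-(k : ℤ))))
      (Verma.v (l - m) κ) κ m β 0,
    sharp_mem _ _ _ (mem_degSpace.2 (Verma.d_v _ _)) (fun k t v hv => by
      have := lie_mem_degSpace (Affine.d_lie_el (-(k : ℤ)) slH) hv
      rwa [Int.cast_neg, ← sub_eq_add_neg, Int.cast_natCast] at this) _ _ _ _⟩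

/-! ### The intertwining operators -/

/-- `Ψ` is the Cox–Futorny isomorphism `V_{λ,κ} → W_{λ,κ}`: the isomorphism of `𝔤̃`-modules with
`f_{n₁} ⋯ f_{nₖ} h_{-m₁} ⋯ h_{-mⱼ} v_{λ,κ} ↦ a_{n₁} ⋯ a_{nₖ} b_{-m₁} ⋯ b_{-mⱼ} w_{λ,κ}`. -/
def IsCoxFutorny {l κ : ℂ} (Ψ : Verma l κ ≃ₗ⁅ℂ, Affine⁆ Wakimoto l κ) : Prop :=
  ∀ (ns : List ℤ) (ms : List ℕ+),
    Ψ ((ns.map fun n => LieModule.toEnd ℂ Affine (Verma l κ) (Affine.f n)).prod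
      ((ms.map fun k => LieModule.toEnd ℂ Affine (Verma l κ) (Affine.h (-(k : ℤ)))).prod
        (Verma.v l κ))) =
    (ns.map fun n => Wakimoto.a l κ n).prod
      ((ms.map fun k => Wakimoto.b l κ (-(k : ℤ))).prod (Wakimoto.w l κ))

/-- `Φ` is the intertwiner `Φ^V(z) : V_{λ,κ} → V_{λ-m,κ} ⊗̂ 𝔉ₘ(z)`: the homomorphism of `𝔤̂`-modules with
`v_{λ,κ} ↦ v^♯_{λ,κ}`. -/
def IsPhiV {l κ : ℂ} {m : ℕ} (β : ℂ) (Φ : Verma l κ →ₗ⁅ℂ, Affine.hat⁆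
    CTensor (Verma (l - m) κ) (-confWeight (l - m) κ) (Twisted 0 (BinaryForm m))) : Prop :=
  Φ (Verma.v l κ) = vSharp l κ m β

section

variable {l κ : ℂ} {m : ℕ} (Ψ : Verma l κ ≃ₗ⁅ℂ, Affine⁆ Wakimoto l κ)
  (Ψ' : Verma (l - m) κ ≃ₗ⁅ℂ, Affine⁆ Wakimoto (l - m) κ)
  (Φ : Verma l κ →ₗ⁅ℂ, Affine.hat⁆
    CTensor (Verma (l - m) κ) (-confWeight (l - m) κ) (Twisted 0 (BinaryForm m)))

/-- `Φ^W(z) = (Ψ_{λ-m,κ} ⊗ 1) ∘ Φ^V(z) ∘ Ψ_{λ,κ}⁻¹`. -/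
def phiW : Wakimoto l κ →ₗ[ℂ]
    CTensor (Wakimoto (l - m) κ) (-confWeight (l - m) κ) (Twisted 0 (BinaryForm m)) :=
  CTensor.map _ Ψ'.toLieModuleHom LinearMap.id ∘ₗ Φ.toLinearMap ∘ₗ Ψ.symm.toLinearMap

/-- `z^{-Δ} Φ^W(z)`. -/
def zPhiW (Δ : ℂ) : Wakimoto l κ →ₗ[ℂ]
    CTensor (Wakimoto (l - m) κ) (-confWeight (l - m) κ) (Twisted Δ (BinaryForm m)) :=
  CTensor.map _ LieModuleHom.id (Twisted.mulPow Δ (BinaryForm m)) ∘ₗ phiW Ψ Ψ' Φ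

end

end ImaginaryWakimoto

end

open ImaginaryWakimoto

/-!
Everything follows from two facts about a vector `w` on which the natural Borel subalgebra acts by a
character, called an imaginary highest weight vector here (`IsImaginaryHighest`).

* The imaginary Verma module is the universal module with such a vector (`Verma.lift`), and the words
  `f_{n₁} ⋯ f_{nᵢ} h_{-m₁} ⋯ h_{-mⱼ} v` span it, by commuting `e`, `h`, `c`, `d` to the right
  (`IsImaginaryHighest.mem_wordStabilizer`).  Only elements of `𝔤̂` occur in words, so `v` generates
  over `𝔤̂` as well, and homomorphisms of `𝔤̂`-modules are determined by the image of `v`.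
* In the Wakimoto module, `fₙ` is multiplication by `xₙ` and `h₋ₖ` is multiplication by `yₖ` on
  polynomials in the `y` alone.  So the homomorphism `V → W` with `v ↦ w` maps words to monomials.  As
  monomials are a basis, there is a linear map back which restores the words, and the homomorphism is
  bijective.  No independence of the words is needed beforehand.

For the intertwiner one checks that `∑ α_π h_π w ⊗ z^{n-Δ} uᵐ` is again an imaginary highest weight
vector (`IsImaginaryHighest.hSharp`).  The elements `eₙ` kill both tensor factors.  For `n > 0` the
operator `hₙ` acts on the `h_π w` as `2 n κ ∂/∂h₋ₙ`, and the recursion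
`α_{π ∪ n} · 2 n κ · (multiplicity of n) = -m α_π` makes the result cancel against `hₙ uᵐ = m zⁿ uᵐ`.
The weight is `(λ - m) + m = λ`, and the degree is `-Δ(λ-m) - Δ`.  For `Δ = Δ(λ) - Δ(λ-m)` this is the
degree of `v_{λ,κ}`, so the universal property gives a homomorphism of `𝔤̃`-modules, and multiplying by
a power of `z`, which is `𝔤̂`-linear, gives `Φ^V(z)`.

Finally `z^{-Δ} Φ^W(z)` is composed of `𝔤̂`-linear maps, and it commutes with `d` if and only if it does
so on the generator, since `[d, 𝔤̂] ⊆ 𝔤̂`.  There it is a comparison of two degrees, the image of the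
generator being nonzero.
-/

noncomputable section

namespace ImaginaryWakimoto

/-! ### Relations in the affine Lie algebra -/

theorem slE_lie_slF : ⁅slE, slF⁆ = slH := by
  apply Subtype.ext; rw [LieAlgebra.SpecialLinear.sl_bracket]
  ext i j; fin_cases i <;> fin_cases j <;>
  simp [slE, slF, slH, Matrix.single, Matrix.mul_apply]

theorem slH_lie_slE : ⁅slH, slE⁆ = (2 : ℂ) • slE := by
  apply Subtype.ext; rw [LieAlgebra.SpecialLinear.sl_bracket]
  ext i j; fin_cases i <;> fin_cases j <;>
  simp [slE, slH, Matrix.single, Matrix.mul_apply]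
  norm_num

theorem slH_lie_slF : ⁅slH, slF⁆ = (-2 : ℂ) • slF := by
  apply Subtype.ext; rw [LieAlgebra.SpecialLinear.sl_bracket]
  ext i j; fin_cases i <;> fin_cases j <;>
  simp [slF, slH, Matrix.single, Matrix.mul_apply]
  norm_num

namespace Affine

theorem el_zero (n : ℤ) : el n 0 = 0 := by
  simpa using el_smul n 0 0

theorem e_lie_f (m n : ℤ) :
    ⁅e m, f n⁆ = h (m + n) + (if m + n = 0 then (m : ℂ) else 0) • c := by
  have t : traceForm slE slF = 1 := by
    simp [traceForm_apply, slE, slF, Matrix.trace_fin_two, Matrix.single, Matrix.mul_apply]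
  rw [e, f, el_lie_el, slE_lie_slF, t, mul_one, h]

theorem h_lie_f (m n : ℤ) : ⁅h m, f n⁆ = (-2 : ℂ) • f (m + n) := by
  have t : traceForm slH slF = 0 := by
    simp [traceForm_apply, slH, slF, Matrix.trace_fin_two, Matrix.single, Matrix.mul_apply]
  rw [h, f, el_lie_el, slH_lie_slF, t, mul_zero, ite_self, zero_smul, add_zero, el_smul, f]

theorem e_lie_h (m n : ℤ) : ⁅e m, h n⁆ = (-2 : ℂ) • e (m + n) := by
  have t : traceForm slE slH = 0 := by
    simp [traceForm_apply, slH, slE, Matrix.trace_fin_two, Matrix.single, Matrix.mul_apply]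
  rw [e, h, el_lie_el, ← lie_skew, slH_lie_slE, t, mul_zero, ite_self, zero_smul, add_zero,
    ← neg_smul, el_smul, e]

theorem h_lie_h (m n : ℤ) :
    ⁅h m, h n⁆ = (if m + n = 0 then 2 * (m : ℂ) else 0) • c := by
  have t : traceForm slH slH = 2 := by
    simp [traceForm_apply, slH, Matrix.trace_fin_two, Matrix.single, Matrix.mul_apply]
    norm_num
  rw [h, h, el_lie_el, lie_self, t, el_zero, zero_add, mul_comm]

theorem f_lie_f (m n : ℤ) : ⁅f m, f n⁆ = 0 := by
  have t : traceForm slF slF = 0 := by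
    simp [traceForm_apply, slF, Matrix.trace_fin_two, Matrix.single, Matrix.mul_apply]
  rw [f, f, el_lie_el, lie_self, t, mul_zero, ite_self, zero_smul, el_zero, add_zero]

/-- Induction over `𝔤̂`, the elements of `𝔤̃` without `d`-component. -/
theorem mem_of_dd_eq_zero {Q : Submodule ℂ Affine} (hel : ∀ n x, el n x ∈ Q) (hc : c ∈ Q)
    {x : Affine} (hx : x.dd = 0) : x ∈ Q := by
  obtain ⟨u, r, s⟩ := x
  obtain rfl : s = 0 := hx
  have h1 : (⟨u, r, 0⟩ : Affine) = ⟨u, 0, 0⟩ + r • c := by ext <;> simp [c]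
  rw [h1]
  refine Q.add_mem ?_ (Q.smul_mem _ hc)
  clear h1
  induction u using Loop.ind with
  | h0 => exact Q.zero_mem
  | htm n x => exact hel n x
  | hadd u v hu hv =>
    have h2 : (⟨u + v, 0, 0⟩ : Affine) = ⟨u, 0, 0⟩ + ⟨v, 0, 0⟩ := by ext <;> simp
    rw [h2]
    exact Q.add_mem hu hv

theorem mem_of_mem_of_d_mem {Q : Submodule ℂ Affine} (hQ : ∀ x : Affine, x.dd = 0 → x ∈ Q)
    (hd : d ∈ Q) (x : Affine) : x ∈ Q := by
  have h1 : x = ⟨x.loop, x.cc, 0⟩ + x.dd • d := by ext <;> simp [d]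
  rw [h1]
  exact Q.add_mem (hQ _ rfl) (Q.smul_mem _ hd)

theorem el_mem {Q : Submodule ℂ Affine} (he : ∀ n, e n ∈ Q) (hf : ∀ n, f n ∈ Q)
    (hh : ∀ n, h n ∈ Q) (n : ℤ) (x : SL2) : el n x ∈ Q := by
  rw [SL2.eq_coords x, el_add, el_add, el_smul, el_smul, el_smul]
  exact Q.add_mem (Q.add_mem (Q.smul_mem _ (he n)) (Q.smul_mem _ (hf n))) (Q.smul_mem _ (hh n))

end Affine

/-! ### Imaginary highest weight vectors -/

/-- An imaginary highest weight vector: one on which `eₙ` and `hₙ` for `n > 0` act by `0`, and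
`h₀`, `c`, `d` act by the scalars `l`, `κ`, `δ`. -/
structure IsImaginaryHighest {N : Type*} [AddCommGroup N] [Module ℂ N] [LieRingModule Affine N]
    (l κ δ : ℂ) (w : N) : Prop where
  lie_e : ∀ n : ℤ, ⁅Affine.e n, w⁆ = 0
  lie_h_pos : ∀ n : ℤ, 0 < n → ⁅Affine.h n, w⁆ = 0
  lie_h_zero : ⁅Affine.h 0, w⁆ = l • w
  lie_c : ⁅Affine.c, w⁆ = κ • w
  lie_d : ⁅Affine.d, w⁆ = δ • w

section words

variable {N : Type*} [AddCommGroup N] [Module ℂ N] [LieRingModule Affine N] [LieModule ℂ Affine N]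

/-- The vector `h_{-k₁} h_{-k₂} ⋯ w` for a list `k₁, k₂, …`. -/
def hWord (w : N) (L : List ℕ) : N :=
  (L.map fun k : ℕ => LieModule.toEnd ℂ Affine N (Affine.h (-(k : ℤ)))).prod w

@[simp] theorem hWord_nil (w : N) : hWord w [] = w := rfl

theorem hWord_cons (w : N) (k : ℕ) (L : List ℕ) :
    hWord w (k :: L) = ⁅Affine.h (-(k : ℤ)), hWord w L⁆ := by
  simp [hWord]

/-- The vector `f_{n₁} f_{n₂} ⋯ v` for a list `n₁, n₂, …`. -/
def fWord (v : N) (L : List ℤ) : N :=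
  (L.map fun n => LieModule.toEnd ℂ Affine N (Affine.f n)).prod v

@[simp] theorem fWord_nil (v : N) : fWord v [] = v := rfl

theorem fWord_cons (v : N) (n : ℤ) (L : List ℤ) :
    fWord v (n :: L) = ⁅Affine.f n, fWord v L⁆ := by
  simp [fWord]

theorem hWord_perm (w : N) {L L' : List ℕ} (hL : L.Perm L') : hWord w L = hWord w L' := by
  induction hL with
  | nil => rfl
  | cons k _ ih => rw [hWord_cons, hWord_cons, ih]
  | trans _ _ h1 h2 => exact h1.trans h2
  | swap k j L =>
    simp only [hWord_cons]
    rw [leibniz_lie, Affine.h_lie_h]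
    split_ifs with h
    · obtain rfl : k = 0 := by lia
      obtain rfl : j = 0 := by lia
      simp
    · simp

theorem fWord_perm (v : N) {L L' : List ℤ} (hL : L.Perm L') : fWord v L = fWord v L' := by
  induction hL with
  | nil => rfl
  | cons k _ ih => rw [fWord_cons, fWord_cons, ih]
  | trans _ _ h1 h2 => exact h1.trans h2
  | swap k j L => simp only [fWord_cons]; rw [leibniz_lie, Affine.f_lie_f, zero_lie, zero_add]

namespace IsImaginaryHighest

variable {l κ δ : ℂ} {w : N} (H : IsImaginaryHighest l κ δ w)
include H

theorem e_hWord (n : ℤ) (L : List ℕ) : ⁅Affine.e n, hWord w L⁆ = 0 := by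
  induction L generalizing n with
  | nil => exact H.lie_e n
  | cons k L ih =>
    rw [hWord_cons, leibniz_lie, Affine.e_lie_h, smul_lie, ih, ih, lie_zero, smul_zero, add_zero]

theorem c_hWord (L : List ℕ) : ⁅Affine.c, hWord w L⁆ = κ • hWord w L := by
  induction L with
  | nil => exact H.lie_c
  | cons k L ih => rw [hWord_cons, leibniz_lie, Affine.c_lie, zero_lie, zero_add, ih, lie_smul]

theorem h_zero_hWord (L : List ℕ) : ⁅Affine.h 0, hWord w L⁆ = l • hWord w L := by
  induction L with
  | nil => exact H.lie_h_zero
  | cons k L ih =>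
    rw [hWord_cons, leibniz_lie, Affine.h_lie_h, ih, lie_smul]
    simp

/-- As `[hₙ, h₋ₖ] = 2 n δ_{n,k} c`, the operator `hₙ` acts on words as a multiple of `∂/∂h₋ₙ`. -/
theorem h_pos_hWord (n : ℕ) (hn : 0 < n) (L : List ℕ) :
    ⁅Affine.h n, hWord w L⁆ = (2 * n * κ * L.count n) • hWord w (L.erase n) := by
  induction L with
  | nil => simpa using H.lie_h_pos n (by lia)
  | cons k L ih =>
    rw [hWord_cons, leibniz_lie, Affine.h_lie_h, ih, smul_lie, H.c_hWord, lie_smul]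
    by_cases hk : k = n
    · subst hk
      rw [if_pos (by lia), List.erase_cons_head, List.count_cons_self]
      by_cases hc : k ∈ L
      · rw [← hWord_cons, hWord_perm w (List.perm_cons_erase hc).symm]
        push_cast; module
      · rw [List.count_eq_zero_of_not_mem hc]
        push_cast; module
    · rw [if_neg (by lia), zero_smul, zero_add, List.erase_cons_tail (by simpa using hk),
        List.count_cons_of_ne hk, hWord_cons]

theorem d_hWord (L : List ℕ) : ⁅Affine.d, hWord w L⁆ = (δ - L.sum) • hWord w L := by
  induction L with
  | nil => simpa using H.lie_d
  | cons k L ih =>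
    rw [hWord_cons, leibniz_lie, Affine.h, Affine.d_lie_el, ih, lie_smul, smul_lie, List.sum_cons]
    push_cast; module

end IsImaginaryHighest

/-- The span of the vectors `f_{n₁} ⋯ f_{nᵢ} h_{-m₁} ⋯ h_{-mⱼ} w`. -/
def wordSpan (w : N) : Submodule ℂ N :=
  Submodule.span ℂ (Set.range fun p : List ℤ × List ℕ+ => fWord (hWord w (p.2.map (↑))) p.1)

theorem word_mem_wordSpan (w : N) (ns : List ℤ) (ms : List ℕ+) :
    fWord (hWord w (ms.map (↑))) ns ∈ wordSpan w :=
  Submodule.subset_span ⟨(ns, ms), rfl⟩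

/-- The subspace of the elements of `𝔤̃` that map the span of the words to itself. -/
def wordStabilizer (w : N) : Submodule ℂ Affine where
  carrier := {x | ∀ v ∈ wordSpan w, ⁅x, v⁆ ∈ wordSpan w}
  add_mem' hx hy v hv := by rw [add_lie]; exact add_mem (hx v hv) (hy v hv)
  zero_mem' v _ := by rw [zero_lie]; exact zero_mem _
  smul_mem' r x hx v hv := by rw [smul_lie]; exact Submodule.smul_mem _ r (hx v hv)

theorem mem_wordStabilizer {w : N} {x : Affine} (h : ∀ (ns : List ℤ) (ms : List ℕ+),
    ⁅x, fWord (hWord w (ms.map (↑))) ns⁆ ∈ wordSpan w) : x ∈ wordStabilizer w := by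
  intro v hv
  have : wordSpan w ≤ (wordSpan w).comap (LieModule.toEnd ℂ Affine N x) := by
    rw [wordSpan, Submodule.span_le]
    rintro _ ⟨p, rfl⟩
    exact h p.1 p.2
  exact this hv

/-- The easy half of the Poincaré–Birkhoff–Witt theorem for the imaginary highest weight module
generated by `w`. -/
theorem IsImaginaryHighest.mem_wordStabilizer {l κ δ : ℂ} {w : N}
    (H : IsImaginaryHighest l κ δ w) (x : Affine) : x ∈ wordStabilizer w := by
  have hf : ∀ n, Affine.f n ∈ wordStabilizer w := fun n =>
    ImaginaryWakimoto.mem_wordStabilizer fun ns ms => by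
      rw [← fWord_cons]; exact word_mem_wordSpan _ _ _
  have hc : Affine.c ∈ wordStabilizer w :=
    ImaginaryWakimoto.mem_wordStabilizer fun ns ms => by
      induction ns with
      | nil => rw [fWord_nil, H.c_hWord]; exact Submodule.smul_mem _ _ (word_mem_wordSpan w [] ms)
      | cons n ns ih =>
        rw [fWord_cons, leibniz_lie, Affine.c_lie, zero_lie, zero_add]
        exact hf n _ ih
  have hd : Affine.d ∈ wordStabilizer w :=
    ImaginaryWakimoto.mem_wordStabilizer fun ns ms => by
      induction ns with
      | nil => rw [fWord_nil, H.d_hWord]; exact Submodule.smul_mem _ _ (word_mem_wordSpan w [] ms)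
      | cons n ns ih =>
        rw [fWord_cons, leibniz_lie, Affine.f, Affine.d_lie_el, ← Affine.f, smul_lie, ← fWord_cons]
        exact add_mem (Submodule.smul_mem _ _ (word_mem_wordSpan w _ ms)) (hf n _ ih)
  have hh : ∀ n, Affine.h n ∈ wordStabilizer w := by
    refine fun n => ImaginaryWakimoto.mem_wordStabilizer fun ns ms => ?_
    induction ns generalizing n with
    | nil =>
      rw [fWord_nil]
      rcases lt_trichotomy n 0 with hn | rfl | hn
      · obtain ⟨k, rfl⟩ := Fock.exists_b_neg n hn
        have := word_mem_wordSpan w [] (k :: ms)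
        rwa [List.map_cons, fWord_nil, hWord_cons] at this
      · rw [H.h_zero_hWord]
        exact Submodule.smul_mem _ _ (word_mem_wordSpan w [] ms)
      · lift n to ℕ using hn.le
        lift n to ℕ+ using by lia
        rw [H.h_pos_hWord n n.pos, ← List.map_erase PNat.coe_injective]
        exact Submodule.smul_mem _ _ (word_mem_wordSpan w [] (ms.erase n))
    | cons k ns ih =>
      rw [fWord_cons, leibniz_lie, Affine.h_lie_f, smul_lie, ← fWord_cons]
      exact add_mem (Submodule.smul_mem _ _ (word_mem_wordSpan w _ ms)) (hf k _ (ih n))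
  have he : ∀ n, Affine.e n ∈ wordStabilizer w := by
    refine fun n => ImaginaryWakimoto.mem_wordStabilizer fun ns ms => ?_
    induction ns generalizing n with
    | nil => rw [fWord_nil, H.e_hWord]; exact zero_mem _
    | cons k ns ih =>
      rw [fWord_cons, leibniz_lie, Affine.e_lie_f, add_lie, smul_lie]
      have hm := word_mem_wordSpan w ns ms
      exact add_mem (add_mem (hh _ _ hm) (Submodule.smul_mem _ _ (hc _ hm))) (hf k _ (ih n))
  exact Affine.mem_of_mem_of_d_mem
    (fun _ => Affine.mem_of_dd_eq_zero (Affine.el_mem he hf hh) hc) hd x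

end words

/-! ### The universal property of the imaginary Verma module -/

namespace Verma

variable (l κ : ℂ)

theorem smul_v_eq_zero {u : UniversalEnvelopingAlgebra ℂ Affine} (hu : u ∈ vermaIdeal l κ) :
    u • v l κ = 0 := by
  refine (Submodule.Quotient.mk_eq_zero (vermaIdeal l κ) (x := u • 1)).2 ?_
  rwa [smul_eq_mul, mul_one]

theorem smul_v_eq_smul {u : UniversalEnvelopingAlgebra ℂ Affine} {r : ℂ}
    (hu : u - algebraMap ℂ _ r ∈ vermaIdeal l κ) : u • v l κ = r • v l κ := by
  have := smul_v_eq_zero l κ hu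
  rwa [sub_smul, algebraMap_smul, sub_eq_zero] at this

theorem isImaginaryHighest_v : IsImaginaryHighest l κ (-confWeight l κ) (v l κ) where
  lie_e n := smul_v_eq_zero l κ (Submodule.subset_span (Or.inl (Or.inl ⟨n, rfl⟩)))
  lie_h_pos n hn := smul_v_eq_zero l κ (Submodule.subset_span (Or.inl (Or.inr ⟨n, hn, rfl⟩)))
  lie_h_zero := smul_v_eq_smul l κ (Submodule.subset_span (Or.inr (by simp)))
  lie_c := smul_v_eq_smul l κ (Submodule.subset_span (Or.inr (by simp)))
  lie_d := d_v l κ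

/-- The imaginary Verma module is generated by `v` over `𝔤̃`. -/
theorem eq_top_of_lie_mem {Q : Submodule ℂ (Verma l κ)} (hv : v l κ ∈ Q)
    (hQ : ∀ (x : Affine), ∀ w ∈ Q, ⁅x, w⁆ ∈ Q) : Q = ⊤ := by
  have key : ∀ t : TensorAlgebra ℂ Affine, ∀ w ∈ Q,
      UniversalEnvelopingAlgebra.mkAlgHom ℂ Affine t • w ∈ Q := by
    intro t
    induction t using TensorAlgebra.induction with
    | algebraMap r =>
      intro w hw
      rw [AlgHom.commutes, algebraMap_smul]
      exact Q.smul_mem r hw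
    | ι x => exact fun w hw => hQ x w hw
    | mul a b ha hb =>
      intro w hw
      rw [map_mul, mul_smul]
      exact ha _ (hb w hw)
    | add a b ha hb =>
      intro w hw
      rw [map_add, add_smul]
      exact Q.add_mem (ha w hw) (hb w hw)
  refine Submodule.eq_top_iff'.2 fun w => ?_
  obtain ⟨u, rfl⟩ := Submodule.Quotient.mk_surjective (vermaIdeal l κ) w
  obtain ⟨t, rfl⟩ : ∃ t, UniversalEnvelopingAlgebra.mkAlgHom ℂ Affine t = u :=
    Quotient.exists_rep u
  have := key t _ hv
  have h1 : UniversalEnvelopingAlgebra.mkAlgHom ℂ Affine t • v l κ =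
      Submodule.Quotient.mk (UniversalEnvelopingAlgebra.mkAlgHom ℂ Affine t) :=
    congrArg Submodule.Quotient.mk (mul_one (UniversalEnvelopingAlgebra.mkAlgHom ℂ Affine t))
  rwa [h1] at this

/-- The words `f_{n₁} ⋯ h_{-m₁} ⋯ v` span the imaginary Verma module. -/
theorem wordSpan_v : wordSpan (v l κ) = ⊤ :=
  eq_top_of_lie_mem l κ (word_mem_wordSpan _ [] [])
    (isImaginaryHighest_v l κ).mem_wordStabilizer

/-- As the words involve only `fₙ` and `h₋ₖ`, the element `d` is not needed to generate. -/
theorem eq_top_of_hat_lie_mem {Q : Submodule ℂ (Verma l κ)} (hv : v l κ ∈ Q)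
    (hQ : ∀ (x : Affine), x.dd = 0 → ∀ w ∈ Q, ⁅x, w⁆ ∈ Q) : Q = ⊤ := by
  rw [← top_le_iff, ← wordSpan_v, wordSpan, Submodule.span_le]
  rintro _ ⟨⟨ns, ms⟩, rfl⟩
  change fWord (hWord (v l κ) (ms.map (↑))) ns ∈ Q
  induction ns with
  | nil =>
    rw [fWord_nil]
    induction ms with
    | nil => exact hv
    | cons k ms ih =>
      rw [List.map_cons, hWord_cons]
      exact hQ (Affine.h (-k)) rfl _ ih
  | cons n ns ih =>
    rw [fWord_cons]
    exact hQ (Affine.f n) rfl _ ih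

variable {l κ} {N : Type*} [AddCommGroup N] [Module ℂ N] [LieRingModule Affine N]
  [LieModule ℂ Affine N]

/-- The linear map `U(𝔤̃) → N`, `u ↦ u ξ`. -/
def evalU (ξ : N) : UniversalEnvelopingAlgebra ℂ Affine →ₗ[ℂ] N :=
  LinearMap.applyₗ ξ ∘ₗ
    (UniversalEnvelopingAlgebra.lift ℂ (LieModule.toEnd ℂ Affine N)).toLinearMap

theorem evalU_mul (ξ : N) (u u' : UniversalEnvelopingAlgebra ℂ Affine) :
    evalU ξ (u * u') =
      UniversalEnvelopingAlgebra.lift ℂ (LieModule.toEnd ℂ Affine N) u (evalU ξ u') := by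
  simp [evalU]

theorem evalU_ι (ξ : N) (x : Affine) : evalU ξ (UniversalEnvelopingAlgebra.ι ℂ x) = ⁅x, ξ⁆ := by
  simp only [evalU, LinearMap.comp_apply, AlgHom.toLinearMap_apply,
    UniversalEnvelopingAlgebra.lift_ι_apply]
  rfl

theorem evalU_algebraMap (ξ : N) (r : ℂ) : evalU ξ (algebraMap ℂ _ r) = r • ξ := by
  simp [evalU]

theorem evalU_eq_zero {ξ : N} (H : IsImaginaryHighest l κ (-confWeight l κ) ξ)
    {u : UniversalEnvelopingAlgebra ℂ Affine} (hu : u ∈ vermaIdeal l κ) : evalU ξ u = 0 := by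
  induction hu using Submodule.span_induction with
  | zero => exact map_zero _
  | add u u' _ _ hu hu' => rw [map_add, hu, hu', add_zero]
  | smul a u _ hu => rw [smul_eq_mul, evalU_mul, hu, map_zero]
  | mem u hu =>
    rcases hu with (⟨n, rfl⟩ | ⟨n, hn, rfl⟩) | rfl | rfl | rfl
    · exact (evalU_ι ξ _).trans (H.lie_e n)
    · exact (evalU_ι ξ _).trans (H.lie_h_pos n hn)
    · rw [map_sub, evalU_ι, evalU_algebraMap, H.lie_h_zero, sub_self]
    · rw [map_sub, evalU_ι, evalU_algebraMap, H.lie_c, sub_self]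
    · rw [map_sub, evalU_ι, evalU_algebraMap, H.lie_d, sub_self]

/-- The homomorphism of `𝔤̃`-modules from the imaginary Verma module that maps its generator to a
given imaginary highest weight vector. -/
def lift {ξ : N} (H : IsImaginaryHighest l κ (-confWeight l κ) ξ) :
    Verma l κ →ₗ⁅ℂ, Affine⁆ N where
  toLinearMap := (((vermaIdeal l κ).restrictScalars ℂ).liftQ (evalU ξ)
    fun _ hu => evalU_eq_zero H hu) ∘ₗ
      ((Submodule.Quotient.restrictScalarsEquiv ℂ (vermaIdeal l κ)).symm :
        (UniversalEnvelopingAlgebra ℂ Affine ⧸ vermaIdeal l κ) →ₗ[ℂ] _)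
  map_lie' {x w} := by
    obtain ⟨u, rfl⟩ := Submodule.Quotient.mk_surjective (vermaIdeal l κ) w
    change evalU ξ (UniversalEnvelopingAlgebra.ι ℂ x * u) = ⁅x, evalU ξ u⁆
    rw [evalU_mul, UniversalEnvelopingAlgebra.lift_ι_apply]
    rfl

theorem lift_v {ξ : N} (H : IsImaginaryHighest l κ (-confWeight l κ) ξ) :
    lift H (v l κ) = ξ := by
  change evalU ξ 1 = ξ
  simp [evalU]

end Verma

/-! ### The Cox–Futorny isomorphism -/

section words

variable {N N' : Type*} [AddCommGroup N] [Module ℂ N] [LieRingModule Affine N]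
  [LieModule ℂ Affine N] [AddCommGroup N'] [Module ℂ N'] [LieRingModule Affine N']
  [LieModule ℂ Affine N'] (φ : N →ₗ⁅ℂ, Affine⁆ N')

theorem map_hWord (w : N) (L : List ℕ) : φ (hWord w L) = hWord (φ w) L := by
  induction L with
  | nil => rfl
  | cons k L ih => rw [hWord_cons, hWord_cons, LieModuleHom.map_lie, ih]

theorem map_fWord (v : N) (L : List ℤ) : φ (fWord v L) = fWord (φ v) L := by
  induction L with
  | nil => rfl
  | cons k L ih => rw [fWord_cons, fWord_cons, LieModuleHom.map_lie, ih]

end words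

namespace Wakimoto

variable (l κ : ℂ)

theorem lie_f (n : ℤ) (p : Wakimoto l κ) : ⁅Affine.f n, p⁆ = a l κ n p := by
  rw [lie_def, Affine.f, Affine.rep_el]
  exact LinearMap.congr_fun (Fock.opT_f l κ n) p

theorem lie_h (n : ℤ) (p : Wakimoto l κ) : ⁅Affine.h n, p⁆ = Fock.opH l κ n p := by
  rw [lie_def, Affine.h, Affine.rep_el]
  exact LinearMap.congr_fun (Fock.opT_h l κ n) p

theorem isImaginaryHighest_w : IsImaginaryHighest l κ (-confWeight l κ) (w l κ) where
  lie_e n := by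
    rw [lie_def, Affine.e, Affine.rep_el]
    exact (LinearMap.congr_fun (Fock.opT_e l κ n) _).trans
      (Fock.opE_of l κ n 1 Fock.aStar_one)
  lie_h_pos n hn := by
    rw [lie_h]
    refine (Fock.opH_of l κ n 1 Fock.aStar_one).trans ((Fock.b_one l κ n hn.le).trans ?_)
    rw [if_neg hn.ne', zero_smul]
    rfl
  lie_h_zero := by
    rw [lie_h]
    refine (Fock.opH_of l κ 0 1 Fock.aStar_one).trans ((Fock.b_one l κ 0 le_rfl).trans ?_)
    rw [if_pos rfl]
    rfl
  lie_c := by rw [lie_def, Affine.rep_c]; rfl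
  lie_d := d_w l κ

/-- On polynomials in the `yₖ` alone, `h₋ₖ` acts as `b₋ₖ`. -/
theorem hWord_w (L : List ℕ) :
    hWord (w l κ) L = (L.map fun k : ℕ => b l κ (-(k : ℤ))).prod (w l κ) ∧
      ∀ i, Fock.aStar i (hWord (N := Wakimoto l κ) (w l κ) L) = 0 := by
  induction L with
  | nil => exact ⟨rfl, Fock.aStar_one⟩
  | cons k L ih =>
    have h1 : hWord (w l κ) (k :: L) = b l κ (-(k : ℤ)) (hWord (w l κ) L) := by
      rw [hWord_cons, lie_h]
      exact Fock.opH_of l κ _ _ ih.2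
    refine ⟨?_, fun i => ?_⟩
    · rw [h1, ih.1, List.map_cons, List.prod_cons, Module.End.mul_apply]
    · rw [h1]
      have h2 : Fock.b l κ (-(k : ℤ)) (Fock.aStar i (hWord (N := Wakimoto l κ) (w l κ) L)) -
          Fock.aStar i (Fock.b l κ (-(k : ℤ)) (hWord (N := Wakimoto l κ) (w l κ) L)) = 0 :=
        LinearMap.congr_fun (Fock.lie_b_aStar l κ (-(k : ℤ)) i) _
      rw [ih.2 i, map_zero, zero_sub, neg_eq_zero] at h2
      exact h2

theorem word_eq (ns : List ℤ) (L : List ℕ) : fWord (hWord (w l κ) L) ns =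
    (ns.map fun n => a l κ n).prod ((L.map fun k : ℕ => b l κ (-(k : ℤ))).prod (w l κ)) := by
  rw [← (hWord_w l κ L).1]
  induction ns with
  | nil => rfl
  | cons n ns ih =>
    rw [fWord_cons, lie_f, ih, List.map_cons, List.prod_cons, Module.End.mul_apply]

/-- The product of a list of variables of the polynomial ring. -/
def monomial (L : List (ℤ ⊕ ℕ+)) : Wakimoto l κ :=
  (MvPolynomial.monomial (Multiset.toFinsupp (L : Multiset (ℤ ⊕ ℕ+))) 1 : Fock)

theorem monomial_cons (i : ℤ ⊕ ℕ+) (L : List (ℤ ⊕ ℕ+)) :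
    monomial l κ (i :: L) = LinearMap.mulLeft ℂ (MvPolynomial.X i : Fock) (monomial l κ L) := by
  rw [monomial, ← Multiset.cons_coe, ← Multiset.singleton_add, map_add,
    Multiset.toFinsupp_singleton, ← one_mul (1 : ℂ), ← MvPolynomial.monomial_mul]
  rfl

theorem monomial_inl_cons (n : ℤ) (L : List (ℤ ⊕ ℕ+)) :
    monomial l κ (Sum.inl n :: L) = a l κ n (monomial l κ L) :=
  monomial_cons l κ _ L

theorem monomial_inr_cons (k : ℕ+) (L : List (ℤ ⊕ ℕ+)) :
    monomial l κ (Sum.inr k :: L) = b l κ (-(k : ℤ)) (monomial l κ L) :=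
  (monomial_cons l κ _ L).trans (LinearMap.congr_fun (Fock.b_neg l κ k) _).symm

theorem monomial_nil : monomial l κ [] = w l κ := by
  rw [monomial, Multiset.coe_nil, map_zero]
  rfl

theorem word_eq_monomial (ns : List ℤ) (ms : List ℕ+) :
    fWord (hWord (w l κ) (ms.map (↑))) ns =
      monomial l κ (ns.map Sum.inl ++ ms.map Sum.inr) := by
  rw [word_eq]
  induction ns with
  | nil =>
    rw [List.map_nil, List.map_nil, List.nil_append, List.prod_nil, Module.End.one_apply]
    induction ms with
    | nil => exact (monomial_nil l κ).symm
    | cons k ms ih =>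
      rw [List.map_cons, List.map_cons, List.map_cons, monomial_inr_cons, ← ih, List.prod_cons,
        Module.End.mul_apply]
  | cons n ns ih =>
    rw [List.map_cons, List.map_cons, List.cons_append, monomial_inl_cons, ← ih, List.prod_cons,
      Module.End.mul_apply]

end Wakimoto

/-- The monomial vector of `V_{μ,κ}` that corresponds to an exponent vector: the exponents of the
`xₙ` count the factors `fₙ`, those of the `yₖ` count the factors `h₋ₖ`. -/
def Verma.monomialVector (μ κ : ℂ) (s : ℤ ⊕ ℕ+ →₀ ℕ) : Verma μ κ :=
  fWord (hWord (Verma.v μ κ) (((Finsupp.toMultiset s).filterMap Sum.getRight?).toList.map (↑)))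
    ((Finsupp.toMultiset s).filterMap Sum.getLeft?).toList

theorem Verma.monomialVector_toFinsupp (μ κ : ℂ) (ns : List ℤ) (ms : List ℕ+) :
    Verma.monomialVector μ κ (Multiset.toFinsupp
      ((ns.map Sum.inl ++ ms.map Sum.inr : List (ℤ ⊕ ℕ+)) : Multiset (ℤ ⊕ ℕ+))) =
    fWord (hWord (Verma.v μ κ) (ms.map (↑))) ns := by
  rw [Verma.monomialVector, Multiset.toFinsupp_toMultiset]
  have h1 : (ns.map Sum.inl ++ ms.map Sum.inr : List (ℤ ⊕ ℕ+)).filterMap Sum.getLeft? = ns := by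
    rw [List.filterMap_append, List.filterMap_map, List.filterMap_map]
    simp [Function.comp_def]
  have h2 : (ns.map Sum.inl ++ ms.map Sum.inr : List (ℤ ⊕ ℕ+)).filterMap Sum.getRight? = ms := by
    rw [List.filterMap_append, List.filterMap_map, List.filterMap_map]
    simp [Function.comp_def]
  rw [Multiset.filterMap_coe, Multiset.filterMap_coe, h1, h2]
  have p1 : ((ns : Multiset ℤ).toList).Perm ns := Multiset.coe_eq_coe.1 (Multiset.coe_toList _)
  have p2 : ((ms : Multiset ℕ+).toList).Perm ms := Multiset.coe_eq_coe.1 (Multiset.coe_toList _)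
  rw [fWord_perm _ p1, hWord_perm _ (p2.map _)]

/-- The homomorphism `V_{μ,κ} → W_{μ,κ}` with `v ↦ w`. -/
def coxFutornyHom (μ κ : ℂ) : Verma μ κ →ₗ⁅ℂ, Affine⁆ Wakimoto μ κ :=
  Verma.lift (Wakimoto.isImaginaryHighest_w μ κ)

theorem coxFutornyHom_v (μ κ : ℂ) : coxFutornyHom μ κ (Verma.v μ κ) = Wakimoto.w μ κ :=
  Verma.lift_v _

theorem coxFutornyHom_word (μ κ : ℂ) (ns : List ℤ) (L : List ℕ) :
    coxFutornyHom μ κ (fWord (hWord (Verma.v μ κ) L) ns) = fWord (hWord (Wakimoto.w μ κ) L) ns := by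
  rw [map_fWord, map_hWord, coxFutornyHom_v]

/-- The linear map `W_{μ,κ} → V_{μ,κ}` that maps monomials to monomial vectors. -/
def coxFutornyInv (μ κ : ℂ) : Wakimoto μ κ →ₗ[ℂ] Verma μ κ :=
  (MvPolynomial.basisMonomials (ℤ ⊕ ℕ+) ℂ).constr ℂ (Verma.monomialVector μ κ)

theorem coxFutornyInv_monomial (μ κ : ℂ) (s : ℤ ⊕ ℕ+ →₀ ℕ) :
    coxFutornyInv μ κ (MvPolynomial.monomial s 1 : Fock) = Verma.monomialVector μ κ s := by
  have := (MvPolynomial.basisMonomials (ℤ ⊕ ℕ+) ℂ).constr_basis ℂ (Verma.monomialVector μ κ) s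
  rwa [MvPolynomial.coe_basisMonomials] at this

theorem coxFutornyInv_word (μ κ : ℂ) (ns : List ℤ) (ms : List ℕ+) :
    coxFutornyInv μ κ (fWord (hWord (Wakimoto.w μ κ) (ms.map (↑))) ns) =
      fWord (hWord (Verma.v μ κ) (ms.map (↑))) ns := by
  rw [Wakimoto.word_eq_monomial, ← Verma.monomialVector_toFinsupp]
  exact coxFutornyInv_monomial μ κ _

/-- Injectivity: the words span `V_{μ,κ}`, and the map back restores each of them. -/
theorem coxFutornyInv_hom (μ κ : ℂ) (u : Verma μ κ) :
    coxFutornyInv μ κ (coxFutornyHom μ κ u) = u := by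
  have hu : u ∈ wordSpan (Verma.v μ κ) := by rw [Verma.wordSpan_v]; trivial
  induction hu using Submodule.span_induction with
  | zero => simp
  | add x y _ _ hx hy => rw [map_add, map_add, hx, hy]
  | smul r x _ hx => rw [map_smul, map_smul, hx]
  | mem x hx =>
    obtain ⟨⟨ns, ms⟩, rfl⟩ := hx
    change coxFutornyInv μ κ (coxFutornyHom μ κ (fWord (hWord (Verma.v μ κ) (ms.map (↑))) ns)) = _
    rw [coxFutornyHom_word, coxFutornyInv_word]

theorem filterMap_getLeft_add_getRight (t : Multiset (ℤ ⊕ ℕ+)) :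
    (t.filterMap Sum.getLeft?).map Sum.inl + (t.filterMap Sum.getRight?).map Sum.inr = t := by
  induction t using Multiset.induction_on with
  | empty => rfl
  | cons i t ih =>
    nth_rw 3 [← ih]
    cases i with
    | inl n =>
      rw [Multiset.filterMap_cons_some Sum.getLeft? _ _ (Sum.getLeft?_inl (x := n)),
        Multiset.filterMap_cons_none _ _ rfl,
        Multiset.map_cons, Multiset.cons_add]
    | inr k =>
      rw [Multiset.filterMap_cons_none _ _ rfl,
        Multiset.filterMap_cons_some Sum.getRight? _ _ (Sum.getRight?_inr (x := k)),
        Multiset.map_cons, Multiset.add_cons]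

theorem coxFutornyHom_inv (μ κ : ℂ) (p : Wakimoto μ κ) :
    coxFutornyHom μ κ (coxFutornyInv μ κ p) = p := by
  have h : (coxFutornyHom μ κ).toLinearMap ∘ₗ coxFutornyInv μ κ = LinearMap.id := by
    refine (MvPolynomial.basisMonomials (ℤ ⊕ ℕ+) ℂ).ext (M₁ := Wakimoto μ κ) fun s => ?_
    rw [MvPolynomial.coe_basisMonomials]
    obtain ⟨ns, ms, hs⟩ : ∃ (ns : List ℤ) (ms : List ℕ+), Multiset.toFinsupp
        ((ns.map Sum.inl ++ ms.map Sum.inr : List (ℤ ⊕ ℕ+)) : Multiset (ℤ ⊕ ℕ+)) = s := by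
      refine ⟨((Finsupp.toMultiset s).filterMap Sum.getLeft?).toList,
        ((Finsupp.toMultiset s).filterMap Sum.getRight?).toList, ?_⟩
      rw [← Multiset.coe_add, ← Multiset.map_coe, ← Multiset.map_coe, Multiset.coe_toList,
        Multiset.coe_toList, filterMap_getLeft_add_getRight, Finsupp.toMultiset_toFinsupp]
    subst hs
    change coxFutornyHom μ κ (coxFutornyInv μ κ
      (Wakimoto.monomial μ κ (ns.map Sum.inl ++ ms.map Sum.inr))) =
        Wakimoto.monomial μ κ (ns.map Sum.inl ++ ms.map Sum.inr)
    rw [← Wakimoto.word_eq_monomial, coxFutornyInv_word, coxFutornyHom_word]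
  exact LinearMap.congr_fun h p

/-- The Cox–Futorny isomorphism `V_{μ,κ} → W_{μ,κ}`. -/
def coxFutorny (μ κ : ℂ) : Verma μ κ ≃ₗ⁅ℂ, Affine⁆ Wakimoto μ κ where
  toLieModuleHom := coxFutornyHom μ κ
  invFun := coxFutornyInv μ κ
  left_inv := coxFutornyInv_hom μ κ
  right_inv := coxFutornyHom_inv μ κ

/-- A list of positive integers may be coerced to integers at once, by the list monad, or through
`ℕ`. -/
theorem map_coe_eq {α : Type*} (ms : List ℕ+) (g : ℤ → α) :
    (do let k ← ms; pure ((k : ℕ) : ℤ)).map g = (ms.map PNat.val).map fun k : ℕ => g k := by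
  induction ms with
  | nil => rfl
  | cons k ms ih => simpa using ih

/-- A homomorphism with `v ↦ w` has the prescribed values on all words. -/
theorem isCoxFutorny_iff {μ κ : ℂ} (Ψ : Verma μ κ ≃ₗ⁅ℂ, Affine⁆ Wakimoto μ κ) :
    IsCoxFutorny Ψ ↔ Ψ (Verma.v μ κ) = Wakimoto.w μ κ := by
  refine ⟨fun h => h [] [], fun h ns ms => ?_⟩
  have h1 : Ψ.toLieModuleHom (fWord (hWord (Verma.v μ κ) (ms.map (↑))) ns) =
      fWord (hWord (Wakimoto.w μ κ) (ms.map (↑))) ns := by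
    rw [map_fWord, map_hWord]
    exact congrArg (fun u => fWord (hWord u _) _) h
  rw [Wakimoto.word_eq, fWord, hWord] at h1
  -- in `IsCoxFutorny` the list `ms` is coerced to a list of integers
  erw [map_coe_eq, map_coe_eq]
  exact h1

theorem Verma.hom_ext {μ κ : ℂ} {N : Type*} [AddCommGroup N] [Module ℂ N]
    [LieRingModule Affine N] {φ ψ : Verma μ κ →ₗ⁅ℂ, Affine⁆ N}
    (h : φ (Verma.v μ κ) = ψ (Verma.v μ κ)) (u : Verma μ κ) : φ u = ψ u := by
  have : LinearMap.eqLocus φ.toLinearMap ψ.toLinearMap = ⊤ :=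
    Verma.eq_top_of_lie_mem μ κ h fun x w hw => by
      change φ w = ψ w at hw
      change φ ⁅x, w⁆ = ψ ⁅x, w⁆
      rw [LieModuleHom.map_lie, LieModuleHom.map_lie, hw]
  exact (this.symm ▸ Submodule.mem_top : u ∈ LinearMap.eqLocus φ.toLinearMap ψ.toLinearMap)

theorem existsUnique_coxFutorny (μ κ : ℂ) :
    ∃! Ψ : Verma μ κ ≃ₗ⁅ℂ, Affine⁆ Wakimoto μ κ, IsCoxFutorny Ψ := by
  refine ⟨coxFutorny μ κ, (isCoxFutorny_iff _).2 (coxFutornyHom_v μ κ), fun Ψ hΨ => ?_⟩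
  replace hΨ := (isCoxFutorny_iff Ψ).1 hΨ
  exact LieModuleEquiv.ext _ _ fun u =>
    Verma.hom_ext (φ := Ψ.toLieModuleHom) (ψ := coxFutornyHom μ κ)
      (hΨ.trans (coxFutornyHom_v μ κ).symm) u

/-! ### The formal vector `∑ α_π h_π w ⊗ uᵐ` -/

/-- The partition of `k + n` obtained from a partition of `k` by adding a part `n`. -/
def addPart (n k : ℕ) (hn : 0 < n) (π : k.Partition) : (k + n).Partition where
  parts := n ::ₘ π.parts
  parts_pos {i} hi := by
    rcases Multiset.mem_cons.1 hi with rfl | hi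
    · exact hn
    · exact π.parts_pos hi
  parts_sum := by rw [Multiset.sum_cons, π.parts_sum, add_comm]

theorem addPart_injective (n k : ℕ) (hn : 0 < n) : Function.Injective (addPart n k hn) :=
  fun _ _ h => Nat.Partition.ext ((Multiset.cons_inj_right n).1 (congrArg Nat.Partition.parts h))

/-- Every partition with a part `n` arises by adding that part. -/
theorem exists_addPart {n k : ℕ} (hn : 0 < n) (π : (k + n).Partition) (h : n ∈ π.parts) :
    ∃ π' : k.Partition, addPart n k hn π' = π := by
  have h1 := Multiset.cons_erase h
  refine ⟨⟨π.parts.erase n, fun hi => π.parts_pos (Multiset.mem_of_mem_erase hi), ?_⟩,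
    Nat.Partition.ext h1⟩
  have h2 := congrArg Multiset.sum h1
  rw [Multiset.sum_cons, π.parts_sum] at h2
  lia

theorem alpha_eq_prod (κ : ℂ) (m : ℕ) (β : ℂ) {n : ℕ} (π : n.Partition) {s : Finset ℕ}
    (hs : π.parts.toFinset ⊆ s) : alpha κ m β π = β * ∏ k ∈ s,
      (-(m : ℂ) / (2 * κ * k)) ^ π.parts.count k / ((π.parts.count k).factorial : ℂ) := by
  rw [alpha, Finset.prod_subset hs]
  intro k _ hk
  rw [Multiset.count_eq_zero_of_notMem fun h => hk (Multiset.mem_toFinset.2 h)]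
  simp

/-- The recursion that characterises the coefficients `α_π`. -/
theorem alpha_addPart {κ : ℂ} (hκ : κ ≠ 0) (m : ℕ) (β : ℂ) (n k : ℕ) (hn : 0 < n)
    (π : k.Partition) : alpha κ m β (addPart n k hn π) *
      (2 * n * κ * ((addPart n k hn π).parts.count n : ℂ)) = -(m : ℂ) * alpha κ m β π := by
  have hn' : (n : ℂ) ≠ 0 := by exact_mod_cast hn.ne'
  set s := insert n π.parts.toFinset with hs
  have hns : n ∈ s := Finset.mem_insert_self _ _
  have hp : (addPart n k hn π).parts = n ::ₘ π.parts := rfl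
  rw [alpha_eq_prod κ m β π (Finset.subset_insert n _), ← hs,
    alpha_eq_prod κ m β (addPart n k hn π) (s := s) (by rw [hp, Multiset.toFinset_cons]),
    ← Finset.mul_prod_erase s _ hns, ← Finset.mul_prod_erase s _ hns, hp,
    Multiset.count_cons_self]
  have h1 : ∏ i ∈ s.erase n, (-(m : ℂ) / (2 * κ * i)) ^ (n ::ₘ π.parts).count i /
      (((n ::ₘ π.parts).count i).factorial : ℂ) = ∏ i ∈ s.erase n,
      (-(m : ℂ) / (2 * κ * i)) ^ π.parts.count i / ((π.parts.count i).factorial : ℂ) :=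
    Finset.prod_congr rfl fun i hi => by
      rw [Multiset.count_cons_of_ne (Finset.ne_of_mem_erase hi)]
  rw [h1, pow_succ, Nat.factorial_succ]
  have h2 : ((π.parts.count n).factorial : ℂ) ≠ 0 := by
    exact_mod_cast (π.parts.count n).factorial_ne_zero
  have h3 : ((π.parts.count n : ℕ) : ℂ) + 1 ≠ 0 := by
    exact_mod_cast (π.parts.count n).succ_ne_zero
  push_cast
  field_simp

section hSum

variable {N : Type*} [AddCommGroup N] [Module ℂ N] [LieRingModule Affine N] [LieModule ℂ Affine N]

/-- The vector `∑ α_π h_π w`, summed over the partitions `π` of `n`. -/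
def hSum (w : N) (κ : ℂ) (m : ℕ) (β : ℂ) (n : ℕ) : N :=
  ∑ π : n.Partition, alpha κ m β π • hWord w (π.parts.sort (· ≤ ·))

/-- The formal sum `∑ₙ ∑_π α_π h_π w ⊗ z^{n-Δ} uᵐ`. -/
def hSharp (w : N) (κ : ℂ) (m : ℕ) (β Δ : ℂ) : FormalTensor N (Twisted Δ (BinaryForm m)) :=
  sharp (fun k => LieModule.toEnd ℂ Affine N (Affine.h (-(k : ℤ)))) w κ m β Δ

theorem hSharp_of_nonneg (w : N) (κ : ℂ) (m : ℕ) (β Δ : ℂ) (k : ℕ) :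
    hSharp w κ m β Δ (-(k : ℤ)) =
      hSum w κ m β k ⊗ₜ[ℂ] Twisted.single Δ (k : ℤ) (BinaryForm.u m) := by
  have h1 : (- -(k : ℤ)).toNat = k := by lia
  have h2 : ∀ k' : ℕ, k' = k →
      (∑ π : k'.Partition, alpha κ m β π • hWord w (π.parts.sort (· ≤ ·))) =
        hSum w κ m β k := by
    rintro _ rfl; rfl
  rw [hSharp, sharp, if_pos (by lia)]
  exact congrArg₂ _ (h2 _ h1) (by rw [neg_neg])

theorem hSharp_of_pos (w : N) (κ : ℂ) (m : ℕ) (β Δ : ℂ) {j : ℤ} (hj : 0 < j) :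
    hSharp w κ m β Δ j = 0 := if_neg (by lia)

theorem map_hSum {N' : Type*} [AddCommGroup N'] [Module ℂ N'] [LieRingModule Affine N']
    [LieModule ℂ Affine N'] (φ : N →ₗ⁅ℂ, Affine⁆ N') (w : N) (κ : ℂ) (m : ℕ) (β : ℂ) (n : ℕ) :
    φ (hSum w κ m β n) = hSum (φ w) κ m β n := by
  rw [hSum, hSum, map_sum]
  refine Finset.sum_congr rfl fun π _ => ?_
  rw [map_smul, map_hWord]

theorem hSum_zero (w : N) (κ : ℂ) (m : ℕ) (β : ℂ) : hSum w κ m β 0 = β • w := by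
  rw [hSum, Fintype.sum_unique]
  simp [alpha]

theorem lie_hSum_of_forall {w : N} {κ : ℂ} (m : ℕ) (β : ℂ) {x : Affine} {r : ℂ}
    {k : ℕ}
    (hx : ∀ L : List ℕ, L.sum = k → ⁅x, hWord w L⁆ = r • hWord w L) :
    ⁅x, hSum w κ m β k⁆ = r • hSum w κ m β k := by
  rw [hSum, lie_sum, Finset.smul_sum]
  refine Finset.sum_congr rfl fun π _ => ?_
  rw [lie_smul, hx _ (by rw [← Multiset.sum_coe, Multiset.sort_eq, π.parts_sum]), smul_comm]

namespace IsImaginaryHighest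

variable {l κ δ : ℂ} {w : N} (H : IsImaginaryHighest l κ δ w) (m : ℕ) (β : ℂ)
include H

theorem e_hSum (n : ℤ) (k : ℕ) : ⁅Affine.e n, hSum w κ m β k⁆ = 0 := by
  rw [lie_hSum_of_forall m β (r := 0) fun L _ => by rw [H.e_hWord, zero_smul], zero_smul]

theorem h_zero_hSum (k : ℕ) : ⁅Affine.h 0, hSum w κ m β k⁆ = l • hSum w κ m β k :=
  lie_hSum_of_forall m β fun L _ => H.h_zero_hWord L

theorem c_hSum (k : ℕ) : ⁅Affine.c, hSum w κ m β k⁆ = κ • hSum w κ m β k :=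
  lie_hSum_of_forall m β fun L _ => H.c_hWord L

theorem d_hSum (k : ℕ) : ⁅Affine.d, hSum w κ m β k⁆ = (δ - k) • hSum w κ m β k :=
  lie_hSum_of_forall m β fun L hL => by rw [H.d_hWord, hL]

/-- A partition of `k < n` has no part `n`. -/
theorem h_hSum_of_lt {n k : ℕ} (hk : k < n) : ⁅Affine.h n, hSum w κ m β k⁆ = 0 := by
  rw [hSum, lie_sum]
  refine Finset.sum_eq_zero fun π _ => ?_
  have hn : n ∉ π.parts.sort (· ≤ ·) := fun h => by
    have := Multiset.single_le_sum (fun _ _ => Nat.zero_le _) _ ((Multiset.mem_sort _).1 h)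
    rw [π.parts_sum] at this
    lia
  rw [lie_smul, H.h_pos_hWord n (by lia), List.count_eq_zero_of_not_mem hn]
  simp

/-- The formal sum of the vectors `∑_π α_π h_π w` is an eigenvector of `hₙ`. -/
theorem h_hSum (hκ : κ ≠ 0) {n : ℕ} (hn : 0 < n) (k : ℕ) :
    ⁅Affine.h n, hSum w κ m β (k + n)⁆ = (-(m : ℂ)) • hSum w κ m β k := by
  have h1 : ∀ π : (k + n).Partition,
      ⁅Affine.h n, alpha κ m β π • hWord w (π.parts.sort (· ≤ ·))⁆ =
        (alpha κ m β π * (2 * n * κ * (π.parts.count n : ℂ))) •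
          hWord w ((π.parts.sort (· ≤ ·)).erase n) := by
    intro π
    rw [lie_smul, H.h_pos_hWord n hn, smul_smul, ← Multiset.coe_count, Multiset.sort_eq]
  rw [hSum, lie_sum, hSum, Finset.smul_sum]
  refine (Finset.sum_of_injOn (addPart n k hn) (addPart_injective n k hn).injOn
    (fun _ _ => Finset.mem_coe.2 (Finset.mem_univ _)) (fun π _ hπ => ?_) fun π _ => ?_).symm
  · have : n ∉ π.parts := fun h => hπ <| by
      obtain ⟨π', h'⟩ := exists_addPart hn π h
      exact ⟨π', by simp, h'⟩
    rw [h1, Multiset.count_eq_zero_of_notMem this]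
    simp
  · rw [h1, alpha_addPart hκ, smul_smul]
    congr 1
    refine hWord_perm w ?_
    rw [← Multiset.coe_eq_coe, ← Multiset.coe_erase, Multiset.sort_eq, Multiset.sort_eq]
    exact (Multiset.erase_cons_head n π.parts).symm

end IsImaginaryHighest

end hSum

namespace FormalTensor

variable {N U : Type*} [AddCommGroup N] [Module ℂ N] [LieRingModule Affine N]
  [LieModule ℂ Affine N] [AddCommGroup U] [Module ℂ U] [LieRingModule Affine U]
  [LieModule ℂ Affine U]

theorem lie_el_apply (n : ℤ) (x : SL2) (ξ : FormalTensor N U) (j : ℤ) :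
    (⁅Affine.el n x, ξ⁆ : FormalTensor N U) j =
      LinearMap.rTensor U (LieModule.toEnd ℂ Affine N (Affine.el n x)) (ξ (j - n)) +
      LinearMap.lTensor N (LieModule.toEnd ℂ Affine U (Affine.el n x)) (ξ j) := by
  change Affine.rep (opT N U) (opCD N U Affine.c) (opCD N U Affine.d) (Affine.el n x) ξ j = _
  rw [Affine.rep_el]
  rfl

theorem lie_c_apply (ξ : FormalTensor N U) (j : ℤ) :
    (⁅Affine.c, ξ⁆ : FormalTensor N U) j =
      LinearMap.rTensor U (LieModule.toEnd ℂ Affine N Affine.c) (ξ j) +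
      LinearMap.lTensor N (LieModule.toEnd ℂ Affine U Affine.c) (ξ j) := by
  change Affine.rep (opT N U) (opCD N U Affine.c) (opCD N U Affine.d) Affine.c ξ j = _
  rw [Affine.rep_c, opCD, LinearMap.add_apply, add_apply, left_apply, sub_zero]
  rfl

theorem lie_d_apply (ξ : FormalTensor N U) (j : ℤ) :
    (⁅Affine.d, ξ⁆ : FormalTensor N U) j =
      LinearMap.rTensor U (LieModule.toEnd ℂ Affine N Affine.d) (ξ j) +
      LinearMap.lTensor N (LieModule.toEnd ℂ Affine U Affine.d) (ξ j) := by
  change Affine.rep (opT N U) (opCD N U Affine.c) (opCD N U Affine.d) Affine.d ξ j = _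
  rw [Affine.rep_d, opCD, LinearMap.add_apply, add_apply, left_apply, sub_zero]
  rfl

end FormalTensor

theorem BinaryForm.slE_u (m : ℕ) : ⁅slE, BinaryForm.u m⁆ = 0 := by
  refine Subtype.ext ?_
  change BinaryForm.der slE (MvPolynomial.X 0 ^ m) = 0
  rw [Derivation.leibniz_pow, BinaryForm.der_X]
  simp [slE, Matrix.single]

theorem BinaryForm.slH_u (m : ℕ) : ⁅slH, BinaryForm.u m⁆ = (m : ℂ) • BinaryForm.u m := by
  refine Subtype.ext ?_
  change BinaryForm.der slH (MvPolynomial.X 0 ^ m) = (m : ℂ) • MvPolynomial.X 0 ^ m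
  rw [Derivation.leibniz_pow, BinaryForm.der_X]
  rcases m with _ | m
  · simp
  · simp [slH, Matrix.single, pow_succ, ← Nat.cast_smul_eq_nsmul ℂ]

theorem Twisted.lie_el_single (Δ : ℂ) (F : Type*) [AddCommGroup F] [Module ℂ F]
    [LieRingModule SL2 F] [LieModule ℂ SL2 F] (n k : ℤ) (x : SL2) (v : F) :
    ⁅Affine.el n x, Twisted.single Δ k v⁆ = Twisted.single Δ (k + n) ⁅x, v⁆ := by
  change Affine.rep (Twisted.opT Δ F) 0 (Twisted.euler Δ F) (Affine.el n x) _ = _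
  rw [Affine.rep_el, Twisted.opT_single]

theorem Twisted.lie_c (Δ : ℂ) (F : Type*) [AddCommGroup F] [Module ℂ F]
    [LieRingModule SL2 F] [LieModule ℂ SL2 F] (u : Twisted Δ F) : ⁅Affine.c, u⁆ = 0 := by
  change Affine.rep (Twisted.opT Δ F) 0 (Twisted.euler Δ F) Affine.c _ = _
  rw [Affine.rep_c, LinearMap.zero_apply]

theorem Twisted.lie_d_single (Δ : ℂ) (F : Type*) [AddCommGroup F] [Module ℂ F]
    [LieRingModule SL2 F] [LieModule ℂ SL2 F] (k : ℤ) (v : F) :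
    ⁅Affine.d, Twisted.single Δ k v⁆ = ((k : ℂ) - Δ) • Twisted.single Δ k v := by
  change Affine.rep (Twisted.opT Δ F) 0 (Twisted.euler Δ F) Affine.d _ = _
  rw [Affine.rep_d, Twisted.euler_single]

section hSharp

variable {N : Type*} [AddCommGroup N] [Module ℂ N] [LieRingModule Affine N] [LieModule ℂ Affine N]

/-- A formal sum is a multiple of `hSharp` if its components are, in degrees `-k ≤ 0` and `j > 0`
separately. -/
theorem eq_smul_hSharp {w : N} {κ : ℂ} {m : ℕ} {β Δ : ℂ}
    {η : FormalTensor N (Twisted Δ (BinaryForm m))} {r : ℂ}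
    (hneg : ∀ k : ℕ, η (-(k : ℤ)) =
      r • (hSum w κ m β k ⊗ₜ[ℂ] Twisted.single Δ (k : ℤ) (BinaryForm.u m)))
    (hpos : ∀ j : ℤ, 0 < j → η j = 0) : η = r • hSharp w κ m β Δ := by
  refine FormalTensor.ext fun j => ?_
  rw [FormalTensor.smul_apply]
  rcases lt_or_ge 0 j with hj | hj
  · rw [hpos j hj, hSharp_of_pos _ _ _ _ _ hj, smul_zero]
  · obtain ⟨k, rfl⟩ : ∃ k : ℕ, j = -(k : ℤ) := ⟨(-j).toNat, by lia⟩
    rw [hneg, hSharp_of_nonneg]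

/-- The formal sum built from an imaginary highest weight vector `w` is again one; `hₙ` with `n > 0`
kills it since its action on the words `h_π w` cancels against `hₙ uᵐ = m zⁿ uᵐ`. -/
theorem IsImaginaryHighest.hSharp {l κ δ : ℂ} {w : N} (H : IsImaginaryHighest l κ δ w)
    (hκ : κ ≠ 0) (m : ℕ) (β Δ : ℂ) :
    IsImaginaryHighest (l + m) κ (δ - Δ) (hSharp w κ m β Δ) where
  lie_e n := by
    rw [← zero_smul ℂ (ImaginaryWakimoto.hSharp w κ m β Δ)]
    have h1 : ∀ j, LinearMap.rTensor (Twisted Δ (BinaryForm m))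
        (LieModule.toEnd ℂ Affine N (Affine.el n slE)) (ImaginaryWakimoto.hSharp w κ m β Δ j) = 0 := by
      intro j
      rcases lt_or_ge 0 j with hj | hj
      · rw [hSharp_of_pos _ _ _ _ _ hj, map_zero]
      · obtain ⟨k, rfl⟩ : ∃ k : ℕ, j = -(k : ℤ) := ⟨(-j).toNat, by lia⟩
        rw [hSharp_of_nonneg, LinearMap.rTensor_tmul, LieModule.toEnd_apply_apply]
        exact (congrArg (· ⊗ₜ[ℂ] _) (H.e_hSum m β n k)).trans (TensorProduct.zero_tmul _ _)
    refine eq_smul_hSharp (fun k => ?_) fun j hj => ?_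
    · rw [Affine.e, FormalTensor.lie_el_apply, h1, hSharp_of_nonneg, LinearMap.lTensor_tmul,
        LieModule.toEnd_apply_apply, Twisted.lie_el_single, BinaryForm.slE_u]
      simp
    · rw [Affine.e, FormalTensor.lie_el_apply, h1, hSharp_of_pos _ _ _ _ _ hj, map_zero, add_zero]
  lie_h_pos n hn := by
    rw [← zero_smul ℂ (ImaginaryWakimoto.hSharp w κ m β Δ)]
    lift n to ℕ using hn.le
    have hn' : 0 < n := by lia
    refine eq_smul_hSharp (fun k => ?_) fun j hj => ?_
    · rw [Affine.h, FormalTensor.lie_el_apply, hSharp_of_nonneg,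
        show -(k : ℤ) - n = -((k + n : ℕ) : ℤ) by push_cast; ring, hSharp_of_nonneg,
        LinearMap.lTensor_tmul, LinearMap.rTensor_tmul, LieModule.toEnd_apply_apply,
        LieModule.toEnd_apply_apply, Twisted.lie_el_single, BinaryForm.slH_u, ← Affine.h,
        H.h_hSum m β hκ hn', map_smul, TensorProduct.tmul_smul, ← TensorProduct.smul_tmul']
      push_cast
      module
    · rw [Affine.h, FormalTensor.lie_el_apply, hSharp_of_pos _ _ _ _ _ hj, map_zero, add_zero]
      rcases lt_or_ge 0 (j - n) with hjn | hjn
      · rw [hSharp_of_pos _ _ _ _ _ hjn, map_zero]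
      · obtain ⟨k, hk⟩ : ∃ k : ℕ, j - n = -(k : ℤ) := ⟨(-(j - n)).toNat, by lia⟩
        rw [hk, hSharp_of_nonneg, LinearMap.rTensor_tmul, LieModule.toEnd_apply_apply, ← Affine.h,
          H.h_hSum_of_lt m β (by lia), TensorProduct.zero_tmul]
  lie_h_zero := by
    refine eq_smul_hSharp (fun k => ?_) fun j hj => ?_
    · rw [Affine.h, FormalTensor.lie_el_apply, sub_zero, hSharp_of_nonneg,
        LinearMap.lTensor_tmul, LinearMap.rTensor_tmul, LieModule.toEnd_apply_apply,
        LieModule.toEnd_apply_apply, Twisted.lie_el_single, BinaryForm.slH_u, ← Affine.h,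
        H.h_zero_hSum, map_smul, TensorProduct.tmul_smul, ← TensorProduct.smul_tmul', add_zero,
        add_smul]
    · rw [Affine.h, FormalTensor.lie_el_apply, sub_zero, hSharp_of_pos _ _ _ _ _ hj, map_zero,
        map_zero, add_zero]
  lie_c := by
    refine eq_smul_hSharp (fun k => ?_) fun j hj => ?_
    · rw [FormalTensor.lie_c_apply, hSharp_of_nonneg,
        LinearMap.lTensor_tmul, LinearMap.rTensor_tmul, LieModule.toEnd_apply_apply,
        LieModule.toEnd_apply_apply, Twisted.lie_c, H.c_hSum, TensorProduct.tmul_zero,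
        TensorProduct.smul_tmul', add_zero]
    · rw [FormalTensor.lie_c_apply, hSharp_of_pos _ _ _ _ _ hj, map_zero, map_zero, add_zero]
  lie_d := by
    refine eq_smul_hSharp (fun k => ?_) fun j hj => ?_
    · rw [FormalTensor.lie_d_apply, hSharp_of_nonneg,
        LinearMap.lTensor_tmul, LinearMap.rTensor_tmul, LieModule.toEnd_apply_apply,
        LieModule.toEnd_apply_apply, Twisted.lie_d_single, H.d_hSum, TensorProduct.tmul_smul,
        ← TensorProduct.smul_tmul']
      push_cast
      module
    · rw [FormalTensor.lie_d_apply, hSharp_of_pos _ _ _ _ _ hj, map_zero, map_zero, add_zero]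

theorem map_hSharp {N' : Type*} [AddCommGroup N'] [Module ℂ N'] [LieRingModule Affine N']
    [LieModule ℂ Affine N'] (φ : N →ₗ⁅ℂ, Affine⁆ N') {m : ℕ} {Δ Δ' : ℂ}
    (g : Twisted Δ (BinaryForm m) →ₗ[ℂ] Twisted Δ' (BinaryForm m))
    (hg : ∀ k v, g (Twisted.single Δ k v) = Twisted.single Δ' k v) (w : N) (κ β : ℂ) (j : ℤ) :
    TensorProduct.map (φ : N →ₗ[ℂ] N') g (hSharp w κ m β Δ j) = hSharp (φ w) κ m β Δ' j := by
  rcases lt_or_ge 0 j with hj | hj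
  · rw [hSharp_of_pos _ _ _ _ _ hj, hSharp_of_pos _ _ _ _ _ hj, map_zero]
  · obtain ⟨k, rfl⟩ : ∃ k : ℕ, j = -(k : ℤ) := ⟨(-j).toNat, by lia⟩
    rw [hSharp_of_nonneg, hSharp_of_nonneg, TensorProduct.map_tmul, hg, ← map_hSum]
    rfl

theorem tmul_ne_zero {V V' : Type*} [AddCommGroup V] [Module ℂ V] [AddCommGroup V']
    [Module ℂ V'] {v : V} {v' : V'} (hv : v ≠ 0) (hv' : v' ≠ 0) : v ⊗ₜ[ℂ] v' ≠ 0 := by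
  intro h
  obtain ⟨φ, hφ⟩ := not_forall.1 (mt (Module.forall_dual_apply_eq_zero_iff ℂ v).1 hv)
  obtain ⟨ψ, hψ⟩ := not_forall.1 (mt (Module.forall_dual_apply_eq_zero_iff ℂ v').1 hv')
  have := congrArg (TensorProduct.lid ℂ ℂ ∘ TensorProduct.map φ ψ) h
  simp [hφ, hψ] at this

theorem hSharp_ne_zero {w : N} (hw : w ≠ 0) (κ : ℂ) (m : ℕ) {β : ℂ} (hβ : β ≠ 0) (Δ : ℂ) :
    hSharp w κ m β Δ ≠ 0 := by
  intro h
  have h1 := hSharp_of_nonneg w κ m β Δ 0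
  rw [h, hSum_zero] at h1
  refine tmul_ne_zero (smul_ne_zero hβ hw) ?_ h1.symm
  refine Finsupp.single_ne_zero.2 fun h2 => ?_
  exact pow_ne_zero m (MvPolynomial.X_ne_zero (0 : Fin 2)) (congrArg Subtype.val h2)

end hSharp

/-! ### Homomorphisms between completed tensor products -/

section intertwined

theorem Verma.hatHom_ext {B : Type*} [AddCommGroup B] [Module ℂ B] [LieRingModule Affine B]
    {l κ : ℂ} {Φ Φ' : Verma l κ →ₗ⁅ℂ, Affine.hat⁆ B}
    (h : Φ (Verma.v l κ) = Φ' (Verma.v l κ)) : Φ = Φ' := by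
  have hQ : LinearMap.eqLocus Φ.toLinearMap Φ'.toLinearMap = ⊤ :=
    Verma.eq_top_of_hat_lie_mem l κ h fun x hx u hu => by
      change Φ u = Φ' u at hu
      change Φ ⁅(⟨x, hx⟩ : Affine.hat), u⁆ = Φ' ⁅(⟨x, hx⟩ : Affine.hat), u⁆
      rw [LieModuleHom.map_lie, LieModuleHom.map_lie, hu]
  exact LieModuleHom.ext fun u =>
    (hQ.symm ▸ Submodule.mem_top : u ∈ LinearMap.eqLocus Φ.toLinearMap Φ'.toLinearMap)

variable {A B : Type*} [AddCommGroup A] [Module ℂ A] [LieRingModule Affine A] [AddCommGroup B]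
  [Module ℂ B] [LieRingModule Affine B]

/-- A `𝔤̃`-homomorphism followed by a `𝔤̂`-linear map. -/
def hatComp {C : Type*} [AddCommGroup C] [Module ℂ C] [LieRingModule Affine C]
    (G : B →ₗ[ℂ] C)
    (hG : ∀ x : Affine, x.dd = 0 → ∀ u, G ⁅x, u⁆ = ⁅x, G u⁆) (φ : A →ₗ⁅ℂ, Affine⁆ B) :
    A →ₗ⁅ℂ, Affine.hat⁆ C where
  toLinearMap := G ∘ₗ (φ : A →ₗ[ℂ] B)
  map_lie' {x u} := by
    change G (φ ⁅(x : Affine), u⁆) = ⁅(x : Affine), G (φ u)⁆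
    rw [LieModuleHom.map_lie, hG _ x.2]

theorem hatComp_apply {C : Type*} [AddCommGroup C] [Module ℂ C] [LieRingModule Affine C]
    (G : B →ₗ[ℂ] C)
    (hG : ∀ x : Affine, x.dd = 0 → ∀ u, G ⁅x, u⁆ = ⁅x, G u⁆) (φ : A →ₗ⁅ℂ, Affine⁆ B) (u : A) :
    hatComp G hG φ u = G (φ u) := rfl

variable [LieModule ℂ Affine A] [LieModule ℂ Affine B]

/-- The subspace of the elements of `𝔤̃` whose action on `u` is intertwined by `Z`. -/
def intertwined (Z : A →ₗ[ℂ] B) (u : A) : Submodule ℂ Affine where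
  carrier := {x | Z ⁅x, u⁆ = ⁅x, Z u⁆}
  add_mem' {x y} (hx : Z ⁅x, u⁆ = ⁅x, Z u⁆) (hy : Z ⁅y, u⁆ = ⁅y, Z u⁆) := by
    change Z ⁅x + y, u⁆ = ⁅x + y, Z u⁆
    rw [add_lie, map_add, hx, hy, add_lie]
  zero_mem' := by
    change Z ⁅(0 : Affine), u⁆ = ⁅(0 : Affine), Z u⁆
    rw [zero_lie, map_zero, zero_lie]
  smul_mem' r x (hx : Z ⁅x, u⁆ = ⁅x, Z u⁆) := by
    change Z ⁅r • x, u⁆ = ⁅r • x, Z u⁆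
    rw [smul_lie, map_smul, hx, smul_lie]

theorem lie_eq_of_el_of_c {Z : A →ₗ[ℂ] B} {u : A}
    (hel : ∀ n x, Z ⁅Affine.el n x, u⁆ = ⁅Affine.el n x, Z u⁆)
    (hc : Z ⁅Affine.c, u⁆ = ⁅Affine.c, Z u⁆) {x : Affine} (hx : x.dd = 0) :
    Z ⁅x, u⁆ = ⁅x, Z u⁆ :=
  Affine.mem_of_dd_eq_zero (Q := intertwined Z u) hel hc hx

theorem lie_eq_of_hat_of_d {Z : A →ₗ[ℂ] B} {u : A}
    (hZ : ∀ x : Affine, x.dd = 0 → Z ⁅x, u⁆ = ⁅x, Z u⁆)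
    (hd : Z ⁅Affine.d, u⁆ = ⁅Affine.d, Z u⁆) (x : Affine) : Z ⁅x, u⁆ = ⁅x, Z u⁆ :=
  Affine.mem_of_mem_of_d_mem (Q := intertwined Z u) hZ hd x

/-- A `𝔤̂`-linear map on a module isomorphic to an imaginary Verma module commutes with `d` as soon as
it does so on the generator: the defect `Z d - d Z` commutes with `𝔤̂`, since `[d, 𝔤̂] ⊆ 𝔤̂`. -/
theorem d_lie_eq_of_generator {l κ : ℂ} (Ψ : Verma l κ ≃ₗ⁅ℂ, Affine⁆ A) {Z : A →ₗ[ℂ] B}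
    (hZ : ∀ x : Affine, x.dd = 0 → ∀ p, Z ⁅x, p⁆ = ⁅x, Z p⁆)
    (hd : Z ⁅Affine.d, Ψ (Verma.v l κ)⁆ = ⁅Affine.d, Z (Ψ (Verma.v l κ))⁆) (p : A) :
    Z ⁅Affine.d, p⁆ = ⁅Affine.d, Z p⁆ := by
  let P := Z ∘ₗ LieModule.toEnd ℂ Affine A Affine.d ∘ₗ (Ψ.toLieModuleHom : Verma l κ →ₗ[ℂ] A)
  let P' := LieModule.toEnd ℂ Affine B Affine.d ∘ₗ Z ∘ₗ (Ψ.toLieModuleHom : Verma l κ →ₗ[ℂ] A)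
  have hQ : LinearMap.eqLocus P P' = ⊤ := by
    refine Verma.eq_top_of_hat_lie_mem l κ hd fun x hx u hu => ?_
    change Z ⁅Affine.d, Ψ.toLieModuleHom u⁆ = ⁅Affine.d, Z (Ψ.toLieModuleHom u)⁆ at hu
    change Z ⁅Affine.d, Ψ.toLieModuleHom ⁅x, u⁆⁆ = ⁅Affine.d, Z (Ψ.toLieModuleHom ⁅x, u⁆)⁆
    rw [LieModuleHom.map_lie, leibniz_lie, map_add, hZ ⁅_, x⁆ rfl, hZ x hx, hZ x hx, hu,
      ← leibniz_lie]
  have h1 : Ψ.symm p ∈ LinearMap.eqLocus P P' := hQ.symm ▸ Submodule.mem_top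
  change Z ⁅Affine.d, Ψ (Ψ.symm p)⁆ = ⁅Affine.d, Z (Ψ (Ψ.symm p))⁆ at h1
  rwa [show Ψ (Ψ.symm p) = p from Ψ.right_inv p] at h1

end intertwined

section CTensor

variable {M M' U U' : Type*} [AddCommGroup M] [Module ℂ M] [AddCommGroup M'] [Module ℂ M']
  [AddCommGroup U] [Module ℂ U] [AddCommGroup U'] [Module ℂ U']

theorem map_lTensor_toEnd [LieRingModule Affine U] [LieModule ℂ Affine U]
    [LieRingModule Affine U'] [LieModule ℂ Affine U'] (f : M →ₗ[ℂ] M') {g : U →ₗ[ℂ] U'} {x : Affine}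
    (hg : ∀ u, g ⁅x, u⁆ = ⁅x, g u⁆) (t : M ⊗[ℂ] U) :
    TensorProduct.map f g (LinearMap.lTensor M (LieModule.toEnd ℂ Affine U x) t) =
      LinearMap.lTensor M' (LieModule.toEnd ℂ Affine U' x) (TensorProduct.map f g t) := by
  induction t using TensorProduct.induction_on with
  | zero => simp
  | tmul v u => simp [hg]
  | add a b ha hb => simp only [map_add, ha, hb]

variable [LieRingModule Affine M] [LieModule ℂ Affine M] [LieRingModule Affine M']
  [LieModule ℂ Affine M']

theorem map_rTensor_toEnd (f : M →ₗ⁅ℂ, Affine⁆ M') (g : U →ₗ[ℂ] U') (x : Affine) (t : M ⊗[ℂ] U) :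
    TensorProduct.map (f : M →ₗ[ℂ] M') g (LinearMap.rTensor U (LieModule.toEnd ℂ Affine M x) t) =
      LinearMap.rTensor U' (LieModule.toEnd ℂ Affine M' x)
        (TensorProduct.map (f : M →ₗ[ℂ] M') g t) := by
  induction t using TensorProduct.induction_on with
  | zero => simp
  | tmul v u => simp
  | add a b ha hb => simp only [map_add, ha, hb]

variable [LieRingModule Affine U] [LieModule ℂ Affine U] [LieRingModule Affine U']
  [LieModule ℂ Affine U']

theorem CTensor.map_apply (s : ℂ) (f : M →ₗ⁅ℂ, Affine⁆ M') (g : U →ₗ[ℂ] U') (ξ : CTensor M s U)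
    (j : ℤ) : (CTensor.map s f g ξ).1 j = TensorProduct.map (f : M →ₗ[ℂ] M') g (ξ.1 j) := rfl

theorem CTensor.map_hSharp (s : ℂ) (f : M →ₗ⁅ℂ, Affine⁆ M') {m : ℕ} {Δ Δ' : ℂ}
    {g : Twisted Δ (BinaryForm m) →ₗ[ℂ] Twisted Δ' (BinaryForm m)}
    (hg : ∀ k v, g (Twisted.single Δ k v) = Twisted.single Δ' k v) {w : M} {κ β : ℂ}
    {ξ : CTensor M s (Twisted Δ (BinaryForm m))} (hξ : ξ.1 = hSharp w κ m β Δ) :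
    (CTensor.map s f g ξ).1 = hSharp (f w) κ m β Δ' := by
  refine FormalTensor.ext fun j => ?_
  rw [CTensor.map_apply, hξ, ImaginaryWakimoto.map_hSharp f g hg]

theorem CTensor.isImaginaryHighest {s l κ δ : ℂ} {ξ : CTensor M s U}
    (H : IsImaginaryHighest l κ δ ξ.1) : IsImaginaryHighest l κ δ ξ where
  lie_e n := Subtype.ext (H.lie_e n)
  lie_h_pos n hn := Subtype.ext (H.lie_h_pos n hn)
  lie_h_zero := Subtype.ext H.lie_h_zero
  lie_c := Subtype.ext H.lie_c
  lie_d := Subtype.ext H.lie_d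

/-- If `f` is a `𝔤̃`-homomorphism and `g` a `𝔤̂`-homomorphism, then `f ⊗̂ g` is a
`𝔤̂`-homomorphism. -/
theorem CTensor.map_lie (s : ℂ) (f : M →ₗ⁅ℂ, Affine⁆ M') {g : U →ₗ[ℂ] U'}
    (hg : ∀ x : Affine, x.dd = 0 → ∀ u, g ⁅x, u⁆ = ⁅x, g u⁆) {x : Affine} (hx : x.dd = 0)
    (ξ : CTensor M s U) : CTensor.map s f g ⁅x, ξ⁆ = ⁅x, CTensor.map s f g ξ⁆ := by
  refine lie_eq_of_el_of_c (fun n x => ?_) ?_ hx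
  · refine Subtype.ext (FormalTensor.ext fun j => ?_)
    change TensorProduct.map (f : M →ₗ[ℂ] M') g ((⁅Affine.el n x, ξ.1⁆ : FormalTensor M U) j) =
      (⁅Affine.el n x, (CTensor.map s f g ξ).1⁆ : FormalTensor M' U') j
    rw [FormalTensor.lie_el_apply, FormalTensor.lie_el_apply, map_add, map_rTensor_toEnd,
      map_lTensor_toEnd _ (hg (Affine.el n x) rfl)]
    rfl
  · refine Subtype.ext (FormalTensor.ext fun j => ?_)
    change TensorProduct.map (f : M →ₗ[ℂ] M') g ((⁅Affine.c, ξ.1⁆ : FormalTensor M U) j) =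
      (⁅Affine.c, (CTensor.map s f g ξ).1⁆ : FormalTensor M' U') j
    rw [FormalTensor.lie_c_apply, FormalTensor.lie_c_apply, map_add, map_rTensor_toEnd,
      map_lTensor_toEnd _ (hg Affine.c rfl)]
    rfl

end CTensor

namespace Twisted

variable (Δ Δ' : ℂ) (F : Type*) [AddCommGroup F] [Module ℂ F]

/-- Multiplication by `z^{Δ-Δ'}`, from `z^{-Δ} F[z, z⁻¹]` to `z^{-Δ'} F[z, z⁻¹]`. -/
def mulPowSub : Twisted Δ F →ₗ[ℂ] Twisted Δ' F := lift Δ F fun n => single Δ' n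

theorem mulPowSub_single (n : ℤ) (v : F) :
    mulPowSub Δ Δ' F (single Δ n v) = single Δ' n v :=
  lift_single _ _ _ _ _

/-- Multiplication by a power of `z` is `𝔤̂`-linear; only `d` sees the shift of the exponents. -/
theorem mulPowSub_lie [LieRingModule SL2 F] [LieModule ℂ SL2 F] (x : Affine) (hx : x.dd = 0)
    (u : Twisted Δ F) : mulPowSub Δ Δ' F ⁅x, u⁆ = ⁅x, mulPowSub Δ Δ' F u⁆ := by
  refine lie_eq_of_el_of_c (fun n x => ?_) ?_ hx
  · have h : mulPowSub Δ Δ' F ∘ₗ LieModule.toEnd ℂ Affine (Twisted Δ F) (Affine.el n x) =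
        LieModule.toEnd ℂ Affine (Twisted Δ' F) (Affine.el n x) ∘ₗ mulPowSub Δ Δ' F :=
      hom_ext Δ fun k v => by
        simp only [LinearMap.comp_apply, LieModule.toEnd_apply_apply, lie_el_single,
          mulPowSub_single]
    exact LinearMap.congr_fun h u
  · rw [lie_c, lie_c, map_zero]

end Twisted

/-! ### The intertwining operators -/

section intertwiner

variable (l κ : ℂ) (m : ℕ) (β : ℂ)

theorem vSharp_val : (vSharp l κ m β).1 = hSharp (Verma.v (l - m) κ) κ m β 0 := rfl

/-- For `Δ = Δ(λ) - Δ(λ-m)` the vector `z^{-Δ} v^♯` is an imaginary highest weight vector of the same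
weight as `v_{λ,κ}`, also with respect to `d`. -/
theorem exists_twisted_vSharp (hκ : κ ≠ 0) :
    ∃ ξ : CTensor (Verma (l - m) κ) (-confWeight (l - m) κ)
        (Twisted (confWeight l κ - confWeight (l - m) κ) (BinaryForm m)),
      ξ.1 = hSharp (Verma.v (l - m) κ) κ m β (confWeight l κ - confWeight (l - m) κ) ∧
      IsImaginaryHighest l κ (-confWeight l κ) ξ := by
  set Δ := confWeight l κ - confWeight (l - m) κ with hΔ
  have H := (Verma.isImaginaryHighest_v (l - m) κ).hSharp hκ m β Δ
  rw [sub_add_cancel, show -confWeight (l - m) κ - Δ = -confWeight l κ by rw [hΔ]; ring] at H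
  have hξ := CTensor.map_hSharp (-confWeight (l - m) κ) LieModuleHom.id
    (Twisted.mulPowSub_single 0 Δ _) (vSharp_val l κ m β)
  refine ⟨_, hξ, CTensor.isImaginaryHighest ?_⟩
  rw [hξ]
  exact H

/-- The intertwiner is the `𝔤̃`-homomorphism into the module twisted by `Δ(λ) - Δ(λ-m)`, followed by
multiplication by a power of `z`. -/
theorem exists_isPhiV (hκ : κ ≠ 0) :
    ∃ Φ : Verma l κ →ₗ⁅ℂ, Affine.hat⁆ CTensor (Verma (l - m) κ) (-confWeight (l - m) κ)
      (Twisted 0 (BinaryForm m)), IsPhiV β Φ := by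
  obtain ⟨ξ, hξ, H⟩ := exists_twisted_vSharp l κ m β hκ
  refine ⟨hatComp (CTensor.map (-confWeight (l - m) κ) LieModuleHom.id
    (Twisted.mulPowSub _ 0 (BinaryForm m)))
    (fun x hx u => CTensor.map_lie _ _ (Twisted.mulPowSub_lie _ 0 _) hx u) (Verma.lift H), ?_⟩
  rw [IsPhiV, hatComp_apply, Verma.lift_v]
  exact Subtype.ext (CTensor.map_hSharp _ LieModuleHom.id (Twisted.mulPowSub_single _ 0 _) hξ)

variable {l κ m β} {Ψ : Verma l κ ≃ₗ⁅ℂ, Affine⁆ Wakimoto l κ}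
  {Ψ' : Verma (l - m) κ ≃ₗ⁅ℂ, Affine⁆ Wakimoto (l - m) κ}
  {Φ : Verma l κ →ₗ⁅ℂ, Affine.hat⁆ CTensor (Verma (l - m) κ) (-confWeight (l - m) κ)
    (Twisted 0 (BinaryForm m))}

theorem zPhiW_apply (Δ : ℂ) (p : Wakimoto l κ) : zPhiW Ψ Ψ' Φ Δ p =
    CTensor.map _ LieModuleHom.id (Twisted.mulPow Δ (BinaryForm m))
      (CTensor.map _ Ψ'.toLieModuleHom LinearMap.id (Φ (Ψ.symm.toLieModuleHom p))) := rfl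

theorem zPhiW_lie_of_dd_eq_zero (Δ : ℂ) {x : Affine} (hx : x.dd = 0) (p : Wakimoto l κ) :
    zPhiW Ψ Ψ' Φ Δ ⁅x, p⁆ = ⁅x, zPhiW Ψ Ψ' Φ Δ p⁆ := by
  have h : ∀ u, Φ ⁅x, u⁆ = ⁅x, Φ u⁆ := fun u => Φ.map_lie ⟨x, hx⟩ u
  have h1 := CTensor.map_lie (-confWeight (l - m) κ) Ψ'.toLieModuleHom
    (g := (LinearMap.id : Twisted 0 (BinaryForm m) →ₗ[ℂ] _)) (fun _ _ _ => rfl) hx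
  have h2 := CTensor.map_lie (-confWeight (l - m) κ) (LieModuleHom.id (M := Wakimoto (l - m) κ))
    (g := Twisted.mulPow Δ (BinaryForm m)) (Twisted.mulPowSub_lie 0 Δ _) hx
  rw [zPhiW_apply, zPhiW_apply, LieModuleHom.map_lie, h, h1, h2]

theorem zPhiW_w_eq_hSharp (hΨ : IsCoxFutorny Ψ) (hΨ' : IsCoxFutorny Ψ') (hΦ : IsPhiV β Φ)
    (Δ : ℂ) : (zPhiW Ψ Ψ' Φ Δ (Wakimoto.w l κ)).1 = hSharp (Wakimoto.w (l - m) κ) κ m β Δ := by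
  have h1 : Ψ.symm.toLieModuleHom (Wakimoto.w l κ) = Verma.v l κ := by
    rw [← (isCoxFutorny_iff Ψ).1 hΨ]
    exact Ψ.left_inv _
  have h2 : Φ (Verma.v l κ) = vSharp l κ m β := hΦ
  have h3 : Ψ'.toLieModuleHom (Verma.v (l - m) κ) = Wakimoto.w (l - m) κ :=
    (isCoxFutorny_iff Ψ').1 hΨ'
  have h4 := CTensor.map_hSharp (-confWeight (l - m) κ) Ψ'.toLieModuleHom
    (g := LinearMap.id) (fun _ _ => rfl) (vSharp_val l κ m β)
  rw [h3] at h4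
  rw [zPhiW_apply, h1, h2]
  exact CTensor.map_hSharp _ LieModuleHom.id (Twisted.mulPowSub_single 0 Δ _) h4

theorem hSharp_w_eq_sharp_b (μ κ : ℂ) (m : ℕ) (β Δ : ℂ) : hSharp (Wakimoto.w μ κ) κ m β Δ =
    sharp (fun k => Wakimoto.b μ κ (-(k : ℤ))) (Wakimoto.w μ κ) κ m β Δ := by
  refine FormalTensor.ext fun j => ?_
  have h : hSum (Wakimoto.w μ κ) κ m β (-j).toNat = ∑ π : (-j).toNat.Partition, alpha κ m β π •
      ((π.parts.sort (· ≤ ·)).map fun k : ℕ => Wakimoto.b μ κ (-(k : ℤ))).prod (Wakimoto.w μ κ) :=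
    Finset.sum_congr rfl fun π _ => congrArg _ (Wakimoto.hWord_w μ κ _).1
  exact if_congr Iff.rfl (congrArg (· ⊗ₜ[ℂ] _) h) rfl

theorem d_lie_zPhiW_w (hκ : κ ≠ 0) (hΨ : IsCoxFutorny Ψ) (hΨ' : IsCoxFutorny Ψ')
    (hΦ : IsPhiV β Φ) (Δ : ℂ) : ⁅Affine.d, zPhiW Ψ Ψ' Φ Δ (Wakimoto.w l κ)⁆ =
      (-confWeight (l - m) κ - Δ) • zPhiW Ψ Ψ' Φ Δ (Wakimoto.w l κ) := by
  have H := (Wakimoto.isImaginaryHighest_w (l - m) κ).hSharp hκ m β Δ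
  rw [← zPhiW_w_eq_hSharp hΨ hΨ' hΦ Δ] at H
  exact (CTensor.isImaginaryHighest H).lie_d

/-- As `z^{-Δ} Φ^W(z)` is `𝔤̂`-linear, it suffices to compare the degrees of the generator `w_{λ,κ}`
and of its image. -/
theorem zPhiW_lie_iff (hκ : κ ≠ 0) (hβ : β ≠ 0) (hΨ : IsCoxFutorny Ψ) (hΨ' : IsCoxFutorny Ψ')
    (hΦ : IsPhiV β Φ) (Δ : ℂ) :
    (∀ (x : Affine) (p : Wakimoto l κ), zPhiW Ψ Ψ' Φ Δ ⁅x, p⁆ = ⁅x, zPhiW Ψ Ψ' Φ Δ p⁆) ↔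
      Δ = confWeight l κ - confWeight (l - m) κ := by
  have hd := d_lie_zPhiW_w hκ hΨ hΨ' hΦ Δ
  constructor
  · intro h
    -- `β ≠ 0` makes the image of `w` nonzero, so that its degree is well defined
    have h0 : zPhiW Ψ Ψ' Φ Δ (Wakimoto.w l κ) ≠ 0 := fun h0 => by
      refine hSharp_ne_zero (w := Wakimoto.w (l - m) κ) (one_ne_zero (α := Fock)) κ m hβ Δ ?_
      rw [← zPhiW_w_eq_hSharp hΨ hΨ' hΦ Δ, h0]
      rfl
    have h1 := h Affine.d (Wakimoto.w l κ)
    rw [hd, Wakimoto.d_w, map_smul] at h1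
    linear_combination smul_left_injective ℂ h0 h1
  · intro hΔ x p
    refine lie_eq_of_hat_of_d (fun x hx => zPhiW_lie_of_dd_eq_zero Δ hx p) ?_ x
    refine d_lie_eq_of_generator Ψ (fun x hx p => zPhiW_lie_of_dd_eq_zero Δ hx p) ?_ p
    rw [(isCoxFutorny_iff Ψ).1 hΨ, hd, Wakimoto.d_w, map_smul]
    congr 1
    rw [hΔ]
    ring

end intertwiner

end ImaginaryWakimoto

end

open ImaginaryWakimoto

theorem mainTheorem4 (l κ : ℂ) (hκ : κ ≠ 0) (hκ2 : κ + 2 ≠ 0) (m : ℕ) (β : ℂ) (hβ : β ≠ 0) :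
    (∀ μ : ℂ, ∃! Ψ : Verma μ κ ≃ₗ⁅ℂ, Affine⁆ Wakimoto μ κ, IsCoxFutorny Ψ) ∧
    (∃! Φ : Verma l κ →ₗ⁅ℂ, Affine.hat⁆ CTensor (Verma (l - m) κ) (-confWeight (l - m) κ)
      (Twisted 0 (BinaryForm m)), IsPhiV β Φ) ∧
    ∀ (Ψ : Verma l κ ≃ₗ⁅ℂ, Affine⁆ Wakimoto l κ)
      (Ψ' : Verma (l - m) κ ≃ₗ⁅ℂ, Affine⁆ Wakimoto (l - m) κ)
      (Φ : Verma l κ →ₗ⁅ℂ, Affine.hat⁆ CTensor (Verma (l - m) κ) (-confWeight (l - m) κ)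
        (Twisted 0 (BinaryForm m))),
      IsCoxFutorny Ψ → IsCoxFutorny Ψ' → IsPhiV β Φ → ∀ Δ : ℂ,
        (∀ (x : Affine.hat) (v : Wakimoto l κ), zPhiW Ψ Ψ' Φ Δ ⁅x, v⁆ = ⁅x, zPhiW Ψ Ψ' Φ Δ v⁆) ∧
        (zPhiW Ψ Ψ' Φ Δ (Wakimoto.w l κ)).1 =
          sharp (fun k => Wakimoto.b (l - m) κ (-(k : ℤ))) (Wakimoto.w (l - m) κ) κ m β Δ ∧
        ((∀ (x : Affine) (v : Wakimoto l κ), zPhiW Ψ Ψ' Φ Δ ⁅x, v⁆ = ⁅x, zPhiW Ψ Ψ' Φ Δ v⁆) ↔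
          Δ = confWeight l κ - confWeight (l - m) κ) := by
  refine ⟨fun μ => existsUnique_coxFutorny μ κ, ?_, fun Ψ Ψ' Φ hΨ hΨ' hΦ Δ => ⟨?_, ?_, ?_⟩⟩
  · obtain ⟨Φ, hΦ⟩ := exists_isPhiV l κ m β hκ
    exact ⟨Φ, hΦ, fun Φ' hΦ' => Verma.hatHom_ext (hΦ'.trans hΦ.symm)⟩
  · exact fun x v => zPhiW_lie_of_dd_eq_zero Δ x.2 v
  · rw [zPhiW_w_eq_hSharp hΨ hΨ' hΦ, hSharp_w_eq_sharp_b]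
  · exact zPhiW_lie_iff hκ hβ hΨ hΨ' hΦ Δ
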